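/- Let $m,n,s,d\ge 1$ be integers. Let $\delta_{ij}$ and $\sigma_{ij}$ ($1\le i\le m$, $1\le j\le n$) be random variables on a probability space with the following properties. The $\delta_{ij}$ take values in $\{0,1\}$; $\mathbb{E}\,\delta_{ij}=s/m$; $\mathbb{E}\prod_{i\in I}\delta_{ij}\le (s/m)^{|I|}$ for every $j$ and every $I\subseteq\{1,\dots,m\}$; $\sum_{i=1}^m\delta_{ij}=s$ almost surely for every $j$; and the columns $(\delta_{ij})_{i=1}^m$, $j=1,\dots,n$, are independent. The $\sigma_{ij}$ are independent Rademacher variables, and $(\sigma_{ij})$ is independent of $(\delta_{ij})$. The sparse Johnson–Lindenstrauss transform $\Phi\in\mathbb{R}^{m\times n}$ with column sparsity $s$ is $\Phi_{ij}=s^{-1/2}\sigma_{ij}\delta_{ij}$. Put $$\|x\|_\delta=\frac1{\sqrt s}\max_{1\le i\le m}\Big(\sum_{j=1}^n\delta_{ij}x_j^2\Big)^{1/2},\qquad x\in\mathbb{R}^n.$$ Let $E\subseteq\mathbb{R}^n$ be a $d$-dimensional linear subspace, $P_E$ the orthogonal projection onto $E$, $T=\{x\in E:\|x\|_2=1\}$,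 $\mu(E)=\max_{1\le j\le n}\|P_Ee_j\|_2$ and $d_\delta(T)=\sup_{x,y\in T}\|x-y\|_\delta$. Let $$\gamma_2(T,\|\cdot\|_\delta)=\inf\ \sup_{x\in T}\sum_{r\ge0}2^{r/2}\inf_{y\in T_r}\|x-y\|_\delta,$$ where the outer infimum is over all $T_0\subseteq T_1\subseteq\dots\subseteq T$ with $|T_0|=1$ and $|T_r|\le 2^{2^r}$. There is a universal constant $C>0$ such that, for all such data, the following hold. (i) For all $p>0$ with $p\ge\log m$ and all $0<\varepsilon<1$, $$\big(\mathbb{E}\,\gamma_2(T,\|\cdot\|_\delta)^{2p}\big)^{1/p}\le C\Big(\varepsilon^2+\frac{(d+\log m)\log^2(d/\varepsilon)}{m}+\frac{p\,\log^2(d/\varepsilon)\log m}{s}\,\mu(E)^2\Big).$$ (ii) For all $p>0$ with $p\ge\log m$, $$\big(\mathbb{E}\,d_\delta(T)^{2p}\big)^{1/p}\le C\Big(\frac dm+\frac ps\,\mu(E)^2\Big).$$ (iii) Let $0<\varepsilon<1$ and $0<\eta\le\min\{1/m,1/2\}$, and put $L=\min\{\log^2(d/\varepsilon),\log^2 m\}$.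 If $$m\ge C\,\frac{(d+\log m)\,L+d\log(1/\eta)}{\varepsilon^2}\qquad\text{and}\qquad s\ge C\,\frac{\big(\log(m)\log(1/\eta)\,L+\log^2(1/\eta)\big)\,\mu(E)^2}{\varepsilon^2},$$ then, with probability at least $1-\eta$, $\ \sup_{x\in T}\big|\|\Phi x\|_2^2-1\big|<\varepsilon$. (iv) In particular, column sparsity $s=1$ suffices for sufficiently incoherent $E$: with $\varepsilon,\eta,L$ as in (iii), if $s=1$, $m$ satisfies the condition in (iii), and $$C\big(\log(m)\log(1/\eta)\,L+\log^2(1/\eta)\big)\,\mu(E)^2\le\varepsilon^2,$$ then $\sup_{x\in T}|\|\Phi x\|_2^2-1|<\varepsilon$ with probability at least $1-\eta$. -/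

import Mathlib

open MeasureTheory ProbabilityTheory
open scoped ENNReal

noncomputable section

/-- A sequence `S₀ ⊆ S₁ ⊆ … ⊆ S` with `|S₀| = 1` and `|Sᵣ| ≤ 2 ^ (2 ^ r)`. -/
structure IsAdmissibleSeq {X : Type*} (S : Set X) (A : ℕ → Set X) : Prop where
  mono : Monotone A
  subset : ∀ r, A r ⊆ S
  card_zero : (A 0).encard = 1
  card_le : ∀ r, (A r).encard ≤ ((2 ^ 2 ^ r : ℕ) : ℕ∞)

/-- Talagrand's functional `γ₂(S, ρ)`: the infimum over admissible sequences `(Sᵣ)` in `S` of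
`sup_{x ∈ S} ∑ᵣ 2^{r/2} ρ(x, Sᵣ)`, with `ρ(x, Sᵣ) = inf_{y ∈ Sᵣ} ρ(x, y)`. -/
def gammaTwo {X : Type*} (S : Set X) (ρ : X → X → ℝ≥0∞) : ℝ≥0∞ :=
  ⨅ (A : ℕ → Set X) (_ : IsAdmissibleSeq S A),
    ⨆ x ∈ S, ∑' r : ℕ, (2 : ℝ≥0∞) ^ ((r : ℝ) / 2) * ⨅ y ∈ A r, ρ x y

/-- The diameter of `S` with respect to `ρ`. -/
def diamTwo {X : Type*} (S : Set X) (ρ : X → X → ℝ≥0∞) : ℝ≥0∞ :=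
  ⨆ x ∈ S, ⨆ y ∈ S, ρ x y

/-- The seminorm `‖x‖_δ = s^{-1/2} max_i (∑_j δ_{ij} x_j²)^{1/2}` attached to a 0/1 pattern. -/
def deltaNorm {m n : ℕ} (s : ℕ) (D : Fin m → Fin n → ℝ) (x : EuclideanSpace ℝ (Fin n)) : ℝ :=
  1 / √(s : ℝ) * ⨆ i : Fin m, √(∑ j : Fin n, D i j * x j ^ 2)

/-- The semimetric `(x, y) ↦ ‖x - y‖_δ`. -/
def deltaDist {m n : ℕ} (s : ℕ) (D : Fin m → Fin n → ℝ)
    (x y : EuclideanSpace ℝ (Fin n)) : ℝ≥0∞ :=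
  ENNReal.ofReal (deltaNorm s D (x - y))

/-- The unit sphere `E ∩ S^{n-1}` of a subspace. -/
def unitSphereOf {n : ℕ} (E : Submodule ℝ (EuclideanSpace ℝ (Fin n))) :
    Set (EuclideanSpace ℝ (Fin n)) :=
  {x | x ∈ E ∧ ‖x‖ = 1}

/-- The incoherence (maximum leverage score) `μ(E) = max_j ‖P_E e_j‖₂`. -/
def incoherence {n : ℕ} (E : Submodule ℝ (EuclideanSpace ℝ (Fin n))) : ℝ :=
  ⨆ j : Fin n, ‖E.starProjection (EuclideanSpace.single j (1 : ℝ))‖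

/-- The random variables `δ_{ij}` and `σ_{ij}` from which a sparse Johnson-Lindenstrauss transform
with column sparsity `s` is built. -/
structure IsSJLTData {Ω : Type*} [MeasurableSpace Ω] (P : Measure Ω) {m n : ℕ} (s : ℕ)
    (δ σ : Fin m → Fin n → Ω → ℝ) : Prop where
  measurable_pattern : ∀ i j, Measurable (δ i j)
  pattern_zero_one : ∀ i j ω, δ i j ω = 0 ∨ δ i j ω = 1
  pattern_mean : ∀ i j, ∫ ω, δ i j ω ∂P = (s : ℝ) / m
  pattern_neg_corr : ∀ (j : Fin n) (I : Finset (Fin m)),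
    ∫ ω, ∏ i ∈ I, δ i j ω ∂P ≤ ((s : ℝ) / m) ^ I.card
  pattern_col_sum : ∀ j, ∀ᵐ ω ∂P, ∑ i, δ i j ω = s
  pattern_indep_cols : iIndepFun (fun (j : Fin n) (ω : Ω) (i : Fin m) => δ i j ω) P
  measurable_sign : ∀ i j, Measurable (σ i j)
  sign_one : ∀ i j, P {ω | σ i j ω = 1} = 1 / 2
  sign_neg_one : ∀ i j, P {ω | σ i j ω = -1} = 1 / 2
  sign_indep : iIndepFun (fun (q : Fin m × Fin n) (ω : Ω) => σ q.1 q.2 ω) P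
  pattern_indep_sign : IndepFun (fun (ω : Ω) (q : Fin m × Fin n) => δ q.1 q.2 ω)
    (fun (ω : Ω) (q : Fin m × Fin n) => σ q.1 q.2 ω) P

/-- The matrix `Φ_{ij} = s^{-1/2} σ_{ij} δ_{ij}`. -/
def sjltMatrix {m n : ℕ} (s : ℕ) (D S : Fin m → Fin n → ℝ) : Matrix (Fin m) (Fin n) ℝ :=
  Matrix.of fun i j => 1 / √(s : ℝ) * S i j * D i j

/-- The restricted isometry constant `sup_{x ∈ T} | ‖Φ x‖₂² - 1 |`. -/
def restrictedIsometryConst {m n : ℕ} (Φ : Matrix (Fin m) (Fin n) ℝ)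
    (T : Set (EuclideanSpace ℝ (Fin n))) : ℝ≥0∞ :=
  ⨆ x ∈ T, ENNReal.ofReal |‖WithLp.toLp 2 (Φ.mulVec x.ofLp)‖ ^ 2 - 1|

end

/-! ### Rank one updates of positive operators and traces of their powers. -/

section RankOneUpdates

open scoped InnerProductSpace

variable {H : Type*} [NormedAddCommGroup H] [InnerProductSpace ℝ H]

/-! Fix the pattern δ and put v_j = P_E e_j. On E the square of ‖·‖_δ is the maximum over the rows i
of the quadratic forms of T_i = s⁻¹ ∑_j δ_ij v_j v_jᵀ. Two row statistics therefore govern the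
geometry: the mass ∑_j δ_ij ‖v_j‖², which is s times the trace of T_i, and the energy, which is s
times its norm. The mass alone bounds the diameter.

For γ₂ (`gammaTwo_sphere_le`), let G² be of the order of max trace + max norm · log m. A dual
Sudakov argument (`card_le_of_quadratic_separated`) gives nets of radius about G 2^{-r/2} at level
r, so every level costs about G. After about log(d/ε) levels volumetric nets take over and leave a
geometric tail of order ε. Hence γ₂ is at most a constant times ε + G log(d/ε).

The row statistics are controlled through trace moments (`integral_trace_weightedFrame_pow_le`).
Within a row the entries are independent with mean s/m, and the v_j form a Parseval frame. Peeling
one factor off the k-th power isolates one column j; comparing the update by v_j v_jᵀ with the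
update by μ² times the identity decouples it, and a binomial recursion gives d(s/m + kμ²)^k. The
same theorem in dimension one treats the mass. For k ≥ log m the sum over the m rows costs only a
constant factor in the k-th root.

For the embedding, condition on δ: ‖Φx‖² - 1 is a Rademacher chaos of order two. A random splitting
of the signs turns it into a decoupled bilinear form, and chaining with Khintchine's inequality in
the metric ‖·‖_δ, started at the level matching the moment, bounds the moments of its supremum Z by
those of sup ‖Φx‖ (`expect_chaos_pow_le_mul`). As sup ‖Φx‖² ≤ 1 + Z, this is a quadratic inequality
for the moment of Z, which `expect_chaos_pow_le` solves. Markov's inequality and the exclusion of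
patterns with large row statistics finish the proof. -/

/-- The rank one operator `x ↦ ⟪v, x⟫ v`. -/
noncomputable def rankOneSq (v : H) : H →ₗ[ℝ] H := (innerₛₗ ℝ v).smulRight v

@[simp] lemma rankOneSq_apply (v x : H) : rankOneSq v x = ⟪v, x⟫_ℝ • v := rfl

lemma rankOneSq_isPositive (v : H) : (rankOneSq v).IsPositive := by
  refine ⟨fun x y => ?_, fun x => ?_⟩
  · simp [inner_smul_left, inner_smul_right, real_inner_comm, mul_comm]
  · simp only [rankOneSq_apply, inner_smul_left, RCLike.re_to_real, RCLike.conj_to_real]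
    exact mul_self_nonneg _

/-- Chebyshev's association inequality for similarly ordered sequences with weights. -/
lemma sum_mul_sum_le_of_monovary {ι : Type*} [Fintype ι] (w f g : ι → ℝ) (hw : ∀ i, 0 ≤ w i)
    (h : ∀ i j, 0 ≤ (f i - f j) * (g i - g j)) :
    (∑ i, w i * f i) * (∑ i, w i * g i) ≤ (∑ i, w i) * ∑ i, w i * (f i * g i) := by
  have key : 0 ≤ ∑ i, ∑ j, w i * w j * ((f i - f j) * (g i - g j)) :=
    Finset.sum_nonneg fun i _ => Finset.sum_nonneg fun j _ =>
      mul_nonneg (mul_nonneg (hw i) (hw j)) (h i j)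
  have e : ∑ i, ∑ j, w i * w j * ((f i - f j) * (g i - g j)) =
      2 * ((∑ i, w i) * ∑ i, w i * (f i * g i)) - 2 * ((∑ i, w i * f i) * ∑ i, w i * g i) := by
    have e1 : ∀ i j, w i * w j * ((f i - f j) * (g i - g j)) =
        (w i * (f i * g i)) * w j + w i * (w j * (f j * g j))
          - ((w i * f i) * (w j * g j) + (w i * g i) * (w j * f j)) := fun i j => by ring
    simp only [e1, Finset.sum_sub_distrib, Finset.sum_add_distrib, ← Finset.sum_mul_sum]
    ring
  linarith

/-- Words in `A` and `B` are sorted by the position of their first `B`, so no commutativity is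
needed. -/
lemma add_pow_eq_pow_add_sum (A B : H →ₗ[ℝ] H) (k : ℕ) :
    (A + B) ^ k = A ^ k + ∑ i ∈ Finset.range k, A ^ i * B * (A + B) ^ (k - 1 - i) := by
  induction k with
  | zero => simp
  | succ k ih =>
    rw [Finset.sum_range_succ']
    have : ∑ i ∈ Finset.range k, A ^ (i + 1) * B * (A + B) ^ (k + 1 - 1 - (i + 1)) =
        A * ∑ i ∈ Finset.range k, A ^ i * B * (A + B) ^ (k - 1 - i) := by
      rw [Finset.mul_sum]
      refine Finset.sum_congr rfl fun i _ => ?_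
      rw [pow_succ', show k + 1 - 1 - (i + 1) = k - 1 - i by omega]
      simp only [mul_assoc]
    rw [this]
    have h2 : (A + B) ^ (k + 1) = A * (A + B) ^ k + B * (A + B) ^ k := by
      rw [pow_succ', add_mul]
    rw [h2]
    nth_rewrite 1 [ih]
    simp only [pow_zero, one_mul, Nat.sub_zero, Nat.add_sub_cancel, pow_succ', mul_add]
    abel

/-- The rank one factor in the middle of each word splits the pairing into a product of two scalars.
With `c • 1` in its place the pairing stays in one piece; the two expansions are later compared term
by term. -/
lemma inner_add_rankOneSq_pow {A : H →ₗ[ℝ] H} (k : ℕ) (v : H) :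
    ⟪v, ((A + rankOneSq v) ^ k) v⟫_ℝ = ⟪v, (A ^ k) v⟫_ℝ + ∑ i ∈ Finset.range k,
      ⟪v, (A ^ i) v⟫_ℝ * ⟪v, ((A + rankOneSq v) ^ (k - 1 - i)) v⟫_ℝ := by
  rw [add_pow_eq_pow_add_sum, LinearMap.add_apply, inner_add_right, LinearMap.sum_apply, inner_sum]
  congr 1
  refine Finset.sum_congr rfl fun i _ => ?_
  simp [Module.End.mul_apply, inner_smul_right, mul_comm]

lemma inner_add_smul_pow {A : H →ₗ[ℝ] H} (c : ℝ) (k : ℕ) (v : H) :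
    ⟪v, ((A + c • 1) ^ k) v⟫_ℝ = ⟪v, (A ^ k) v⟫_ℝ + ∑ i ∈ Finset.range k,
      c * ⟪v, (A ^ i * (A + c • 1) ^ (k - 1 - i)) v⟫_ℝ := by
  rw [add_pow_eq_pow_add_sum, LinearMap.add_apply, inner_add_right, LinearMap.sum_apply, inner_sum]
  congr 1
  refine Finset.sum_congr rfl fun i _ => ?_
  simp [Module.End.mul_apply, inner_smul_right]

lemma inner_add_smul_pow_eq_sum_choose (A : H →ₗ[ℝ] H) (c : ℝ) (k : ℕ) (v : H) :
    ⟪v, ((A + c • 1) ^ k) v⟫_ℝ =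
      ∑ l ∈ Finset.range (k + 1), (k.choose l : ℝ) * c ^ (k - l) * ⟪v, (A ^ l) v⟫_ℝ := by
  have hcomm : Commute A (c • (1 : H →ₗ[ℝ] H)) := (Commute.one_right A).smul_right c
  rw [hcomm.add_pow, LinearMap.sum_apply, inner_sum]
  refine Finset.sum_congr rfl fun l _ => ?_
  have : A ^ l * (c • (1 : H →ₗ[ℝ] H)) ^ (k - l) * ((k.choose l : ℕ) : H →ₗ[ℝ] H)
      = ((k.choose l : ℝ) * c ^ (k - l)) • A ^ l := by
    rw [smul_pow, one_pow, mul_smul_comm, mul_one, ← nsmul_eq_mul', mul_smul, ← Nat.cast_smul_eq_nsmul ℝ]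
  rw [this, LinearMap.smul_apply, inner_smul_right]

/-- The operator `∑ⱼ Dⱼ vⱼ vⱼᵀ`. -/
noncomputable def weightedFrame {ι : Type*} [Fintype ι] (v : ι → H) (D : ι → ℝ) : H →ₗ[ℝ] H :=
  ∑ j, D j • rankOneSq (v j)

variable [FiniteDimensional ℝ H]

/-- The weights are the spectral measure of `v`; operator inequalities at `v` become scalar
inequalities on the spectrum. -/
lemma LinearMap.IsSymmetric.inner_pow_mul_pow {T : H →ₗ[ℝ] H} (hT : T.IsSymmetric) (c : ℝ)
    (i j : ℕ) (v : H) :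
    ⟪v, (T ^ i * (T + c • 1) ^ j) v⟫_ℝ =
      ∑ l, ⟪hT.eigenvectorBasis rfl l, v⟫_ℝ ^ 2 *
        (hT.eigenvalues rfl l ^ i * (hT.eigenvalues rfl l + c) ^ j) := by
  set b := hT.eigenvectorBasis rfl
  set a := hT.eigenvalues rfl
  have hb : ∀ l, T (b l) = a l • b l := fun l => by
    exact hT.apply_eigenvectorBasis rfl l
  have h1 : ∀ l j, ((T + c • 1) ^ j) (b l) = (a l + c) ^ j • b l := by
    intro l j
    induction j with
    | zero => simp
    | succ j ih => rw [pow_succ', Module.End.mul_apply, ih]; simp [hb, ← add_smul, smul_smul, pow_succ]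
  have h2 : ∀ l i, (T ^ i) (b l) = a l ^ i • b l := by
    intro l i
    induction i with
    | zero => simp
    | succ j ih => rw [pow_succ', Module.End.mul_apply, ih]; simp [hb, smul_smul, pow_succ]
  have h3 : (T ^ i * (T + c • 1) ^ j) v = ∑ l, ⟪b l, v⟫_ℝ • (a l ^ i * (a l + c) ^ j) • b l := by
    conv_lhs => rw [← b.sum_repr' v]
    simp only [map_sum, map_smul, Module.End.mul_apply, h1, h2, smul_smul]
    refine Finset.sum_congr rfl fun l _ => ?_
    congr 1; ring
  rw [h3, inner_sum]
  refine Finset.sum_congr rfl fun l _ => ?_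
  rw [inner_smul_right, inner_smul_right, real_inner_comm]
  ring

/-- Chebyshev's association inequality for the spectral measure of `v`, of total mass ‖v‖²: both t^i
and (t + c)^j increase on the nonnegative spectrum. -/
lemma LinearMap.IsPositive.inner_pow_mul_inner_pow_le {T : H →ₗ[ℝ] H} (hT : T.IsPositive) {c : ℝ}
    (hc : 0 ≤ c) (i j : ℕ) (v : H) :
    ⟪v, (T ^ i) v⟫_ℝ * ⟪v, ((T + c • 1) ^ j) v⟫_ℝ ≤ ‖v‖ ^ 2 * ⟪v, (T ^ i * (T + c • 1) ^ j) v⟫_ℝ := by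
  have hs := hT.isSymmetric
  have h0 := hs.inner_pow_mul_pow c 0 0 v
  have h1 := hs.inner_pow_mul_pow c i 0 v
  have h2 := hs.inner_pow_mul_pow c 0 j v
  simp only [pow_zero, mul_one, one_mul, Module.End.one_apply, real_inner_self_eq_norm_sq] at h0 h1 h2
  rw [h0, h1, h2, hs.inner_pow_mul_pow c i j v]
  refine sum_mul_sum_le_of_monovary _ _ _ (fun l => sq_nonneg _) fun k l => ?_
  have hk := hT.nonneg_eigenvalues rfl k
  have hl := hT.nonneg_eigenvalues rfl l
  rcases le_total (hs.eigenvalues rfl k) (hs.eigenvalues rfl l) with h | h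
  · refine mul_nonneg_of_nonpos_of_nonpos ?_ ?_
    · have := pow_le_pow_left₀ hk h i; linarith
    · have := pow_le_pow_left₀ (add_nonneg hk hc) (add_le_add_left h c) j; linarith
  · refine mul_nonneg ?_ ?_
    · have := pow_le_pow_left₀ hl h i; linarith
    · have := pow_le_pow_left₀ (add_nonneg hl hc) (add_le_add_left h c) j; linarith

lemma LinearMap.IsPositive.inner_pow_nonneg {T : H →ₗ[ℝ] H} (hT : T.IsPositive) (k : ℕ) (v : H) :
    0 ≤ ⟪v, (T ^ k) v⟫_ℝ := by
  have := hT.isSymmetric.inner_pow_mul_pow 0 k 0 v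
  simp only [pow_zero, mul_one] at this
  rw [this]
  exact Finset.sum_nonneg fun l _ => mul_nonneg (sq_nonneg _) (pow_nonneg (hT.nonneg_eigenvalues rfl l) _)

/-- Powers of a rank one update are dominated by powers of a multiple of the identity added. -/
lemma LinearMap.IsPositive.inner_add_rankOneSq_pow_le {A : H →ₗ[ℝ] H} (hA : A.IsPositive) {c : ℝ}
    {v : H} (hv : ‖v‖ ^ 2 ≤ c) (k : ℕ) :
    ⟪v, ((A + rankOneSq v) ^ k) v⟫_ℝ ≤ ⟪v, ((A + c • 1) ^ k) v⟫_ℝ := by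
  have hc : 0 ≤ c := (sq_nonneg _).trans hv
  induction k using Nat.strong_induction_on with
  | _ k ih =>
    rw [inner_add_rankOneSq_pow, inner_add_smul_pow]
    refine add_le_add le_rfl (Finset.sum_le_sum fun i hi => ?_)
    rw [Finset.mem_range] at hi
    -- The induction hypothesis replaces the second factor, association merges the two factors at
    -- the price ‖v‖², and ‖v‖² ≤ c turns that price into the weight of the matching term.
    calc _ ≤ ⟪v, (A ^ i) v⟫_ℝ * ⟪v, ((A + c • 1) ^ (k - 1 - i)) v⟫_ℝ :=
          mul_le_mul_of_nonneg_left (ih _ (by omega)) (hA.inner_pow_nonneg _ _)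
      _ ≤ _ := hA.inner_pow_mul_inner_pow_le hc _ _ _
      _ ≤ _ := by
        refine mul_le_mul_of_nonneg_right hv ?_
        have := hA.isSymmetric.inner_pow_mul_pow c i (k - 1 - i) v
        rw [this]
        refine Finset.sum_nonneg fun l _ => mul_nonneg (sq_nonneg _) ?_
        have := hA.nonneg_eigenvalues rfl l
        positivity

/-- Powers are not operator monotone in general, but tested on the updating vector itself every
extra term is a product of nonnegative scalars. -/
lemma LinearMap.IsPositive.inner_pow_le_add_rankOneSq {A : H →ₗ[ℝ] H} (hA : A.IsPositive)
    (v : H) (k : ℕ) :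
    ⟪v, (A ^ k) v⟫_ℝ ≤ ⟪v, ((A + rankOneSq v) ^ k) v⟫_ℝ := by
  rw [inner_add_rankOneSq_pow]
  refine le_add_of_nonneg_right (Finset.sum_nonneg fun i _ => mul_nonneg (hA.inner_pow_nonneg _ _) ?_)
  exact (hA.add (rankOneSq_isPositive v)).inner_pow_nonneg _ _

/-- Peeling off one factor exposes each weight linearly, which is what lets a single column be
decoupled under the expectation. -/
lemma trace_weightedFrame_pow_succ {ι : Type*} [Fintype ι] (v : ι → H) (D : ι → ℝ) (k : ℕ) :
    LinearMap.trace ℝ H (weightedFrame v D ^ (k + 1)) =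
      ∑ j, D j * ⟪v j, (weightedFrame v D ^ k) (v j)⟫_ℝ := by
  set b := stdOrthonormalBasis ℝ H
  rw [LinearMap.trace_eq_sum_inner _ b]
  have h : ∀ l, ⟪b l, (weightedFrame v D ^ (k + 1)) (b l)⟫_ℝ =
      ∑ j, D j * (⟪v j, b l⟫_ℝ * ⟪b l, (weightedFrame v D ^ k) (v j)⟫_ℝ) := fun l => by
    rw [pow_succ, Module.End.mul_apply]
    nth_rewrite 2 [weightedFrame]
    simp [LinearMap.sum_apply, map_sum, inner_sum, inner_smul_right]
  simp only [h]
  rw [Finset.sum_comm]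
  refine Finset.sum_congr rfl fun j _ => ?_
  rw [← Finset.mul_sum, b.sum_inner_mul_inner]

lemma sum_inner_of_tight {ι : Type*} [Fintype ι] {v : ι → H} {Λ : ℝ}
    (hv : ∀ x, ∑ j, ⟪v j, x⟫_ℝ • v j = Λ • x) (X : H →ₗ[ℝ] H) :
    ∑ j, ⟪v j, X (v j)⟫_ℝ = Λ * LinearMap.trace ℝ H X := by
  set b := stdOrthonormalBasis ℝ H
  rw [LinearMap.trace_eq_sum_inner _ b, Finset.mul_sum]
  have h : ∀ j, ⟪v j, X (v j)⟫_ℝ = ∑ l, ⟪v j, b l⟫_ℝ * ⟪b l, X (v j)⟫_ℝ := fun j =>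
    (b.sum_inner_mul_inner _ _).symm
  simp only [h]
  rw [Finset.sum_comm]
  refine Finset.sum_congr rfl fun l _ => ?_
  have := congrArg (fun y => ⟪b l, X y⟫_ℝ) (hv (b l))
  simpa [map_sum, inner_sum, inner_smul_right] using this

/-- Jensen's inequality for the spectral measure of `x`, whose weights are at most one. This is how
trace moments control the energy of a row uniformly over the sphere. -/
lemma LinearMap.IsPositive.inner_pow_le_trace_pow {T : H →ₗ[ℝ] H} (hT : T.IsPositive) (k : ℕ)
    {x : H} (hx : ‖x‖ = 1) : ⟪x, T x⟫_ℝ ^ k ≤ LinearMap.trace ℝ H (T ^ k) := by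
  have hs := hT.isSymmetric
  set b := hs.eigenvectorBasis rfl with hb
  set a := hs.eigenvalues rfl with ha
  have ha0 : ∀ l, 0 ≤ a l := hT.nonneg_eigenvalues rfl
  have h1 := hs.inner_pow_mul_pow 0 1 0 x
  simp only [pow_one, pow_zero, mul_one] at h1
  have hw : ∑ l, ⟪b l, x⟫_ℝ ^ 2 = 1 := by
    have := hs.inner_pow_mul_pow 0 0 0 x
    simp only [pow_zero, mul_one, Module.End.one_apply, real_inner_self_eq_norm_sq, hx,
      one_pow] at this
    exact this.symm
  have htr : LinearMap.trace ℝ H (T ^ k) = ∑ l, a l ^ k := by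
    rw [LinearMap.trace_eq_sum_inner _ b]
    refine Finset.sum_congr rfl fun l _ => ?_
    have : (T ^ k) (b l) = a l ^ k • b l := by
      induction k with
      | zero => simp
      | succ j ih =>
        have hbl : T (b l) = a l • b l := hs.apply_eigenvectorBasis rfl l
        rw [pow_succ', Module.End.mul_apply, ih]; simp [hbl, smul_smul, pow_succ]
    simp [this, inner_smul_right]
  rw [htr, h1]
  calc _ ≤ ∑ l, ⟪b l, x⟫_ℝ ^ 2 * a l ^ k :=
        Real.pow_arith_mean_le_arith_mean_pow _ _ _ (fun l _ => sq_nonneg _) hw (fun l _ => ha0 l) k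
    _ ≤ ∑ l, a l ^ k := by
      refine Finset.sum_le_sum fun l _ => ?_
      have : ⟪b l, x⟫_ℝ ^ 2 ≤ 1 := hw ▸ Finset.single_le_sum (f := fun l => ⟪b l, x⟫_ℝ ^ 2)
        (fun l _ => sq_nonneg _) (Finset.mem_univ l)
      exact mul_le_of_le_one_left (pow_nonneg (ha0 l) k) this

omit [FiniteDimensional ℝ H] in
lemma weightedFrame_isPositive {ι : Type*} [Fintype ι] (v : ι → H) {D : ι → ℝ} (hD : ∀ j, 0 ≤ D j) :
    (weightedFrame v D).IsPositive :=
  LinearMap.isPositive_sum _ fun j _ => (rankOneSq_isPositive (v j)).smul_of_nonneg (hD j)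

lemma trace_weightedFrame_pow_nonneg {ι : Type*} [Fintype ι] (v : ι → H) {D : ι → ℝ}
    (hD : ∀ j, 0 ≤ D j) (k : ℕ) : 0 ≤ LinearMap.trace ℝ H (weightedFrame v D ^ k) := by
  rw [LinearMap.trace_eq_sum_inner _ (stdOrthonormalBasis ℝ H)]
  exact Finset.sum_nonneg fun l _ => (weightedFrame_isPositive v hD).inner_pow_nonneg _ _

omit [FiniteDimensional ℝ H] in
lemma continuous_weightedFrame_pow {ι : Type*} [Fintype ι] (v : ι → H) (k : ℕ) (x : H) :
    Continuous fun D : ι → ℝ => (weightedFrame v D ^ k) x := by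
  induction k with
  | zero => simpa using continuous_const
  | succ k ih =>
    simp only [pow_succ', Module.End.mul_apply, weightedFrame, LinearMap.sum_apply,
      LinearMap.smul_apply, rankOneSq_apply]
    exact continuous_finsetSum _ fun j _ =>
      (continuous_apply j).smul ((continuous_const.inner ih).smul continuous_const)

lemma continuous_trace_weightedFrame_pow {ι : Type*} [Fintype ι] (v : ι → H) (k : ℕ) :
    Continuous fun D : ι → ℝ => LinearMap.trace ℝ H (weightedFrame v D ^ k) := by
  simp only [LinearMap.trace_eq_sum_inner _ (stdOrthonormalBasis ℝ H)]
  exact continuous_finsetSum _ fun l _ => continuous_const.inner (continuous_weightedFrame_pow v k _)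

omit [FiniteDimensional ℝ H] in
lemma weightedFrame_eq_update_add {ι : Type*} [Fintype ι] [DecidableEq ι] (v : ι → H) (D : ι → ℝ)
    (j : ι) : weightedFrame v D = weightedFrame v (Function.update D j 0) + D j • rankOneSq (v j) := by
  unfold weightedFrame
  rw [← Finset.add_sum_erase _ _ (Finset.mem_univ j), add_comm,
    ← Finset.add_sum_erase Finset.univ (fun i => Function.update D j 0 i • rankOneSq (v i))
      (Finset.mem_univ j)]
  simp only [Function.update_self, zero_smul, zero_add]
  congr 1
  refine Finset.sum_congr rfl fun i hi => ?_
  rw [Function.update_of_ne (Finset.ne_of_mem_erase hi)]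

end RankOneUpdates

/-! ### Trace moments of randomly selected tight frames. -/

section BernoulliFrames

open scoped InnerProductSpace

variable {Ω ι : Type*} [MeasurableSpace Ω] {P : Measure Ω} [Fintype ι] {ξ : ι → Ω → ℝ}

/-- With coordinate `j` zeroed, `F` depends on the other coordinates only and so is independent of
`ξ j`. -/
lemma integral_mul_comp_update [DecidableEq ι] (hm : ∀ j, Measurable (ξ j)) (hind : iIndepFun ξ P)
    (j : ι) {F : (ι → ℝ) → ℝ} (hF : Continuous F) :
    ∫ ω, ξ j ω * F (Function.update (fun i => ξ i ω) j 0) ∂P =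
      (∫ ω, ξ j ω ∂P) * ∫ ω, F (Function.update (fun i => ξ i ω) j 0) ∂P := by
  have h1 := hind.indepFun_finset {j} (Finset.univ.erase j) (by simp) hm
  let G : (↥(Finset.univ.erase j) → ℝ) → ℝ := fun y =>
    F fun i => if h : i ∈ Finset.univ.erase j then y ⟨i, h⟩ else 0
  have hG : Measurable G := by
    refine hF.measurable.comp (measurable_pi_lambda _ fun i => ?_)
    by_cases h : i ∈ Finset.univ.erase j
    · simp only [h, dite_true]; exact measurable_pi_apply _
    · simp only [h, dite_false]; exact measurable_const
  have hφ : Measurable fun y : ↥({j} : Finset ι) → ℝ => y ⟨j, Finset.mem_singleton_self j⟩ :=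
    measurable_pi_apply _
  have h2 := h1.comp (φ := fun y : ↥({j} : Finset ι) → ℝ => y ⟨j, Finset.mem_singleton_self j⟩) (ψ := G)
    hφ hG
  have e : ∀ ω, F (Function.update (fun i => ξ i ω) j 0) =
      G (fun i : ↥(Finset.univ.erase j) => ξ i ω) := by
    intro ω
    simp only [G]
    congr 1
    ext i
    by_cases h : i = j
    · subst h; simp
    · simp [h]
  have h3 := h2.integral_mul_eq_mul_integral (hm j).aestronglyMeasurable
    (hG.comp (measurable_pi_lambda _ fun i => hm i)).aestronglyMeasurable
  simp only [e]
  exact h3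

variable [IsProbabilityMeasure P]

lemma integrable_continuous_comp_zero_one (hm : ∀ j, Measurable (ξ j))
    (h01 : ∀ j ω, ξ j ω = 0 ∨ ξ j ω = 1) {F : (ι → ℝ) → ℝ} (hF : Continuous F) :
    Integrable (fun ω => F fun j => ξ j ω) P := by
  have hK : IsCompact (Set.univ.pi fun _ : ι => Set.Icc (0 : ℝ) 1) :=
    isCompact_univ_pi fun _ => isCompact_Icc
  obtain ⟨C, hC⟩ := hK.exists_bound_of_continuousOn hF.continuousOn
  refine Integrable.of_bound (C := C) ?_ (Filter.Eventually.of_forall fun ω => hC _ ?_)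
  · exact (hF.measurable.comp (measurable_pi_lambda _ fun j => hm j)).aestronglyMeasurable
  · intro j _
    rcases h01 j ω with h | h <;> simp [h]

variable [DecidableEq ι]

variable {H : Type*} [NormedAddCommGroup H] [InnerProductSpace ℝ H] [FiniteDimensional ℝ H]

/-- Recursion for the trace moments of a Bernoulli-selected tight frame. -/
lemma integral_trace_weightedFrame_pow_succ_le (hm : ∀ j, Measurable (ξ j))
    (h01 : ∀ j ω, ξ j ω = 0 ∨ ξ j ω = 1) (hind : iIndepFun ξ P) {q : ℝ} (hq0 : 0 ≤ q)
    (hq : ∀ j, ∫ ω, ξ j ω ∂P = q) {v : ι → H} {Λ c : ℝ} (hv : ∀ x, ∑ j, ⟪v j, x⟫_ℝ • v j = Λ • x)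
    (hc : ∀ j, ‖v j‖ ^ 2 ≤ c) (hc0 : 0 ≤ c) (k : ℕ) :
    ∫ ω, LinearMap.trace ℝ H (weightedFrame v (fun j => ξ j ω) ^ (k + 1)) ∂P ≤
      q * Λ * ∑ l ∈ Finset.range (k + 1), (k.choose l : ℝ) * c ^ (k - l) *
        ∫ ω, LinearMap.trace ℝ H (weightedFrame v (fun j => ξ j ω) ^ l) ∂P := by
  have hξ : ∀ j ω, 0 ≤ ξ j ω := fun j ω => by rcases h01 j ω with h | h <;> simp [h]
  have hcont : ∀ (l : ℕ) j, Continuous fun D : ι → ℝ => ⟪v j, (weightedFrame v D ^ l) (v j)⟫_ℝ :=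
    fun l j => continuous_const.inner (continuous_weightedFrame_pow v l _)
  have hup : ∀ j : ι, Continuous fun D : ι → ℝ => Function.update D j 0 := fun j =>
    continuous_id.update j continuous_const
  have hint : ∀ (l : ℕ) j, Integrable
      (fun ω => ⟪v j, (weightedFrame v (fun i => ξ i ω) ^ l) (v j)⟫_ℝ) P := fun l j =>
    integrable_continuous_comp_zero_one hm h01 (hcont l j)
  have hint' : ∀ (l : ℕ) j, Integrable
      (fun ω => ⟪v j, (weightedFrame v (Function.update (fun i => ξ i ω) j 0) ^ l) (v j)⟫_ℝ) P :=
    fun l j => integrable_continuous_comp_zero_one hm h01 ((hcont l j).comp (hup j))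
  have hmul : ∀ (l : ℕ) j, Integrable
      (fun ω => ξ j ω * ⟪v j, (weightedFrame v (fun i => ξ i ω) ^ l) (v j)⟫_ℝ) P := fun l j =>
    integrable_continuous_comp_zero_one hm h01 ((continuous_apply j).mul (hcont l j))
  have hmul' : ∀ (l : ℕ) j, Integrable (fun ω => (k.choose l : ℝ) * c ^ (k - l) * (ξ j ω *
      ⟪v j, (weightedFrame v (Function.update (fun i => ξ i ω) j 0) ^ l) (v j)⟫_ℝ)) P := fun l j =>
    (integrable_continuous_comp_zero_one hm h01
      ((continuous_apply j).mul ((hcont l j).comp (hup j)))).const_mul _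
  have hupd : ∀ ω j, ∀ i, 0 ≤ Function.update (fun i => ξ i ω) j 0 i := fun ω j i => by
    by_cases h : i = j
    · subst h; simp
    · simp [h, hξ]
  -- Where ξ_j = 1 the frame is a rank one update of the frame without column j. Replacing the
  -- update by `c • 1` removes ξ_j from the power, independence factors out its mean q, and
  -- monotonicity then puts column j back.
  have hstep : ∀ j, ∫ ω, ξ j ω * ⟪v j, (weightedFrame v (fun i => ξ i ω) ^ k) (v j)⟫_ℝ ∂P ≤
      ∑ l ∈ Finset.range (k + 1), (k.choose l : ℝ) * c ^ (k - l) *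
        (q * ∫ ω, ⟪v j, (weightedFrame v (fun i => ξ i ω) ^ l) (v j)⟫_ℝ ∂P) := by
    intro j
    calc _ ≤ ∫ ω, ∑ l ∈ Finset.range (k + 1), (k.choose l : ℝ) * c ^ (k - l) *
          (ξ j ω * ⟪v j, (weightedFrame v (Function.update (fun i => ξ i ω) j 0) ^ l) (v j)⟫_ℝ) ∂P := by
          refine integral_mono ?_ ?_ fun ω => ?_
          · exact hmul k j
          · exact integrable_finsetSum _ fun l _ => hmul' l j
          · have hA := weightedFrame_isPositive v (hupd ω j)
            rcases h01 j ω with h | h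
            · simp [h]
            · have e := weightedFrame_eq_update_add v (fun i => ξ i ω) j
              simp only [h, one_smul] at e
              simp only [h, one_mul]
              rw [e, ← inner_add_smul_pow_eq_sum_choose]
              exact hA.inner_add_rankOneSq_pow_le (hc j) k
      _ = ∑ l ∈ Finset.range (k + 1), (k.choose l : ℝ) * c ^ (k - l) *
          (q * ∫ ω, ⟪v j, (weightedFrame v (Function.update (fun i => ξ i ω) j 0) ^ l) (v j)⟫_ℝ ∂P) := by
          rw [integral_finsetSum _ fun l _ => hmul' l j]
          refine Finset.sum_congr rfl fun l _ => ?_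
          rw [integral_const_mul, integral_mul_comp_update hm hind j (hcont l j), hq]
      _ ≤ _ := by
          refine Finset.sum_le_sum fun l _ => mul_le_mul_of_nonneg_left
            (mul_le_mul_of_nonneg_left (integral_mono (hint' l j) (hint l j) fun ω => ?_) hq0)
            (by positivity)
          have hA := weightedFrame_isPositive v (hupd ω j)
          have e := weightedFrame_eq_update_add v (fun i => ξ i ω) j
          simp only at e ⊢
          rw [e]
          rcases h01 j ω with h | h
          · simp [h]
          · simp only [h, one_smul]
            exact hA.inner_pow_le_add_rankOneSq (v j) l
  simp only [trace_weightedFrame_pow_succ]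
  rw [integral_finsetSum _ fun j _ => hmul k j]
  refine (Finset.sum_le_sum fun j _ => hstep j).trans (le_of_eq ?_)
  -- Summing over `j` with tightness turns the pairings back into traces, which closes the
  -- recursion.
  rw [Finset.sum_comm, Finset.mul_sum]
  refine Finset.sum_congr rfl fun l _ => ?_
  rw [← Finset.mul_sum, ← Finset.mul_sum, ← integral_finsetSum _ fun j _ => hint l j]
  simp only [sum_inner_of_tight hv]
  rw [integral_const_mul]
  ring

/-- In the recursion each base qΛ + lc is enlarged to qΛ + kc; the binomial theorem then sums the
right side to (qΛ + (k+1)c)^k, and the remaining factor qΛ is at most one more copy of that base. -/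
theorem integral_trace_weightedFrame_pow_le (hm : ∀ j, Measurable (ξ j))
    (h01 : ∀ j ω, ξ j ω = 0 ∨ ξ j ω = 1) (hind : iIndepFun ξ P) {q : ℝ} (hq0 : 0 ≤ q)
    (hq : ∀ j, ∫ ω, ξ j ω ∂P = q) {v : ι → H} {Λ c : ℝ} (hv : ∀ x, ∑ j, ⟪v j, x⟫_ℝ • v j = Λ • x)
    (hΛ : 0 ≤ Λ) (hc : ∀ j, ‖v j‖ ^ 2 ≤ c) (hc0 : 0 ≤ c) (k : ℕ) :
    ∫ ω, LinearMap.trace ℝ H (weightedFrame v (fun j => ξ j ω) ^ k) ∂P ≤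
      Module.finrank ℝ H * (q * Λ + k * c) ^ k := by
  induction k using Nat.strong_induction_on with
  | _ k ih =>
    rcases k with _ | k
    · simp
    · refine (integral_trace_weightedFrame_pow_succ_le hm h01 hind hq0 hq hv hc hc0 k).trans ?_
      have hqΛ : 0 ≤ q * Λ := mul_nonneg hq0 hΛ
      calc _ ≤ q * Λ * ∑ l ∈ Finset.range (k + 1), (k.choose l : ℝ) * c ^ (k - l) *
            (Module.finrank ℝ H * (q * Λ + k * c) ^ l) := by
            refine mul_le_mul_of_nonneg_left (Finset.sum_le_sum fun l hl => ?_) hqΛ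
            refine mul_le_mul_of_nonneg_left ((ih l (Finset.mem_range.mp hl)).trans ?_) (by positivity)
            have : (l : ℝ) ≤ k := by exact_mod_cast Finset.mem_range_succ_iff.mp hl
            gcongr
        _ = Module.finrank ℝ H * (q * Λ * (q * Λ + (k + 1 : ℕ) * c) ^ k) := by
            have : q * Λ + ((k + 1 : ℕ) : ℝ) * c = (q * Λ + k * c) + c := by push_cast; ring
            rw [this, add_pow, Finset.mul_sum, Finset.mul_sum, Finset.mul_sum]
            refine Finset.sum_congr rfl fun l _ => ?_
            ring
        _ ≤ _ := by
            rw [pow_succ']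
            gcongr
            exact le_add_of_nonneg_right (by positivity)

end BernoulliFrames

/-! ### Gaussian measure, dual Sudakov and volumetric covering bounds. -/

section GaussianCovering

open scoped InnerProductSpace Real

set_option linter.unusedSectionVars false

variable {H : Type*} [NormedAddCommGroup H] [InnerProductSpace ℝ H] [FiniteDimensional ℝ H]

section

variable [MeasurableSpace H] [BorelSpace H]

lemma integral_exp_neg_sum_mul_inner_sq {ι : Type*} [Fintype ι] (b : OrthonormalBasis ι ℝ H)
    (c : ι → ℝ) :
    ∫ x : H, Real.exp (-∑ l, c l * ⟪b l, x⟫_ℝ ^ 2) = ∏ l, √(π / c l) := by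
  rw [← b.measurePreserving_repr_symm.integral_comp
    b.repr.symm.toHomeomorph.measurableEmbedding,
    ← (PiLp.volume_preserving_toLp ι).integral_comp
      (MeasurableEquiv.toLp 2 (ι → ℝ)).measurableEmbedding]
  have h : ∀ y : ι → ℝ, Real.exp (-∑ l, c l * ⟪b l, b.repr.symm (WithLp.toLp 2 y)⟫_ℝ ^ 2) =
      ∏ l, Real.exp (-c l * y l ^ 2) := fun y => by
    rw [← Real.exp_sum, ← Finset.sum_neg_distrib]
    congr 1
    refine Finset.sum_congr rfl fun l _ => ?_
    rw [← b.repr_apply_apply]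
    simp
  simp only [h]
  rw [integral_fintype_prod_volume_eq_prod (fun l (t : ℝ) => Real.exp (-c l * t ^ 2))]
  simp only [integral_gaussian]

/-- The unnormalised standard Gaussian measure. -/
noncomputable def gaussWeight (H : Type*) [NormedAddCommGroup H] [InnerProductSpace ℝ H]
    [FiniteDimensional ℝ H] [MeasurableSpace H] [BorelSpace H] : Measure H :=
  volume.withDensity fun x => ENNReal.ofReal (Real.exp (-(‖x‖ ^ 2 / 2)))

lemma measurable_gaussDensity :
    Measurable fun x : H => ENNReal.ofReal (Real.exp (-(‖x‖ ^ 2 / 2))) := by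
  fun_prop

lemma norm_sq_eq_sum_inner_sq {ι : Type*} [Fintype ι] (b : OrthonormalBasis ι ℝ H) (x : H) :
    ‖x‖ ^ 2 = ∑ l, ⟪b l, x⟫_ℝ ^ 2 := by
  rw [← real_inner_self_eq_norm_sq, ← b.sum_inner_mul_inner]
  exact Finset.sum_congr rfl fun l _ => by rw [real_inner_comm, sq]

lemma lintegral_exp_neg_sum_mul_inner_sq {ι : Type*} [Fintype ι] (b : OrthonormalBasis ι ℝ H)
    {c : ι → ℝ} (hc : ∀ l, 0 < c l) :
    ∫⁻ x : H, ENNReal.ofReal (Real.exp (-∑ l, c l * ⟪b l, x⟫_ℝ ^ 2)) =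
      ENNReal.ofReal (∏ l, √(π / c l)) := by
  rw [← integral_exp_neg_sum_mul_inner_sq b c, ofReal_integral_eq_lintegral_ofReal]
  · refine Integrable.of_integral_ne_zero ?_
    rw [integral_exp_neg_sum_mul_inner_sq b c]
    exact (Finset.prod_pos fun l _ => Real.sqrt_pos.2 (div_pos Real.pi_pos (hc l))).ne'
  · exact Filter.Eventually.of_forall fun x => (Real.exp_pos _).le

lemma gaussWeight_univ {ι : Type*} [Fintype ι] (b : OrthonormalBasis ι ℝ H) :
    gaussWeight H Set.univ = ENNReal.ofReal (∏ _l : ι, √(π / (1 / 2))) := by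
  rw [gaussWeight, withDensity_apply _ MeasurableSet.univ, Measure.restrict_univ,
    ← lintegral_exp_neg_sum_mul_inner_sq b (fun _ => by norm_num)]
  refine lintegral_congr fun x => ?_
  rw [norm_sq_eq_sum_inner_sq b, ← Finset.mul_sum]
  congr 3; ring

lemma gaussWeight_univ_ne_zero : gaussWeight H Set.univ ≠ 0 := by
  rw [gaussWeight_univ (stdOrthonormalBasis ℝ H)]
  exact (ENNReal.ofReal_pos.2 (Finset.prod_pos fun l _ => by positivity)).ne'

lemma gaussWeight_univ_ne_top : gaussWeight H Set.univ ≠ ∞ := by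
  rw [gaussWeight_univ (stdOrthonormalBasis ℝ H)]
  exact ENNReal.ofReal_ne_top

/-- Laplace transform of a Gaussian quadratic form. -/
lemma LinearMap.IsPositive.lintegral_exp_inner_gaussWeight_le {T : H →ₗ[ℝ] H} (hT : T.IsPositive)
    {t : ℝ} (ht : 0 ≤ t) (hT2 : ∀ x, 4 * t * ⟪x, T x⟫_ℝ ≤ ‖x‖ ^ 2) :
    ∫⁻ x, ENNReal.ofReal (Real.exp (t * ⟪x, T x⟫_ℝ)) ∂(gaussWeight H) ≤
      ENNReal.ofReal (Real.exp (2 * t * LinearMap.trace ℝ H T)) * gaussWeight H Set.univ := by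
  have hs := hT.isSymmetric
  set b := hs.eigenvectorBasis rfl
  set a := hs.eigenvalues rfl
  have ha0 : ∀ l, 0 ≤ a l := hT.nonneg_eigenvalues rfl
  have hba : ∀ l, T (b l) = a l • b l := fun l => hs.apply_eigenvectorBasis rfl l
  have ha1 : ∀ l, 4 * t * a l ≤ 1 := fun l => by
    simpa [hba, inner_smul_right] using hT2 (b l)
  have hq : ∀ x, ⟪x, T x⟫_ℝ = ∑ l, ⟪b l, x⟫_ℝ ^ 2 * a l := fun x => by
    have := hs.inner_pow_mul_pow 0 1 0 x
    simpa only [pow_one, pow_zero, mul_one] using this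
  have htr : LinearMap.trace ℝ H T = ∑ l, a l := by
    rw [LinearMap.trace_eq_sum_inner _ b]
    exact Finset.sum_congr rfl fun l _ => by simp [hba, inner_smul_right]
  rw [gaussWeight_univ b, gaussWeight, lintegral_withDensity_eq_lintegral_mul _
    measurable_gaussDensity (by
      have : Continuous T := T.continuous_of_finiteDimensional
      fun_prop)]
  have he : ∀ x : H, ENNReal.ofReal (Real.exp (-(‖x‖ ^ 2 / 2))) *
      ENNReal.ofReal (Real.exp (t * ⟪x, T x⟫_ℝ)) =
      ENNReal.ofReal (Real.exp (-∑ l, (1 / 2 - t * a l) * ⟪b l, x⟫_ℝ ^ 2)) := fun x => by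
    rw [← ENNReal.ofReal_mul (Real.exp_pos _).le, ← Real.exp_add, norm_sq_eq_sum_inner_sq b, hq]
    congr 2
    rw [Finset.sum_div, ← Finset.sum_neg_distrib, ← Finset.sum_neg_distrib, Finset.mul_sum,
      ← Finset.sum_add_distrib]
    exact Finset.sum_congr rfl fun l _ => by ring
  simp only [Pi.mul_apply, he]
  rw [lintegral_exp_neg_sum_mul_inner_sq b (fun l => by linarith [ha1 l]), ← ENNReal.ofReal_mul
    (Real.exp_pos _).le]
  refine ENNReal.ofReal_le_ofReal ?_
  rw [htr, Finset.mul_sum, Real.exp_sum, ← Finset.prod_mul_distrib]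
  refine Finset.prod_le_prod (fun l _ => Real.sqrt_nonneg _) fun l _ => ?_
  rw [Real.sqrt_le_left (by positivity), mul_pow, Real.sq_sqrt (by positivity), ← Real.exp_nat_mul]
  have h1 := ha1 l
  have h2 : 0 ≤ t * a l := mul_nonneg ht (ha0 l)
  set y := t * a l
  have hy : 4 * y ≤ 1 := by simpa [y, mul_assoc] using h1
  -- One eigenvalue contributes (1 - 2y)^{-1/2}, to be bounded by e^{2y}. From e^{4y} ≥ 1 + 4y this
  -- reduces to y ≤ 1/4, which is `hy`.
  have h3 : 1 ≤ (1 - 2 * y) * Real.exp (4 * y) := by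
    have := Real.add_one_le_exp (4 * y)
    nlinarith
  rw [div_le_iff₀ (by linarith)]
  have h4 : ((2 : ℕ) : ℝ) * (2 * t * a l) = 4 * y := by simp only [y]; push_cast; ring
  rw [h4]
  have := Real.pi_pos
  nlinarith

/-- Chernoff's bound at t = 1/(4b), the largest parameter the Laplace transform estimate allows,
leaves each form a relative mass of at most 1/(2 card κ) above `R`; a union bound does the rest. For
b = 0 all the forms are nonpositive and the set is empty. -/
lemma gaussWeight_quadratic_tail {κ : Type*} [Fintype κ] [Nonempty κ] {T : κ → H →ₗ[ℝ] H}
    (hT : ∀ i, (T i).IsPositive) {a b : ℝ} (ha : ∀ i, LinearMap.trace ℝ H (T i) ≤ a)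
    (hb : ∀ i x, ⟪x, T i x⟫_ℝ ≤ b * ‖x‖ ^ 2) (ha0 : 0 ≤ a) (hb0 : 0 ≤ b) {R : ℝ}
    (hR : 2 * a + 4 * b * Real.log (2 * Fintype.card κ) ≤ R) :
    gaussWeight H {x | ∃ i, R < ⟪x, T i x⟫_ℝ} ≤ gaussWeight H Set.univ / 2 := by
  have hm : (1 : ℝ) ≤ Fintype.card κ := by exact_mod_cast Fintype.card_pos
  rcases hb0.eq_or_lt with rfl | hbpos
  · have : {x | ∃ i, R < ⟪x, T i x⟫_ℝ} = (∅ : Set H) := by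
      refine Set.eq_empty_of_forall_notMem ?_
      rintro x ⟨i, hi⟩
      have := hb i x
      linarith
    simp [this]
  set t := 1 / (4 * b) with ht
  have ht0 : 0 < t := by positivity
  have htail : ∀ i, gaussWeight H {x | R < ⟪x, T i x⟫_ℝ} ≤
      ENNReal.ofReal (1 / (2 * Fintype.card κ)) * gaussWeight H Set.univ := by
    intro i
    have hc : Continuous (T i) := (T i).continuous_of_finiteDimensional
    have h1 := mul_meas_ge_le_lintegral₀ (μ := gaussWeight H)
      (f := fun x => ENNReal.ofReal (Real.exp (t * ⟪x, T i x⟫_ℝ)))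
      (by fun_prop) (ENNReal.ofReal (Real.exp (t * R)))
    have h2 := h1.trans ((hT i).lintegral_exp_inner_gaussWeight_le ht0.le fun x => by
      have := hb i x
      have e : 4 * t * b = 1 := by rw [ht]; field_simp
      calc 4 * t * ⟪x, T i x⟫_ℝ ≤ 4 * t * (b * ‖x‖ ^ 2) := by gcongr
        _ = ‖x‖ ^ 2 := by rw [← mul_assoc, e, one_mul])
    have hsub : {x | R < ⟪x, T i x⟫_ℝ} ⊆ {x | ENNReal.ofReal (Real.exp (t * R)) ≤
        ENNReal.ofReal (Real.exp (t * ⟪x, T i x⟫_ℝ))} := fun x hx =>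
      ENNReal.ofReal_le_ofReal (Real.exp_le_exp.2 (mul_le_mul_of_nonneg_left (le_of_lt hx) ht0.le))
    have h3 := (mul_le_mul_right (measure_mono hsub) _).trans h2
    have hpos : ENNReal.ofReal (Real.exp (t * R)) ≠ 0 := (ENNReal.ofReal_pos.2 (Real.exp_pos _)).ne'
    calc gaussWeight H {x | R < ⟪x, T i x⟫_ℝ}
        ≤ (ENNReal.ofReal (Real.exp (t * R)))⁻¹ * (ENNReal.ofReal
          (Real.exp (2 * t * LinearMap.trace ℝ H (T i))) * gaussWeight H Set.univ) := by
          rw [← ENNReal.div_eq_inv_mul, ENNReal.le_div_iff_mul_le (Or.inl hpos)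
            (Or.inl ENNReal.ofReal_ne_top), mul_comm]
          exact h3
      _ ≤ _ := by
          rw [← mul_assoc, ← ENNReal.ofReal_inv_of_pos (Real.exp_pos _),
            ← ENNReal.ofReal_mul (by positivity), ← Real.exp_neg, ← Real.exp_add]
          gcongr
          have e1 : t * R ≥ t * (2 * a) + Real.log (2 * Fintype.card κ) := by
            calc t * R ≥ t * (2 * a + 4 * b * Real.log (2 * Fintype.card κ)) := by gcongr
              _ = _ := by rw [mul_add, ht]; field_simp
          have e2 : t * LinearMap.trace ℝ H (T i) ≤ t * a := by gcongr; exact ha i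
          calc Real.exp (-(t * R) + 2 * t * LinearMap.trace ℝ H (T i))
              ≤ Real.exp (-Real.log (2 * Fintype.card κ)) := Real.exp_le_exp.2 (by linarith)
            _ = _ := by rw [Real.exp_neg, Real.exp_log (by positivity), one_div]
  calc gaussWeight H {x | ∃ i, R < ⟪x, T i x⟫_ℝ}
      = gaussWeight H (⋃ i, {x | R < ⟪x, T i x⟫_ℝ}) := by congr 1; ext x; simp
    _ ≤ ∑ i, gaussWeight H {x | R < ⟪x, T i x⟫_ℝ} := measure_iUnion_fintype_le _ _
    _ ≤ ∑ _i : κ, ENNReal.ofReal (1 / (2 * Fintype.card κ)) * gaussWeight H Set.univ :=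
        Finset.sum_le_sum fun i _ => htail i
    _ = _ := by
        rw [Finset.sum_const, Finset.card_univ, nsmul_eq_mul, ← mul_assoc, ENNReal.div_eq_inv_mul]
        congr 1
        rw [← ENNReal.ofReal_natCast, ← ENNReal.ofReal_mul (by positivity)]
        have : (Fintype.card κ : ℝ) * (1 / (2 * Fintype.card κ)) = 2⁻¹ := by field_simp
        rw [this, ENNReal.ofReal_inv_of_pos (by norm_num)]
        simp

/-- Translates of a symmetric set have comparable Gaussian measure. -/
lemma exp_mul_gaussWeight_le_translate {K : Set H} (hK : MeasurableSet K)
    (hsym : ∀ x, x ∈ K → -x ∈ K) (y : H) :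
    ENNReal.ofReal (Real.exp (-(‖y‖ ^ 2 / 2))) * gaussWeight H K ≤
      gaussWeight H ((fun z => z - y) ⁻¹' K) := by
  have hpre : MeasurableSet ((fun z : H => z - y) ⁻¹' K) := (measurable_id.sub_const y) hK
  have hφ : ∀ w : H, Measurable fun x : H => ENNReal.ofReal (Real.exp (-(‖x + w‖ ^ 2 / 2))) := by
    intro w; fun_prop
  have e1 : gaussWeight H ((fun z => z - y) ⁻¹' K) =
      ∫⁻ x in K, ENNReal.ofReal (Real.exp (-(‖x + y‖ ^ 2 / 2))) := by
    rw [gaussWeight, withDensity_apply _ hpre, ← lintegral_indicator hpre, ← lintegral_indicator hK,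
      ← lintegral_add_right_eq_self _ y]
    refine lintegral_congr fun x => ?_
    by_cases h : x ∈ K <;> simp [Set.indicator, h]
  have e2 : ∫⁻ x in K, ENNReal.ofReal (Real.exp (-(‖x + y‖ ^ 2 / 2))) =
      ∫⁻ x in K, ENNReal.ofReal (Real.exp (-(‖x + -y‖ ^ 2 / 2))) := by
    rw [← lintegral_indicator hK, ← lintegral_indicator hK, ← lintegral_neg_eq_self]
    refine lintegral_congr fun x => ?_
    have : -x ∈ K ↔ x ∈ K := ⟨fun h => by simpa using hsym _ h, hsym x⟩
    have hn : ‖-x + y‖ = ‖x + -y‖ := by rw [show -x + y = -(x + -y) by abel, norm_neg]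
    by_cases h : x ∈ K <;> simp only [Set.indicator, h, this, hn, if_true, if_false]
  -- By symmetry of `K` the shifts by `y` and `-y` give the same mass. Adding the two integrands
  -- produces the factor e^{-‖y‖²/2} · 2cosh⟪x, y⟫, and cosh ≥ 1.
  have e3 : 2 * (ENNReal.ofReal (Real.exp (-(‖y‖ ^ 2 / 2))) * gaussWeight H K) ≤
      2 * gaussWeight H ((fun z => z - y) ⁻¹' K) := by
    rw [two_mul (gaussWeight H ((fun z => z - y) ⁻¹' K))]
    nth_rewrite 2 [e1]
    rw [e2, e1, ← lintegral_add_left (hφ _), gaussWeight, withDensity_apply _ hK,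
      ← lintegral_const_mul _ measurable_gaussDensity,
      ← lintegral_const_mul _ (measurable_gaussDensity.const_mul _)]
    refine lintegral_mono fun x => ?_
    rw [← ENNReal.ofReal_mul (Real.exp_pos _).le, ← ENNReal.ofReal_add (Real.exp_pos _).le
      (Real.exp_pos _).le, ← Real.exp_add, show (2 : ℝ≥0∞) = ENNReal.ofReal 2 by simp,
      ← ENNReal.ofReal_mul (by norm_num)]
    refine ENNReal.ofReal_le_ofReal ?_
    have h1 : ‖x + y‖ ^ 2 = ‖x‖ ^ 2 + 2 * ⟪x, y⟫_ℝ + ‖y‖ ^ 2 := norm_add_sq_real x y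
    have h2 : ‖x + -y‖ ^ 2 = ‖x‖ ^ 2 - 2 * ⟪x, y⟫_ℝ + ‖y‖ ^ 2 := by
      rw [← sub_eq_add_neg]; exact norm_sub_sq_real x y
    rw [h1, h2]
    have e4 : -((‖x‖ ^ 2 + 2 * ⟪x, y⟫_ℝ + ‖y‖ ^ 2) / 2) =
      (-(‖y‖ ^ 2 / 2) + -(‖x‖ ^ 2 / 2)) + -⟪x, y⟫_ℝ := by ring
    have e5 : -((‖x‖ ^ 2 - 2 * ⟪x, y⟫_ℝ + ‖y‖ ^ 2) / 2) =
      (-(‖y‖ ^ 2 / 2) + -(‖x‖ ^ 2 / 2)) + ⟪x, y⟫_ℝ := by ring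
    rw [e4, e5, Real.exp_add _ (-⟪x, y⟫_ℝ), Real.exp_add _ ⟪x, y⟫_ℝ, ← mul_add]
    have h3 : 2 ≤ Real.exp (-⟪x, y⟫_ℝ) + Real.exp ⟪x, y⟫_ℝ := by
      have := Real.add_one_le_exp ⟪x, y⟫_ℝ
      have := Real.add_one_le_exp (-⟪x, y⟫_ℝ)
      linarith
    have := Real.exp_pos (-(‖y‖ ^ 2 / 2) + -(‖x‖ ^ 2 / 2))
    nlinarith
  exact (ENNReal.mul_le_mul_iff_right (by norm_num) (by norm_num)).1 e3

end

/-- Dual Sudakov inequality for the maximum of finitely many quadratic forms. -/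
theorem card_le_of_quadratic_separated {κ : Type*} [Fintype κ] [Nonempty κ] {T : κ → H →ₗ[ℝ] H}
    (hT : ∀ i, (T i).IsPositive) {a b : ℝ} (ha : ∀ i, LinearMap.trace ℝ H (T i) ≤ a)
    (hb : ∀ i x, ⟪x, T i x⟫_ℝ ≤ b * ‖x‖ ^ 2) (ha0 : 0 ≤ a) (hb0 : 0 ≤ b) {ρ u : ℝ}
    (hρ0 : 0 < ρ) (hρ : 2 * a + 4 * b * Real.log (2 * Fintype.card κ) ≤ ρ ^ 2) (hu : 0 < u)
    (F : Finset H) (hF : ∀ x ∈ F, ‖x‖ ≤ 1)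
    (hsep : ∀ x ∈ F, ∀ y ∈ F, x ≠ y → ∃ i, u ^ 2 < ⟪x - y, T i (x - y)⟫_ℝ) :
    (F.card : ℝ) ≤ 2 * Real.exp (2 * ρ ^ 2 / u ^ 2) := by
  borelize H
  set K : Set H := {x | ∃ i, ρ ^ 2 < ⟪x, T i x⟫_ℝ}ᶜ with hKdef
  have hKmem : ∀ x, x ∈ K ↔ ∀ i, ⟪x, T i x⟫_ℝ ≤ ρ ^ 2 := fun x => by simp [hKdef]
  have hcl : IsClosed K := by
    have : K = ⋂ i, {x | ⟪x, T i x⟫_ℝ ≤ ρ ^ 2} := by ext x; simp [hKmem]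
    rw [this]
    refine isClosed_iInter fun i => isClosed_le ?_ continuous_const
    exact continuous_id.inner (T i).continuous_of_finiteDimensional
  have hK : MeasurableSet K := hcl.measurableSet
  have hsym : ∀ x, x ∈ K → -x ∈ K := fun x hx => by
    rw [hKmem] at hx ⊢; simpa using hx
  have hhalf : gaussWeight H Set.univ / 2 ≤ gaussWeight H K := by
    have h1 := gaussWeight_quadratic_tail hT ha hb ha0 hb0 hρ
    have h2 : gaussWeight H Set.univ ≤ gaussWeight H K + gaussWeight H Set.univ / 2 := by
      calc gaussWeight H Set.univ ≤ gaussWeight H K + gaussWeight H Kᶜ := by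
            rw [← Set.union_compl_self K]; exact measure_union_le _ _
        _ ≤ _ := by rw [hKdef, compl_compl]; gcongr
    have h3 : gaussWeight H Set.univ / 2 ≠ ∞ :=
      (ENNReal.div_lt_top gaussWeight_univ_ne_top (by norm_num)).ne
    rw [← ENNReal.add_halves (gaussWeight H Set.univ)] at h2
    exact (ENNReal.add_le_add_iff_right (by simpa using h3)).1 (by simpa using h2)
  -- The dilation is chosen so that lam²u² = 4ρ². If two translates of `K` by dilated points met,
  -- the parallelogram law would bound some form of lam(x - y) by 4ρ², against the separation. The
  -- translates are disjoint and each retains a fraction e^{-lam²/2}/2 of the total mass.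
  set lam := 2 * ρ / u with hlam
  have hlam0 : 0 < lam := by positivity
  set W : H → Set H := fun x => (fun z => z - lam • x) ⁻¹' K
  have hWm : ∀ x, MeasurableSet (W x) := fun x => (measurable_id.sub_const _) hK
  have hdisj : (F : Set H).PairwiseDisjoint W := by
    intro x hx y hy hxy
    rw [Function.onFun, Set.disjoint_left]
    intro z hzx hzy
    obtain ⟨i, hi⟩ := hsep x hx y hy hxy
    have h1 := (hKmem _).1 hzx i
    have h2 := (hKmem _).1 hzy i
    simp only at h1 h2
    set k := z - lam • x
    set k' := z - lam • y
    have hk : lam • (x - y) = k' - k := by simp only [k, k', smul_sub]; abel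
    have hpos := (hT i).re_inner_nonneg_right (k' + k)
    simp only [RCLike.re_to_real] at hpos
    have h3 : ⟪k' - k, T i (k' - k)⟫_ℝ ≤ 4 * ρ ^ 2 := by
      simp only [map_sub, map_add, inner_sub_left, inner_sub_right, inner_add_left,
        inner_add_right] at hpos ⊢
      linarith
    rw [← hk, map_smul, inner_smul_left, inner_smul_right, RCLike.conj_to_real] at h3
    have h4 : lam * (lam * u ^ 2) = 4 * ρ ^ 2 := by rw [hlam]; field_simp; ring
    nlinarith [mul_pos hlam0 hlam0]
  have hlow : ∀ x ∈ F, ENNReal.ofReal (Real.exp (-(lam ^ 2 / 2))) * (gaussWeight H Set.univ / 2) ≤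
      gaussWeight H (W x) := by
    intro x hx
    refine le_trans ?_ (exp_mul_gaussWeight_le_translate hK hsym (lam • x))
    refine mul_le_mul' (ENNReal.ofReal_le_ofReal (Real.exp_le_exp.2 ?_)) hhalf
    rw [norm_smul, Real.norm_of_nonneg hlam0.le, mul_pow]
    have : ‖x‖ ^ 2 ≤ 1 := pow_le_one₀ (norm_nonneg _) (hF x hx)
    nlinarith [sq_nonneg lam]
  have hsum : (F.card : ℝ≥0∞) * (ENNReal.ofReal (Real.exp (-(lam ^ 2 / 2))) *
      (gaussWeight H Set.univ / 2)) ≤ gaussWeight H Set.univ := by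
    calc _ = ∑ _x ∈ F, ENNReal.ofReal (Real.exp (-(lam ^ 2 / 2))) *
          (gaussWeight H Set.univ / 2) := by rw [Finset.sum_const, nsmul_eq_mul]
      _ ≤ ∑ x ∈ F, gaussWeight H (W x) := Finset.sum_le_sum hlow
      _ = gaussWeight H (⋃ x ∈ F, W x) :=
          (measure_biUnion_finset hdisj fun x _ => hWm x).symm
      _ ≤ _ := measure_mono (Set.subset_univ _)
  have hG : gaussWeight H Set.univ = ENNReal.ofReal (gaussWeight H Set.univ).toReal :=
    (ENNReal.ofReal_toReal gaussWeight_univ_ne_top).symm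
  have hGpos : 0 < (gaussWeight H Set.univ).toReal :=
    ENNReal.toReal_pos gaussWeight_univ_ne_zero gaussWeight_univ_ne_top
  set g := (gaussWeight H Set.univ).toReal
  rw [hG] at hsum
  clear hG
  rw [← ENNReal.ofReal_natCast, show (2 : ℝ≥0∞) = ENNReal.ofReal 2 by simp,
    ← ENNReal.ofReal_div_of_pos (by norm_num), ← ENNReal.ofReal_mul (Real.exp_pos _).le,
    ← ENNReal.ofReal_mul (by positivity), ENNReal.ofReal_le_ofReal_iff hGpos.le] at hsum
  have hl2 : lam ^ 2 / 2 = 2 * ρ ^ 2 / u ^ 2 := by rw [hlam]; ring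
  rw [hl2, Real.exp_neg] at hsum
  have hE := Real.exp_pos (2 * ρ ^ 2 / u ^ 2)
  set e := Real.exp (2 * ρ ^ 2 / u ^ 2)
  have : (F.card : ℝ) * (e⁻¹ * (g / 2)) = (F.card : ℝ) / (2 * e) * g := by field_simp
  rw [this] at hsum
  have h5 : (F.card : ℝ) / (2 * e) ≤ 1 := by
    by_contra hcon
    push Not at hcon
    nlinarith
  rw [div_le_one (by positivity)] at h5
  exact h5

/-- Volumetric bound for separated subsets of the unit ball. -/
theorem card_le_of_norm_separated {u : ℝ} (hu : 0 < u) (F : Finset H) (hF : ∀ x ∈ F, ‖x‖ ≤ 1)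
    (hsep : ∀ x ∈ F, ∀ y ∈ F, x ≠ y → u ≤ ‖x - y‖) :
    (F.card : ℝ) ≤ Real.exp (2 * Module.finrank ℝ H / u) := by
  borelize H
  let μ : Measure H := Measure.addHaar
  have hball : ∀ (x : H) {r : ℝ}, 0 < r → μ (Metric.ball x r) =
      ENNReal.ofReal (r ^ Module.finrank ℝ H) * μ (Metric.ball 0 1) := fun x r hr =>
    μ.addHaar_ball_of_pos x hr
  have D : (F : Set H).PairwiseDisjoint fun c => Metric.ball c (u / 2) := by
    intro c hc d hd hcd
    refine Metric.ball_disjoint_ball ?_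
    rw [dist_eq_norm]
    linarith [hsep c hc d hd hcd]
  have hsub : (⋃ x ∈ F, Metric.ball x (u / 2)) ⊆ Metric.ball (0 : H) (1 + u / 2) := by
    refine Set.iUnion₂_subset fun x hx => Metric.ball_subset_ball' ?_
    rw [dist_zero_right]; linarith [hF x hx]
  have I : (F.card : ℝ≥0∞) * ENNReal.ofReal ((u / 2) ^ Module.finrank ℝ H) * μ (Metric.ball 0 1) ≤
      ENNReal.ofReal ((1 + u / 2) ^ Module.finrank ℝ H) * μ (Metric.ball 0 1) :=
    calc _ = μ (⋃ x ∈ F, Metric.ball x (u / 2)) := by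
          rw [measure_biUnion_finset D fun x _ => measurableSet_ball]
          simp only [hball _ (half_pos hu), Finset.sum_const,
            nsmul_eq_mul, mul_assoc]
      _ ≤ μ (Metric.ball 0 (1 + u / 2)) := measure_mono hsub
      _ = _ := hball 0 (by positivity)
  have J := (ENNReal.mul_le_mul_iff_left (Metric.measure_ball_pos _ _ zero_lt_one).ne'
    measure_ball_lt_top.ne).1 I
  rw [← ENNReal.ofReal_natCast, ← ENNReal.ofReal_mul (by positivity),
    ENNReal.ofReal_le_ofReal_iff (by positivity)] at J
  have e : (1 + u / 2) = (1 + 2 / u) * (u / 2) := by field_simp; ring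
  rw [e, mul_pow] at J
  have J2 := le_of_mul_le_mul_right J (by positivity)
  refine J2.trans ?_
  calc (1 + 2 / u) ^ Module.finrank ℝ H ≤ (Real.exp (2 / u)) ^ Module.finrank ℝ H := by
        gcongr; linarith [Real.add_one_le_exp (2 / u)]
    _ = _ := by rw [← Real.exp_nat_mul]; congr 1; ring

end GaussianCovering

/-! ### From nets to γ₂ of a sphere. -/

section GammaTwoBounds

/-- If separated subsets of `S` have at most `N` points then `S` has a net with at most `N` points. -/
lemma exists_net_of_card_le {X : Type*} {S : Set X} {far : X → X → Prop} (hirr : ∀ x, ¬ far x x)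
    (hsymm : ∀ x y, far x y → far y x) {N : ℕ}
    (h : ∀ F : Finset X, ↑F ⊆ S → (∀ x ∈ F, ∀ y ∈ F, x ≠ y → far x y) → F.card ≤ N) :
    ∃ F : Finset X, ↑F ⊆ S ∧ F.card ≤ N ∧ ∀ x ∈ S, ∃ y ∈ F, ¬ far x y := by
  classical
  let p : ℕ → Prop := fun k => ∃ F : Finset X, ↑F ⊆ S ∧ (∀ x ∈ F, ∀ y ∈ F, x ≠ y → far x y) ∧
    F.card = k
  have hp0 : p 0 := ⟨∅, by simp, by simp, by simp⟩
  -- A separated set of maximal cardinality is a net: a point far from all of it could be added.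
  obtain ⟨F, hFS, hF, hcard⟩ : p (Nat.findGreatest p N) := Nat.findGreatest_spec (Nat.zero_le N) hp0
  refine ⟨F, hFS, h F hFS hF, fun x hx => ?_⟩
  by_contra hcon
  push Not at hcon
  have hxF : x ∉ F := fun hxF => hirr x (hcon x hxF)
  have hsub : (↑(insert x F) : Set X) ⊆ S := by
    rw [Finset.coe_insert]; exact Set.insert_subset hx hFS
  have hsep : ∀ y ∈ insert x F, ∀ z ∈ insert x F, y ≠ z → far y z := by
    intro y hy z hz hyz
    rw [Finset.mem_insert] at hy hz
    rcases hy with rfl | hy <;> rcases hz with rfl | hz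
    · exact absurd rfl hyz
    · exact hcon z hz
    · exact hsymm _ _ (hcon y hy)
    · exact hF y hy z hz hyz
  have hc : (insert x F).card = F.card + 1 := Finset.card_insert_of_notMem hxF
  have := Nat.le_findGreatest (P := p) (h _ hsub hsep) ⟨_, hsub, hsep, rfl⟩
  omega

lemma gammaTwo_image_le {X Y : Type*} (φ : X → Y) (S : Set X) (ρ : Y → Y → ℝ≥0∞) :
    gammaTwo (φ '' S) ρ ≤ gammaTwo S fun x y => ρ (φ x) (φ y) := by
  refine le_iInf₂ fun A hA => ?_
  refine iInf₂_le_of_le (fun r => φ '' A r) ⟨?_, ?_, ?_, ?_⟩ ?_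
  · exact fun r t hrt => Set.image_mono (hA.mono hrt)
  · exact fun r => Set.image_mono (hA.subset r)
  · obtain ⟨x, hx⟩ := Set.encard_eq_one.1 hA.card_zero
    simp [hx]
  · exact fun r => (Set.encard_image_le _ _).trans (hA.card_le r)
  · refine iSup₂_le ?_
    rintro _ ⟨x, hx, rfl⟩
    refine le_trans ?_ (le_iSup₂ (f := fun x (_ : x ∈ S) => ∑' r : ℕ, (2 : ℝ≥0∞) ^ ((r : ℝ) / 2) *
      ⨅ y ∈ A r, ρ (φ x) (φ y)) x hx)
    refine ENNReal.tsum_le_tsum fun r => ?_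
    rw [iInf_image]

/-- A bound for `γ₂` from a sequence of nets. -/
lemma gammaTwo_le_of_nets {X : Type*} {S : Set X} {ρ : X → X → ℝ≥0∞} {x₀ : X} (hx₀ : x₀ ∈ S)
    {Δ : ℝ≥0∞} (hΔ : ∀ x ∈ S, ρ x x₀ ≤ Δ) {e : ℕ → ℝ≥0∞}
    (hN : ∀ r, ∃ F : Finset X, ↑F ⊆ S ∧ F.card ≤ 2 ^ 2 ^ r ∧ ∀ x ∈ S, ∃ y ∈ F, ρ x y ≤ e r) :
    gammaTwo S ρ ≤ Δ + ∑' r : ℕ, (2 : ℝ≥0∞) ^ (((r + 1 : ℕ) : ℝ) / 2) * e r := by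
  classical
  choose N hNS hNc hNe using hN
  -- Accumulating the nets makes the sequence nested. The delay by one level pays for the unions,
  -- since 2 · 2^{2^r} ≤ 2^{2^{r+1}}, and explains the weight 2^{(r+1)/2} on `e r`.
  let A : ℕ → Finset X := fun r => Nat.rec (motive := fun _ => Finset X) {x₀} (fun r F => F ∪ N r) r
  have hA0 : A 0 = {x₀} := rfl
  have hAs : ∀ r, A (r + 1) = A r ∪ N r := fun r => rfl
  have hcard : ∀ r, (A r).card ≤ 2 ^ 2 ^ r := by
    intro r
    induction r with
    | zero => simp [hA0]
    | succ r ih =>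
      rw [hAs]
      calc (A r ∪ N r).card ≤ (A r).card + (N r).card := Finset.card_union_le _ _
        _ ≤ 2 ^ 2 ^ r + 2 ^ 2 ^ r := add_le_add ih (hNc r)
        _ = 2 ^ (2 ^ r + 1) := by ring
        _ ≤ 2 ^ 2 ^ (r + 1) := by
          refine Nat.pow_le_pow_right (by norm_num) ?_
          have : 1 ≤ 2 ^ r := Nat.one_le_two_pow
          rw [pow_succ]; omega
  have hadm : IsAdmissibleSeq S fun r => ((A r : Finset X) : Set X) := by
    refine ⟨monotone_nat_of_le_succ fun r => ?_, fun r => ?_, ?_, fun r => ?_⟩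
    · rw [hAs, Finset.coe_union]; exact Set.subset_union_left
    · induction r with
      | zero => simpa [hA0] using hx₀
      | succ r ih => rw [hAs, Finset.coe_union]; exact Set.union_subset ih (hNS r)
    · simp [hA0]
    · rw [Set.encard_coe_eq_coe_finsetCard]; exact_mod_cast hcard r
  refine iInf₂_le_of_le _ hadm (iSup₂_le fun x hx => ?_)
  rw [tsum_eq_zero_add' ENNReal.summable]
  refine add_le_add ?_ (ENNReal.tsum_le_tsum fun r => mul_le_mul_right ?_ _)
  · simpa [hA0] using hΔ x hx
  · obtain ⟨y, hy, hxy⟩ := hNe r x hx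
    refine iInf₂_le_of_le y ?_ hxy
    simp only [hAs, Finset.coe_union]; exact Or.inr hy

lemma ennreal_two_rpow_half (r : ℕ) : (2 : ℝ≥0∞) ^ ((r : ℝ) / 2) = ENNReal.ofReal (√2 ^ r) := by
  rw [show (2 : ℝ≥0∞) = ENNReal.ofReal 2 by simp, ENNReal.ofReal_rpow_of_pos (by norm_num),
    Real.sqrt_eq_rpow, ← Real.rpow_natCast, ← Real.rpow_mul (by norm_num)]
  congr 2; ring

open scoped InnerProductSpace

variable {H : Type*} [NormedAddCommGroup H] [InnerProductSpace ℝ H] [FiniteDimensional ℝ H]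

lemma two_mul_exp_le_two_pow {r : ℕ} (hr : 1 ≤ r) {y : ℝ} (hy : y ≤ 2 ^ r / 4) :
    2 * Real.exp y ≤ ((2 ^ 2 ^ r : ℕ) : ℝ) := by
  have h2 : (2 : ℝ) = Real.exp (Real.log 2) := (Real.exp_log (by norm_num)).symm
  have hl := Real.log_two_gt_d9
  have hr2 : (2 : ℝ) ≤ 2 ^ r := by
    calc (2 : ℝ) = 2 ^ 1 := by norm_num
      _ ≤ _ := pow_le_pow_right₀ (by norm_num) hr
  push_cast
  calc 2 * Real.exp y = Real.exp (Real.log 2 + y) := by rw [Real.exp_add, ← h2]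
    _ ≤ Real.exp ((2 ^ r : ℕ) * Real.log 2) := by
      refine Real.exp_le_exp.2 ?_
      push_cast
      nlinarith
    _ = 2 ^ 2 ^ r := by rw [Real.exp_nat_mul, ← h2]

lemma exp_le_two_pow {r : ℕ} {y : ℝ} (hy : y ≤ 2 / 3 * 2 ^ r) :
    Real.exp y ≤ ((2 ^ 2 ^ r : ℕ) : ℝ) := by
  have h2 : (2 : ℝ) = Real.exp (Real.log 2) := (Real.exp_log (by norm_num)).symm
  have hl := Real.log_two_gt_d9
  have hr2 : (0 : ℝ) < 2 ^ r := by positivity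
  push_cast
  calc Real.exp y ≤ Real.exp ((2 ^ r : ℕ) * Real.log 2) := by
        refine Real.exp_le_exp.2 ?_
        push_cast
        nlinarith
    _ = 2 ^ 2 ^ r := by rw [Real.exp_nat_mul, ← h2]

/-- `γ₂` of the unit sphere with respect to a maximum of quadratic forms. -/
theorem gammaTwo_sphere_le {κ : Type*} [Fintype κ] [Nonempty κ] {T : κ → H →ₗ[ℝ] H}
    (hT : ∀ i, (T i).IsPositive) {a b : ℝ} (ha : ∀ i, LinearMap.trace ℝ H (T i) ≤ a)
    (hb : ∀ i x, ⟪x, T i x⟫_ℝ ≤ b * ‖x‖ ^ 2) (hb0 : 0 ≤ b) (hba : b ≤ a) (hb1 : b ≤ 1)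
    {ρ : H → H → ℝ≥0∞}
    (hρ : ∀ x y u, 0 ≤ u → (∀ i, ⟪x - y, T i (x - y)⟫_ℝ ≤ u ^ 2) → ρ x y ≤ ENNReal.ofReal u)
    {G ε : ℝ} (hG : 0 < G) (hG2 : 5 * a + 4 * b * Real.log (Fintype.card κ) ≤ G ^ 2)
    (hε : 0 < ε) (hd : 2 ≤ Module.finrank ℝ H / ε) :
    gammaTwo (Metric.sphere (0 : H) 1) ρ ≤
      ENNReal.ofReal (25 * (ε + Real.log (Module.finrank ℝ H / ε) * G)) := by
  have ha0 : 0 ≤ a := hb0.trans hba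
  have hm : (1 : ℝ) ≤ Fintype.card κ := by exact_mod_cast Fintype.card_pos
  set d := (Module.finrank ℝ H : ℝ) with hd_def
  have hd0 : 0 < d := by
    by_contra hcon
    have : d / ε ≤ 0 := div_nonpos_of_nonpos_of_nonneg (not_lt.1 hcon) hε.le
    linarith
  have hfin : 0 < Module.finrank ℝ H := Nat.cast_pos.1 hd0
  have : Nontrivial H := Module.nontrivial_of_finrank_pos hfin
  obtain ⟨x₀, hx₀⟩ : (Metric.sphere (0 : H) 1).Nonempty :=
    NormedSpace.sphere_nonempty.2 zero_le_one
  have hnorm : ∀ x ∈ Metric.sphere (0 : H) 1, ‖x‖ = 1 := fun x hx => by simpa using hx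
  have hlog2 := Real.log_two_lt_d9
  have hlog2' := Real.log_two_gt_d9
  have hlogm : 0 ≤ Real.log (Fintype.card κ) := Real.log_nonneg hm
  have hG3 : 2 * a + 4 * b * Real.log (2 * Fintype.card κ) ≤ G ^ 2 := by
    rw [Real.log_mul (by norm_num) (by positivity)]
    nlinarith
  have hdiam : ∀ x ∈ Metric.sphere (0 : H) 1, ∀ y ∈ Metric.sphere (0 : H) 1,
      ρ x y ≤ ENNReal.ofReal G := fun x hx y hy => by
    refine hρ _ _ _ hG.le fun i => (hb i _).trans ?_
    have h1 : ‖x - y‖ ≤ 2 := (norm_sub_le _ _).trans (by rw [hnorm x hx, hnorm y hy]; norm_num)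
    have h2 : ‖x - y‖ ^ 2 ≤ 2 ^ 2 := by gcongr
    nlinarith [mul_nonneg hb0 hlogm]
  have hs2 : √2 ^ 2 = (2 : ℝ) := Real.sq_sqrt (by norm_num)
  have hs0 : 0 < √2 := Real.sqrt_pos.2 (by norm_num)
  have hpow2 : ∀ r : ℕ, (√2 ^ r) ^ 2 = (2 : ℝ) ^ r := fun r => by
    rw [← pow_mul, mul_comm, pow_mul, hs2]
  -- The constant 3 makes the dual Sudakov exponent (2/9) · 2^r, below the admissible 2^r/4. That
  -- count needs r ≥ 1; at level 0 one point suffices because the diameter is at most `G`.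
  have net1 : ∀ r : ℕ, ∃ F : Finset H, ↑F ⊆ Metric.sphere (0 : H) 1 ∧ F.card ≤ 2 ^ 2 ^ r ∧
      ∀ x ∈ Metric.sphere (0 : H) 1, ∃ y ∈ F, ρ x y ≤ ENNReal.ofReal (3 * G / √2 ^ r) := by
    intro r
    rcases Nat.eq_zero_or_pos r with rfl | hr
    · refine ⟨{x₀}, by simpa using hx₀, by simp, fun x hx => ⟨x₀, by simp, ?_⟩⟩
      exact (hdiam x hx x₀ hx₀).trans (ENNReal.ofReal_le_ofReal (by simp; linarith))
    · have hu : 0 < 3 * G / √2 ^ r := by positivity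
      obtain ⟨F, hF, hFc, hFn⟩ := exists_net_of_card_le (S := Metric.sphere (0 : H) 1)
        (far := fun x y => ∃ i, (3 * G / √2 ^ r) ^ 2 < ⟪x - y, T i (x - y)⟫_ℝ) (N := 2 ^ 2 ^ r)
        (fun x => by
          rintro ⟨i, hi⟩
          simp only [sub_self, inner_zero_left] at hi
          exact absurd hi (not_lt.2 (sq_nonneg _)))
        (fun x y => by
          rintro ⟨i, hi⟩
          refine ⟨i, ?_⟩
          rw [← neg_sub x y, map_neg, inner_neg_neg]
          exact hi)
        (fun F hF hsep => by
          have h1 := card_le_of_quadratic_separated hT ha hb ha0 hb0 hG hG3 hu F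
            (fun x hx => (hnorm x (hF hx)).le) hsep
          have h2 := h1.trans (two_mul_exp_le_two_pow hr (by
            rw [div_pow, hpow2, mul_pow, div_div_eq_mul_div, div_le_div_iff₀ (by positivity)
              (by norm_num)]
            have : 0 < G ^ 2 * 2 ^ r := by positivity
            nlinarith))
          exact_mod_cast h2)
      refine ⟨F, hF, hFc, fun x hx => ?_⟩
      obtain ⟨y, hy, hxy⟩ := hFn x hx
      push Not at hxy
      exact ⟨y, hy, hρ _ _ _ hu.le hxy⟩
  -- Since b ≤ 1, Euclidean nets serve for `ρ`. The volumetric exponent is (2/3) · 2^r, and 2/3 <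
  -- log 2.
  have net2 : ∀ r : ℕ, ∃ F : Finset H, ↑F ⊆ Metric.sphere (0 : H) 1 ∧ F.card ≤ 2 ^ 2 ^ r ∧
      ∀ x ∈ Metric.sphere (0 : H) 1, ∃ y ∈ F, ρ x y ≤ ENNReal.ofReal (3 * d / 2 ^ r) := by
    intro r
    have hu : 0 < 3 * d / 2 ^ r := by positivity
    obtain ⟨F, hF, hFc, hFn⟩ := exists_net_of_card_le (S := Metric.sphere (0 : H) 1)
      (far := fun x y => 3 * d / 2 ^ r ≤ ‖x - y‖) (N := 2 ^ 2 ^ r)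
      (fun x => by simpa using hu) (fun x y h => by rwa [norm_sub_rev])
      (fun F hF hsep => by
        have h1 := card_le_of_norm_separated hu F (fun x hx => (hnorm x (hF hx)).le) hsep
        have h2 := h1.trans (exp_le_two_pow (r := r) (by
          rw [← hd_def, div_div_eq_mul_div, div_le_iff₀ (by positivity)]
          linarith))
        exact_mod_cast h2)
    refine ⟨F, hF, hFc, fun x hx => ?_⟩
    obtain ⟨y, hy, hxy⟩ := hFn x hx
    refine ⟨y, hy, hρ _ _ _ hu.le fun i => (hb i _).trans ?_⟩
    have h3 : ‖x - y‖ ^ 2 ≤ (3 * d / 2 ^ r) ^ 2 := by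
      have := (not_le.1 hxy).le
      gcongr
    nlinarith [sq_nonneg ‖x - y‖]
  set l := Real.log (d / ε) with hl
  have hl2 : Real.log 2 ≤ l := Real.log_le_log (by norm_num) hd
  -- `K` is the level at which the nets are switched. Each earlier level contributes 3√2·G, whence
  -- the factor log(d/ε); the later ones form a geometric series of order d/√2^K ≤ ε.
  obtain ⟨K, hK1, hK2⟩ : ∃ K : ℕ, d / ε ≤ √2 ^ K ∧ (K : ℝ) ≤ 5 * l := by
    refine ⟨⌈2 * l / Real.log 2⌉₊, ?_, ?_⟩
    · have h1 := Nat.le_ceil (2 * l / Real.log 2)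
      set K := ⌈2 * l / Real.log 2⌉₊
      rw [div_le_iff₀ (by linarith)] at h1
      have h2 : (d / ε) ^ 2 ≤ (√2 ^ K) ^ 2 := by
        rw [hpow2, ← Real.log_le_log_iff (by positivity) (by positivity), Real.log_pow, Real.log_pow]
        push_cast; exact h1
      exact le_of_sq_le_sq h2 (by positivity)
    · have h1 := Nat.ceil_lt_add_one (a := 2 * l / Real.log 2) (by
        apply div_nonneg <;> linarith)
      refine h1.le.trans ?_
      rw [div_add_one (by linarith), div_le_iff₀ (by linarith)]
      nlinarith
  have hsq : √2 ≤ 1.415 := by rw [Real.sqrt_le_left (by norm_num)]; norm_num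
  have hsq' : 1.414 ≤ √2 := Real.le_sqrt_of_sq_le (by norm_num)
  refine (gammaTwo_le_of_nets hx₀ (fun x hx => hdiam x hx x₀ hx₀)
    (e := fun r => if r < K then ENNReal.ofReal (3 * G / √2 ^ r) else ENNReal.ofReal (3 * d / 2 ^ r))
    fun r => ?_).trans ?_
  · by_cases h : r < K
    · simpa only [h, if_true] using net1 r
    · simpa only [h, if_false] using net2 r
  rw [← ENNReal.summable.sum_add_tsum_nat_add' (k := K)]
  have hs1 : ∑ r ∈ Finset.range K, (2 : ℝ≥0∞) ^ (((r + 1 : ℕ) : ℝ) / 2) *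
      (if r < K then ENNReal.ofReal (3 * G / √2 ^ r) else ENNReal.ofReal (3 * d / 2 ^ r)) =
      ENNReal.ofReal (K * (3 * √2 * G)) := by
    rw [ENNReal.ofReal_mul (by positivity), ENNReal.ofReal_natCast, ← nsmul_eq_mul]
    rw [← Finset.card_range K, ← Finset.sum_const, Finset.card_range]
    refine Finset.sum_congr rfl fun r hr => ?_
    rw [if_pos (Finset.mem_range.1 hr), ennreal_two_rpow_half, ← ENNReal.ofReal_mul (by positivity)]
    congr 1
    rw [pow_succ]; field_simp
  have hq1 : (√2)⁻¹ < 1 := inv_lt_one_of_one_lt₀ (by linarith)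
  have hs3 : ∑' r : ℕ, (2 : ℝ≥0∞) ^ (((r + K + 1 : ℕ) : ℝ) / 2) *
      (if r + K < K then ENNReal.ofReal (3 * G / √2 ^ (r + K)) else
        ENNReal.ofReal (3 * d / 2 ^ (r + K))) =
      ENNReal.ofReal (3 * √2 * d / √2 ^ K * (1 - (√2)⁻¹)⁻¹) := by
    rw [← tsum_geometric_of_lt_one (by positivity) hq1, ← tsum_mul_left, ENNReal.ofReal_tsum_of_nonneg
      (fun r => by positivity) ((summable_geometric_of_lt_one (by positivity) hq1).mul_left _)]
    refine tsum_congr fun r => ?_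
    rw [if_neg (by omega), ennreal_two_rpow_half, ← ENNReal.ofReal_mul (by positivity)]
    congr 1
    rw [← hpow2 (r + K), pow_succ, pow_add, inv_pow]
    field_simp
  rw [hs1, hs3, ← ENNReal.ofReal_add (by positivity) (by
    have : 0 < 1 - (√2)⁻¹ := by linarith
    positivity), ← ENNReal.ofReal_add hG.le (by
    have : 0 < 1 - (√2)⁻¹ := by linarith
    positivity)]
  refine ENNReal.ofReal_le_ofReal ?_
  have hqi : (1 - (√2)⁻¹)⁻¹ ≤ 3.5 := by
    rw [inv_le_comm₀ (by linarith) (by norm_num)]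
    have : (√2)⁻¹ ≤ 0.71 := by
      rw [inv_le_comm₀ hs0 (by norm_num)]; norm_num; linarith
    norm_num at this ⊢; linarith
  have hdK : d / √2 ^ K ≤ ε := by
    rw [div_le_iff₀ (by positivity)]
    rw [div_le_iff₀ hε] at hK1
    linarith
  have h1 : 3 * √2 * d / √2 ^ K * (1 - (√2)⁻¹)⁻¹ ≤ 3 * 1.415 * ε * 3.5 := by
    have : 3 * √2 * d / √2 ^ K = 3 * √2 * (d / √2 ^ K) := by ring
    rw [this]
    have : 0 < 1 - (√2)⁻¹ := by linarith
    gcongr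
  have h2 : (K : ℝ) * (3 * √2 * G) ≤ 5 * l * (3 * 1.415 * G) := by
    have : 0 ≤ l := by linarith
    gcongr
  have h3 : G ≤ 1.5 * l * G := by nlinarith
  have h4 : 0 < l * G := mul_pos (by linarith) hG
  linarith

end GammaTwoBounds

/-! ### Khintchine's inequality and decoupling for random signs. -/

section RademacherChaos

open scoped InnerProductSpace BigOperators

variable {ι : Type*} [Fintype ι] [DecidableEq ι]

/-- The real vector of a sign pattern. -/
def signVec (σ : ι → ℤˣ) : ι → ℝ := fun a => ((σ a : ℤ) : ℝ)

omit [Fintype ι] [DecidableEq ι] in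
lemma signVec_mul (σ τ : ι → ℤˣ) (a : ι) : signVec (σ * τ) a = signVec σ a * signVec τ a := by
  simp [signVec]

omit [Fintype ι] [DecidableEq ι] in
lemma signVec_eq (σ : ι → ℤˣ) (a : ι) : signVec σ a = 1 ∨ signVec σ a = -1 := by
  rcases Int.units_eq_one_or (σ a) with h | h <;> simp [signVec, h]

lemma expect_comp_mul_left (f : (ι → ℤˣ) → ℝ) (φ : ι → ℤˣ) : 𝔼 σ, f (φ * σ) = 𝔼 σ, f σ :=
  Fintype.expect_equiv (Equiv.mulLeft φ) _ _ fun _ => rfl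

lemma expect_exp_signVec_le (c : ι → ℝ) :
    𝔼 σ : ι → ℤˣ, Real.exp (∑ a, signVec σ a * c a) ≤ Real.exp ((∑ a, c a ^ 2) / 2) := by
  have h1 : ∑ σ : ι → ℤˣ, Real.exp (∑ a, signVec σ a * c a) = ∏ a, (2 * Real.cosh (c a)) := by
    have h2 : ∀ a, 2 * Real.cosh (c a) = ∑ s : ℤˣ, Real.exp (((s : ℤ) : ℝ) * c a) := fun a => by
      rw [show (Finset.univ : Finset ℤˣ) = {1, -1} from rfl, Finset.sum_pair (by decide),
        Real.cosh_eq]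
      simp; ring
    simp only [h2, Finset.prod_univ_sum, Fintype.piFinset_univ, Real.exp_sum]
    rfl
  rw [Fintype.expect_eq_sum_div_card, h1, Finset.prod_mul_distrib, Finset.prod_const,
    Finset.card_univ, Fintype.card_fun, Fintype.card_units_int]
  push_cast
  rw [mul_div_cancel_left₀ _ (by positivity), Finset.sum_div, Real.exp_sum]
  exact Finset.prod_le_prod (fun a _ => (Real.cosh_pos _).le) fun a _ => Real.cosh_le_exp_half_sq _

/-- Khintchine's inequality for even moments. -/
lemma expect_signVec_pow_le {c : ι → ℝ} {v : ℝ} (hc : ∑ a, c a ^ 2 ≤ v) {k : ℕ} (hk : 1 ≤ k) :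
    𝔼 σ : ι → ℤˣ, (∑ a, signVec σ a * c a) ^ (2 * k) ≤ (11 * k * v) ^ k := by
  have hv0 : 0 ≤ v := (Finset.sum_nonneg fun a _ => sq_nonneg (c a)).trans hc
  rcases hv0.eq_or_lt with rfl | hv
  · have hz : ∀ a, c a = 0 := fun a => by
      have := (Finset.sum_eq_zero_iff_of_nonneg fun a _ => sq_nonneg (c a)).1
        (le_antisymm hc (Finset.sum_nonneg fun a _ => sq_nonneg (c a))) a (Finset.mem_univ a)
      exact pow_eq_zero_iff (by norm_num) |>.1 this
    have h1 : k ≠ 0 := by omega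
    simp [hz, h1]
  have hk0 : (0 : ℝ) < k := by exact_mod_cast hk
  -- With this scale both exponential moments are at most e^k. The bound (2k)! ≤ (2k)^{2k} then
  -- produces the constant 4e < 11.
  set l := √(2 * k / v) with hl
  have hl2 : l ^ 2 = 2 * k / v := Real.sq_sqrt (by positivity)
  have hexp : ∀ s : ℝ, s ^ 2 = 1 → 𝔼 σ : ι → ℤˣ, Real.exp (s * (l * ∑ a, signVec σ a * c a)) ≤
      Real.exp k := fun s hs => by
    have h1 := expect_exp_signVec_le fun a => s * l * c a
    have h2 : ∀ σ : ι → ℤˣ, ∑ a, signVec σ a * (s * l * c a) = s * (l * ∑ a, signVec σ a * c a) :=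
      fun σ => by
        rw [Finset.mul_sum, Finset.mul_sum]; exact Finset.sum_congr rfl fun a _ => by ring
    simp only [h2] at h1
    refine h1.trans (Real.exp_le_exp.2 ?_)
    have h3 : ∑ a, (s * l * c a) ^ 2 = l ^ 2 * ∑ a, c a ^ 2 := by
      rw [Finset.mul_sum]; exact Finset.sum_congr rfl fun a _ => by rw [mul_pow, mul_pow, hs]; ring
    rw [h3, hl2]
    calc 2 * k / v * (∑ a, c a ^ 2) / 2 ≤ 2 * k / v * v / 2 := by gcongr
      _ = k := by field_simp
  have hpt : ∀ y : ℝ, y ^ (2 * k) ≤ (2 * k).factorial * (Real.exp (1 * y) + Real.exp (-1 * y)) := by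
    intro y
    have h1 := Real.pow_div_factorial_le_exp |y| (abs_nonneg y) (2 * k)
    rw [div_le_iff₀ (by positivity)] at h1
    have h2 : |y| ^ (2 * k) = y ^ (2 * k) := by rw [pow_mul, sq_abs, ← pow_mul]
    rw [h2] at h1
    have h3 : Real.exp |y| ≤ Real.exp (1 * y) + Real.exp (-1 * y) := by
      rcases abs_cases y with ⟨h, _⟩ | ⟨h, _⟩ <;> rw [h]
      · simpa using (Real.exp_pos _).le
      · simpa using (Real.exp_pos _).le
    calc _ ≤ _ := h1
      _ ≤ (Real.exp (1 * y) + Real.exp (-1 * y)) * (2 * k).factorial := by gcongr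
      _ = _ := by ring
  have hmain : l ^ (2 * k) * 𝔼 σ : ι → ℤˣ, (∑ a, signVec σ a * c a) ^ (2 * k) ≤
      (2 * k).factorial * (2 * Real.exp k) := by
    rw [Finset.mul_expect]
    calc _ ≤ 𝔼 σ : ι → ℤˣ, ((2 * k).factorial * (Real.exp (1 * (l * ∑ a, signVec σ a * c a)) +
          Real.exp (-1 * (l * ∑ a, signVec σ a * c a)))) := by
          refine Finset.expect_le_expect fun σ _ => ?_
          rw [← mul_pow]; exact hpt _
      _ ≤ _ := by
          rw [← Finset.mul_expect, Finset.expect_add_distrib]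
          have := hexp 1 (by norm_num)
          have := hexp (-1) (by norm_num)
          gcongr
          linarith
  have hfac : ((2 * k).factorial : ℝ) ≤ (2 * k) ^ (2 * k) := by
    exact_mod_cast Nat.factorial_le_pow (2 * k)
  have hek : Real.exp k ≤ 2.7182818286 ^ k := by
    rw [← Real.exp_one_pow]
    exact pow_le_pow_left₀ (Real.exp_pos _).le Real.exp_one_lt_d9.le k
  have h2k : (2 : ℝ) ≤ 2 ^ k := by
    calc (2 : ℝ) = 2 ^ 1 := by norm_num
      _ ≤ _ := pow_le_pow_right₀ (by norm_num) hk
  rw [pow_mul, hl2] at hmain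
  have hpos : 0 < (2 * (k : ℝ) / v) ^ k := by positivity
  refine le_of_mul_le_mul_left (hmain.trans ?_) hpos
  calc ((2 * k).factorial : ℝ) * (2 * Real.exp k)
      ≤ (2 * k) ^ (2 * k) * (2 ^ k * 2.7182818286 ^ k) := by gcongr
    _ = (2 * k / v) ^ k * ((2 * 2 * 2.7182818286) * k * v) ^ k := by
      rw [← mul_pow, pow_mul, ← mul_pow, ← mul_pow]
      congr 1; field_simp
    _ ≤ _ := by gcongr; norm_num

lemma expect_signVec_mul (a b : ι) :
    𝔼 σ : ι → ℤˣ, signVec σ a * signVec σ b = if a = b then 1 else 0 := by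
  split_ifs with h
  · subst h
    have : ∀ σ : ι → ℤˣ, signVec σ a * signVec σ a = 1 := fun σ => by
      rcases signVec_eq σ a with h | h <;> rw [h] <;> norm_num
    simp [this]
  -- Flipping the sign at `a` preserves the average but negates the product.
  · have h1 := expect_comp_mul_left (fun σ => signVec σ a * signVec σ b) (Pi.mulSingle a (-1))
    have h2 : ∀ σ : ι → ℤˣ, signVec (Pi.mulSingle a (-1) * σ) a * signVec (Pi.mulSingle a (-1) * σ) b =
        -(signVec σ a * signVec σ b) := fun σ => by
      rw [signVec_mul, signVec_mul]
      simp [signVec, Ne.symm h]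
    simp only [h2, Finset.expect_neg_distrib] at h1
    linarith

variable {W : Type*} [NormedAddCommGroup W] [InnerProductSpace ℝ W]

lemma expect_norm_sum_signVec_sq (y : ι → W) :
    𝔼 σ : ι → ℤˣ, ‖∑ a, signVec σ a • y a‖ ^ 2 = ∑ a, ‖y a‖ ^ 2 := by
  have h : ∀ σ : ι → ℤˣ, ‖∑ a, signVec σ a • y a‖ ^ 2 =
      ∑ a, ∑ b, (signVec σ a * signVec σ b) * ⟪y a, y b⟫_ℝ := fun σ => by
    rw [← real_inner_self_eq_norm_sq]
    simp only [sum_inner, inner_sum, inner_smul_left, inner_smul_right, RCLike.conj_to_real]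
    refine Finset.sum_congr rfl fun a _ => ?_
    rw [Finset.mul_sum]
    refine Finset.sum_congr rfl fun b _ => ?_
    rw [real_inner_comm]; ring
  simp only [h, Finset.expect_sum_comm, ← Finset.expect_mul, expect_signVec_mul]
  simp

/-- The part of a sign pattern on which a second pattern is positive. -/
noncomputable def signPart (τ σ : ι → ℤˣ) : ι → ℝ :=
  (2 : ℝ)⁻¹ • (signVec σ + signVec (τ * σ))

omit [Fintype ι] [DecidableEq ι] in
lemma signPart_neg (τ σ : ι → ℤˣ) : signPart (-τ) σ = (2 : ℝ)⁻¹ • (signVec σ - signVec (τ * σ)) := by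
  ext a
  simp [signPart, signVec]
  ring

omit [Fintype ι] [DecidableEq ι] in
lemma abs_signPart_le (τ σ : ι → ℤˣ) (a : ι) : signPart τ σ a ^ 2 ≤ 1 := by
  simp only [signPart, Pi.smul_apply, Pi.add_apply, signVec_mul, smul_eq_mul]
  rcases signVec_eq σ a with h | h <;> rcases signVec_eq τ a with h' | h' <;> rw [h, h'] <;> norm_num

/-- The two parts depend on σ through disjoint sets of coordinates. Multiplying σ by θ only where τ
= -1 preserves the uniform law and the first part, and randomises the second afresh. -/
lemma expect_signPart (τ : ι → ℤˣ) (f : (ι → ℝ) → (ι → ℝ) → ℝ) :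
    𝔼 σ, f (signPart τ σ) (signPart (-τ) σ) =
      𝔼 σ, 𝔼 θ, f (signPart τ σ) (fun a => signVec θ a * signPart (-τ) σ a) := by
  rw [Finset.expect_comm]
  have h : ∀ θ : ι → ℤˣ, 𝔼 σ, f (signPart τ σ) (fun a => signVec θ a * signPart (-τ) σ a) =
      𝔼 σ, f (signPart τ σ) (signPart (-τ) σ) := fun θ => by
    rw [← expect_comp_mul_left (fun σ => f (signPart τ σ) (signPart (-τ) σ))
      (fun a => if τ a = 1 then 1 else θ a)]
    refine Finset.expect_congr rfl fun σ _ => ?_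
    congr 1
    · ext a
      rcases Int.units_eq_one_or (τ a) with h | h <;> simp [signPart, signVec, h]
    · ext a
      rcases Int.units_eq_one_or (τ a) with h | h <;> simp [signPart, signVec, h]
      ring
  simp only [h, Fintype.expect_const]

end RademacherChaos

/-! ### Chaining for a decoupled chaos of order two. -/

section ChaosChaining

open scoped InnerProductSpace BigOperators

set_option linter.unusedSectionVars false

variable {ι : Type*} [Fintype ι] [DecidableEq ι]
  {W : Type*} [NormedAddCommGroup W] [InnerProductSpace ℝ W]
  {V : Type*} [AddCommGroup V] [Module ℝ V]

lemma inner_map_eq_sum_single (A : (ι → ℝ) →ₗ[ℝ] W) (u : ι → ℝ) (z : W) :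
    ⟪A u, z⟫_ℝ = ∑ a, u a * ⟪A (Pi.single a 1), z⟫_ℝ := by
  rw [LinearMap.pi_apply_eq_sum_univ A u, sum_inner]
  refine Finset.sum_congr rfl fun a _ => ?_
  rw [inner_smul_left, RCLike.conj_to_real]
  congr 4
  ext b
  simp [Pi.single_apply, eq_comm]

/-- The largest value of `‖B y u‖` for `y` in a finite set. -/
noncomputable def supNorm (B : V →ₗ[ℝ] (ι → ℝ) →ₗ[ℝ] W) {F : Finset V} (hF : F.Nonempty)
    (u : ι → ℝ) : ℝ :=
  F.sup' hF fun y => ‖B y u‖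

lemma norm_le_supNorm (B : V →ₗ[ℝ] (ι → ℝ) →ₗ[ℝ] W) {F : Finset V} (hF : F.Nonempty)
    (u : ι → ℝ) {y : V} (hy : y ∈ F) : ‖B y u‖ ≤ supNorm B hF u :=
  Finset.le_sup' (fun y => ‖B y u‖) hy

lemma supNorm_nonneg (B : V →ₗ[ℝ] (ι → ℝ) →ₗ[ℝ] W) {F : Finset V} (hF : F.Nonempty)
    (u : ι → ℝ) : 0 ≤ supNorm B hF u :=
  let ⟨_, hy⟩ := hF
  (norm_nonneg _).trans (norm_le_supNorm B hF u hy)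

/-- Normalised moment sum controlling all links of a chain simultaneously. -/
noncomputable def chainSum (B : V →ₗ[ℝ] (ι → ℝ) →ₗ[ℝ] W) (ρ : V → ℝ) (J : ℕ → Finset (V × V))
    (k M : ℕ) (N : ℝ) (w u : ι → ℝ) : ℝ :=
  1 + ∑ r ∈ Finset.Ico k M, ∑ t ∈ J r,
    (⟪B t.1 w, B t.2 u⟫_ℝ / (40 * √2 ^ r * ρ t.1 * N)) ^ (2 * 2 ^ r)

lemma one_le_chainSum (B : V →ₗ[ℝ] (ι → ℝ) →ₗ[ℝ] W) (ρ : V → ℝ) (J : ℕ → Finset (V × V))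
    (k M : ℕ) (N : ℝ) (w u : ι → ℝ) : 1 ≤ chainSum B ρ J k M N w u :=
  le_add_of_nonneg_right (Finset.sum_nonneg fun _ _ => Finset.sum_nonneg fun _ _ =>
    Even.pow_nonneg (even_two_mul _) _)

variable {B : V →ₗ[ℝ] (ι → ℝ) →ₗ[ℝ] W} {ρ : V → ℝ}

/-- With `u` frozen, each link is a Rademacher sum of variance at most (ρ·N)², where N is the
supremum of the norms at `u`. Khintchine's inequality of order 2·2^r bounds its normalised moment by
(11/1600)^{2^r}, which beats the 64^{2^r} links at level `r`, as 64 · 11/1600 < 1/2. -/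
lemma expect_chainSum_le
    (hB : ∀ x z, ∑ a, ⟪B x (Pi.single a 1), z⟫_ℝ ^ 2 ≤ ρ x ^ 2 * ‖z‖ ^ 2)
    {F : Finset V} (hF : F.Nonempty) {J : ℕ → Finset (V × V)} {k M : ℕ}
    (hJ : ∀ r ∈ Finset.Ico k M, ∀ t ∈ J r, t.2 ∈ F)
    (hJc : ∀ r ∈ Finset.Ico k M, (J r).card ≤ 64 ^ 2 ^ r) (u w : ι → ℝ) (hw : ∀ a, w a ^ 2 ≤ 1) :
    𝔼 θ : ι → ℤˣ, chainSum B ρ J k M (supNorm B hF u) (fun a => signVec θ a * w a) u ≤ 2 := by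
  have hterm : ∀ r ∈ Finset.Ico k M, ∀ t ∈ J r,
      𝔼 θ : ι → ℤˣ, (⟪B t.1 (fun a => signVec θ a * w a), B t.2 u⟫_ℝ /
        (40 * √2 ^ r * ρ t.1 * supNorm B hF u)) ^ (2 * 2 ^ r) ≤ (11 / 1600) ^ 2 ^ r := by
    intro r hr t ht
    set D := 40 * √2 ^ r * ρ t.1 * supNorm B hF u with hD
    have h1 : ∀ θ : ι → ℤˣ, ⟪B t.1 (fun a => signVec θ a * w a), B t.2 u⟫_ℝ / D =
        ∑ a, signVec θ a * (w a * ⟪B t.1 (Pi.single a 1), B t.2 u⟫_ℝ / D) := fun θ => by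
      rw [inner_map_eq_sum_single, Finset.sum_div]
      exact Finset.sum_congr rfl fun a _ => by ring
    have hs2 : (√2 ^ r) ^ 2 = (2 : ℝ) ^ r := by
      rw [← pow_mul, mul_comm, pow_mul, Real.sq_sqrt (by norm_num)]
    have h2 : ∑ a, (w a * ⟪B t.1 (Pi.single a 1), B t.2 u⟫_ℝ / D) ^ 2 ≤ 1 / (1600 * 2 ^ r) := by
      rcases eq_or_ne D 0 with h0 | h0
      · simp [h0]
      have hD2 : 0 < D ^ 2 := by positivity
      calc ∑ a, (w a * ⟪B t.1 (Pi.single a 1), B t.2 u⟫_ℝ / D) ^ 2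
          ≤ ∑ a, ⟪B t.1 (Pi.single a 1), B t.2 u⟫_ℝ ^ 2 / D ^ 2 := by
            refine Finset.sum_le_sum fun a _ => ?_
            rw [div_pow, mul_pow]
            gcongr
            exact mul_le_of_le_one_left (sq_nonneg _) (hw a)
        _ ≤ ρ t.1 ^ 2 * supNorm B hF u ^ 2 / D ^ 2 := by
            rw [← Finset.sum_div]
            gcongr
            refine (hB _ _).trans ?_
            gcongr
            exact norm_le_supNorm B hF u (hJ r hr t ht)
        _ = _ := by
            rw [div_eq_div_iff hD2.ne' (by positivity), hD, mul_pow, mul_pow, mul_pow, hs2]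
            ring
    simp only [h1]
    refine (expect_signVec_pow_le h2 Nat.one_le_two_pow).trans (le_of_eq ?_)
    congr 1
    push_cast
    field_simp
  unfold chainSum
  rw [Finset.expect_add_distrib, Fintype.expect_const, Finset.expect_sum_comm]
  simp only [Finset.expect_sum_comm]
  have hr : ∀ r ∈ Finset.Ico k M, ∑ t ∈ J r,
      𝔼 θ : ι → ℤˣ, (⟪B t.1 (fun a => signVec θ a * w a), B t.2 u⟫_ℝ /
        (40 * √2 ^ r * ρ t.1 * supNorm B hF u)) ^ (2 * 2 ^ r) ≤ (1 / 2) * (1 / 2) ^ r := by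
    intro r hr
    calc _ ≤ ∑ _t ∈ J r, (11 / 1600 : ℝ) ^ 2 ^ r := Finset.sum_le_sum fun t ht => hterm r hr t ht
      _ = (J r).card * (11 / 1600 : ℝ) ^ 2 ^ r := by rw [Finset.sum_const, nsmul_eq_mul]
      _ ≤ (64 : ℝ) ^ 2 ^ r * (11 / 1600 : ℝ) ^ 2 ^ r := by
          gcongr; exact_mod_cast hJc r hr
      _ ≤ (1 / 2 : ℝ) ^ 2 ^ r := by rw [← mul_pow]; gcongr; norm_num
      _ ≤ (1 / 2 : ℝ) ^ (r + 1) :=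
          pow_le_pow_of_le_one (by norm_num) (by norm_num) Nat.lt_two_pow_self
      _ = _ := by rw [pow_succ']
  have hgeo : ∑ r ∈ Finset.Ico k M, (1 / 2 : ℝ) * (1 / 2) ^ r ≤ 1 := by
    calc _ ≤ ∑ r ∈ Finset.range M, (1 / 2 : ℝ) * (1 / 2) ^ r :=
          Finset.sum_le_sum_of_subset_of_nonneg
            (fun r hr => Finset.mem_range.2 (Finset.mem_Ico.1 hr).2) fun _ _ _ => by positivity
      _ ≤ (1 / 2) * 2 := by
          rw [← Finset.mul_sum]
          gcongr
          simpa [one_div] using (summable_geometric_two.sum_le_tsum (Finset.range M)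
            fun _ _ => by positivity).trans_eq tsum_geometric_two
      _ = 1 := by norm_num
  linarith [(Finset.sum_le_sum hr).trans hgeo]

/-- A single term is at most the whole sum. On levels r ≥ k the exponent 2·2^r is at least `p`, so
one p-th root controls every link at once; the summand 1 covers normalised values below one. If the
normaliser vanishes, `hB` forces the link to vanish too. -/
lemma abs_inner_le_chainSum
    (hB : ∀ x z, ∑ a, ⟪B x (Pi.single a 1), z⟫_ℝ ^ 2 ≤ ρ x ^ 2 * ‖z‖ ^ 2) (hρ : ∀ x, 0 ≤ ρ x)
    {F : Finset V} (hF : F.Nonempty) {J : ℕ → Finset (V × V)} {k M : ℕ}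
    (hJ : ∀ r ∈ Finset.Ico k M, ∀ t ∈ J r, t.2 ∈ F) {p : ℕ} (hp0 : p ≠ 0) (hp : p ≤ 2 * 2 ^ k)
    (u w : ι → ℝ) {r : ℕ} (hr : r ∈ Finset.Ico k M) {t : V × V} (ht : t ∈ J r) :
    |⟪B t.1 w, B t.2 u⟫_ℝ| ≤ chainSum B ρ J k M (supNorm B hF u) w u ^ (p : ℝ)⁻¹ *
      (40 * √2 ^ r * ρ t.1 * supNorm B hF u) := by
  set S := chainSum B ρ J k M (supNorm B hF u) w u with hS
  have hS1 : 1 ≤ S := one_le_chainSum ..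
  set D := 40 * √2 ^ r * ρ t.1 * supNorm B hF u with hD
  have hD0 : 0 ≤ D := by
    have := supNorm_nonneg B hF u
    have := hρ t.1
    positivity
  rcases hD0.eq_or_lt with h0 | hDpos
  · rw [← h0, mul_zero]
    have hz : ρ t.1 * supNorm B hF u = 0 := by
      have hne : (40 : ℝ) * √2 ^ r ≠ 0 := by positivity
      have : 40 * √2 ^ r * (ρ t.1 * supNorm B hF u) = 0 := by rw [← mul_assoc, ← hD, ← h0]
      exact (mul_eq_zero.1 this).resolve_left hne
    have h1 : ∑ a, ⟪B t.1 (Pi.single a 1), B t.2 u⟫_ℝ ^ 2 ≤ 0 := by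
      refine (hB _ _).trans ?_
      rw [← mul_pow]
      have h2 : ρ t.1 * ‖B t.2 u‖ ≤ ρ t.1 * supNorm B hF u :=
        mul_le_mul_of_nonneg_left (norm_le_supNorm B hF u (hJ r hr t ht)) (hρ _)
      have h3 : 0 ≤ ρ t.1 * ‖B t.2 u‖ := mul_nonneg (hρ _) (norm_nonneg _)
      have h4 : ρ t.1 * ‖B t.2 u‖ = 0 := by linarith
      rw [h4]; norm_num
    have h5 : ∀ a, ⟪B t.1 (Pi.single a 1), B t.2 u⟫_ℝ = 0 := fun a => by
      have := (Finset.sum_eq_zero_iff_of_nonneg fun a _ => sq_nonneg _).1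
        (le_antisymm h1 (Finset.sum_nonneg fun a _ => sq_nonneg _)) a (Finset.mem_univ a)
      exact pow_eq_zero_iff (by norm_num) |>.1 this
    rw [inner_map_eq_sum_single]
    simp [h5]
  · set y := |⟪B t.1 w, B t.2 u⟫_ℝ| / D with hy
    have hy0 : 0 ≤ y := by positivity
    have hle : y ^ p ≤ S := by
      rcases le_total y 1 with h | h
      · exact (pow_le_one₀ hy0 h).trans hS1
      · have hpr : p ≤ 2 * 2 ^ r := hp.trans (Nat.mul_le_mul_left 2
          (Nat.pow_le_pow_right (by norm_num) (Finset.mem_Ico.1 hr).1))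
        refine (pow_le_pow_right₀ h hpr).trans ?_
        have e : y ^ (2 * 2 ^ r) = (⟪B t.1 w, B t.2 u⟫_ℝ / D) ^ (2 * 2 ^ r) := by
          have e2 : y ^ 2 = (⟪B t.1 w, B t.2 u⟫_ℝ / D) ^ 2 := by rw [hy, div_pow, div_pow, sq_abs]
          rw [pow_mul, e2, ← pow_mul]
        rw [e, hS]
        unfold chainSum
        have hnn : ∀ r' (t' : V × V), 0 ≤ (⟪B t'.1 w, B t'.2 u⟫_ℝ /
            (40 * √2 ^ r' * ρ t'.1 * supNorm B hF u)) ^ (2 * 2 ^ r') := fun r' t' =>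
          Even.pow_nonneg (even_two_mul _) _
        have h1 := Finset.single_le_sum (f := fun r' => ∑ t' ∈ J r', (⟪B t'.1 w, B t'.2 u⟫_ℝ /
            (40 * √2 ^ r' * ρ t'.1 * supNorm B hF u)) ^ (2 * 2 ^ r'))
          (fun r' _ => Finset.sum_nonneg fun t' _ => hnn r' t') hr
        have h2 := Finset.single_le_sum (f := fun t' : V × V => (⟪B t'.1 w, B t'.2 u⟫_ℝ /
            (40 * √2 ^ r * ρ t'.1 * supNorm B hF u)) ^ (2 * 2 ^ r))
          (fun t' _ => hnn r t') ht
        linarith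
    have hroot : y ≤ S ^ (p : ℝ)⁻¹ := by
      rw [← Real.pow_rpow_inv_natCast hy0 hp0]
      exact Real.rpow_le_rpow (by positivity) hle (by positivity)
    calc |⟪B t.1 w, B t.2 u⟫_ℝ| = y * D := by rw [hy]; field_simp
      _ ≤ _ := by gcongr

/-- Deterministic chaining for a bilinear form along a sequence of approximations. -/
lemma abs_inner_le_of_chain (B : V →ₗ[ℝ] (ι → ℝ) →ₗ[ℝ] W) {k M : ℕ} (hkM : k ≤ M) (π : ℕ → V)
    (u w : ι → ℝ) {c₀ : ℝ} (c : ℕ → ℝ)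
    (h0 : |⟪B (π k) u, B (π k) w⟫_ℝ| ≤ c₀)
    (h : ∀ r ∈ Finset.Ico k M, |⟪B (π (r + 1) - π r) w, B (π (r + 1)) u⟫_ℝ| +
      |⟪B (π (r + 1) - π r) u, B (π r) w⟫_ℝ| ≤ c r) :
    |⟪B (π M) u, B (π M) w⟫_ℝ| ≤ c₀ + ∑ r ∈ Finset.Ico k M, c r := by
  induction M, hkM using Nat.le_induction with
  | base => simpa using h0
  | succ M hkM ih =>
    have h1 := ih fun r hr => h r (Finset.Ico_subset_Ico_right (Nat.le_succ M) hr)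
    have h2 := h M (Finset.mem_Ico.2 ⟨hkM, Nat.lt_succ_self M⟩)
    rw [Finset.sum_Ico_succ_top hkM]
    have e : ⟪B (π (M + 1)) u, B (π (M + 1)) w⟫_ℝ = ⟪B (π M) u, B (π M) w⟫_ℝ +
        (⟪B (π (M + 1) - π M) w, B (π (M + 1)) u⟫_ℝ + ⟪B (π (M + 1) - π M) u, B (π M) w⟫_ℝ) := by
      simp only [map_sub, LinearMap.sub_apply, inner_sub_left]
      rw [real_inner_comm (B (π (M + 1)) w), real_inner_comm (B (π (M+1)) u) (B (π M) w)]
      ring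
    rw [e]
    refine (abs_add_le _ _).trans ?_
    have := abs_add_le (⟪B (π (M + 1) - π M) w, B (π (M + 1)) u⟫_ℝ)
      (⟪B (π (M + 1) - π M) u, B (π M) w⟫_ℝ)
    linarith

lemma expect_pow_le {α : Type*} [Fintype α] [Nonempty α] {f : α → ℝ} (hf : ∀ i, 0 ≤ f i) (p : ℕ) :
    (𝔼 i, f i) ^ p ≤ 𝔼 i, f i ^ p := by
  have hc : (0 : ℝ) < Fintype.card α := by exact_mod_cast Fintype.card_pos
  have := Real.pow_arith_mean_le_arith_mean_pow Finset.univ (fun _ => (1 : ℝ) / Fintype.card α) f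
    (fun _ _ => by positivity) (by simp [Finset.sum_const]) (fun i _ => hf i) p
  rw [← Finset.mul_sum, ← Finset.mul_sum] at this
  rw [Fintype.expect_eq_sum_div_card, Fintype.expect_eq_sum_div_card]
  simpa [div_eq_inv_mul] using this

lemma expect_norm_map_signVec_sq (A : (ι → ℝ) →ₗ[ℝ] W) :
    𝔼 σ : ι → ℤˣ, ‖A (signVec σ)‖ ^ 2 = ∑ a, ‖A (Pi.single a 1)‖ ^ 2 := by
  rw [← expect_norm_sum_signVec_sq]
  refine Finset.expect_congr rfl fun σ _ => ?_
  rw [LinearMap.pi_apply_eq_sum_univ A (signVec σ)]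
  congr 3
  ext a
  congr 3
  ext b
  simp [Pi.single_apply, eq_comm]

lemma four_mul_inner_signPart (A : (ι → ℝ) →ₗ[ℝ] W) (τ σ : ι → ℤˣ) :
    4 * ⟪A (signPart τ σ), A (signPart (-τ) σ)⟫_ℝ =
      ‖A (signVec σ)‖ ^ 2 - ‖A (signVec (τ * σ))‖ ^ 2 := by
  rw [signPart_neg, signPart, map_smul, map_smul, map_add, map_sub, inner_smul_left,
    inner_smul_right, RCLike.conj_to_real]
  simp only [inner_add_left, inner_sub_right, real_inner_self_eq_norm_sq]
  rw [real_inner_comm (A (signVec σ)) (A (signVec (τ * σ)))]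
  ring

/-- By polarisation the pairing of the two parts is a difference of squares at σ and τσ. For fixed σ
the pattern τσ is uniform, so the second square averages to one. -/
lemma norm_map_signVec_sq_sub_one {A : (ι → ℝ) →ₗ[ℝ] W} (hA : ∑ a, ‖A (Pi.single a 1)‖ ^ 2 = 1)
    (σ : ι → ℤˣ) :
    ‖A (signVec σ)‖ ^ 2 - 1 = 𝔼 τ : ι → ℤˣ, 4 * ⟪A (signPart τ σ), A (signPart (-τ) σ)⟫_ℝ := by
  simp only [four_mul_inner_signPart, Finset.expect_sub_distrib, Fintype.expect_const]
  congr 1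
  rw [← hA, ← expect_norm_map_signVec_sq]
  simp only [mul_comm _ σ]
  exact (expect_comp_mul_left (fun τ => ‖A (signVec τ)‖ ^ 2) σ).symm

/-- A restricted sign vector is the midpoint of two uniformly distributed ones; convexity does the
rest. -/
lemma expect_supNorm_signPart_pow_le (B : V →ₗ[ℝ] (ι → ℝ) →ₗ[ℝ] W) {F : Finset V}
    (hF : F.Nonempty) (τ : ι → ℤˣ) (p : ℕ) :
    𝔼 σ : ι → ℤˣ, supNorm B hF (signPart τ σ) ^ p ≤ 𝔼 σ : ι → ℤˣ, supNorm B hF (signVec σ) ^ p := by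
  have h1 : ∀ σ, supNorm B hF (signPart τ σ) ≤
      (1 / 2) * supNorm B hF (signVec σ) + (1 / 2) * supNorm B hF (signVec (τ * σ)) := by
    intro σ
    refine Finset.sup'_le _ _ fun y hy => ?_
    rw [signPart, map_smul, map_add, norm_smul]
    have h2 := norm_le_supNorm B hF (signVec σ) hy
    have h3 := norm_le_supNorm B hF (signVec (τ * σ)) hy
    have h4 := norm_add_le (B y (signVec σ)) (B y (signVec (τ * σ)))
    rw [Real.norm_of_nonneg (by norm_num)]
    linarith
  calc _ ≤ 𝔼 σ : ι → ℤˣ, ((1 / 2) * supNorm B hF (signVec σ) ^ p +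
        (1 / 2) * supNorm B hF (signVec (τ * σ)) ^ p) := by
        refine Finset.expect_le_expect fun σ _ => ?_
        refine (pow_le_pow_left₀ (supNorm_nonneg _ _ _) (h1 σ) p).trans ?_
        exact (convexOn_pow p).2 (supNorm_nonneg B hF _) (supNorm_nonneg B hF _)
          (by norm_num) (by norm_num) (by norm_num)
    _ = _ := by
        rw [Finset.expect_add_distrib, ← Finset.mul_expect, ← Finset.mul_expect,
          expect_comp_mul_left (fun σ => supNorm B hF (signVec σ) ^ p) τ]
        ring

/-- Moment bound for the supremum of a Rademacher chaos of order two along an admissible sequence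
in terms of the moments of the supremum of the norms. -/
theorem expect_chaos_pow_le_mul
    (hB : ∀ x z, ∑ a, ⟪B x (Pi.single a 1), z⟫_ℝ ^ 2 ≤ ρ x ^ 2 * ‖z‖ ^ 2) (hρ : ∀ x, 0 ≤ ρ x)
    {A : ℕ → Finset V} (hAm : Monotone A) (hAc : ∀ r, (A r).card ≤ 2 ^ 2 ^ r) {k M : ℕ} (hkM : k < M)
    (hF : (A M).Nonempty) (hB1 : ∀ y ∈ A M, ∑ a, ‖B y (Pi.single a 1)‖ ^ 2 = 1) {Γ : ℝ} (hΓ : 0 ≤ Γ)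
    (hchain : ∀ y ∈ A M, ∃ π : ℕ → V, (∀ r, π r ∈ A r) ∧ π M = y ∧
      √2 ^ k * ρ (π k) + ∑ r ∈ Finset.Ico k M, √2 ^ r * ρ (π (r + 1) - π r) ≤ Γ) :
    𝔼 σ : ι → ℤˣ, ((A M).sup' hF fun y => |‖B y (signVec σ)‖ ^ 2 - 1|) ^ (2 * 2 ^ k) ≤
      2 * (320 * Γ) ^ (2 * 2 ^ k) *
        𝔼 σ : ι → ℤˣ, supNorm B hF (signVec σ) ^ (2 * 2 ^ k) := by
  classical
  set p := 2 * 2 ^ k with hp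
  have hp0 : p ≠ 0 := by positivity
  -- Inserting 0 among the subtracted points makes the starting point of a chain a link as well. The
  -- second component runs over the points a link is paired with. Each of the three choices has at
  -- most 4^{2^r} values.
  let J : ℕ → Finset (V × V) := fun r =>
    ((A (r + 1) ×ˢ insert 0 (A r)).image fun q => q.1 - q.2) ×ˢ A (r + 1)
  have hJ : ∀ r ∈ Finset.Ico k M, ∀ t ∈ J r, t.2 ∈ A M := fun r hr t ht =>
    hAm (Nat.succ_le_of_lt (Finset.mem_Ico.1 hr).2) (Finset.mem_product.1 ht).2
  have hJc : ∀ r ∈ Finset.Ico k M, (J r).card ≤ 64 ^ 2 ^ r := by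
    intro r _
    have e1 : ((A (r + 1) ×ˢ insert 0 (A r)).image fun q => q.1 - q.2).card ≤
        2 ^ 2 ^ (r + 1) * (2 ^ 2 ^ r + 1) := by
      refine Finset.card_image_le.trans ?_
      rw [Finset.card_product]
      exact Nat.mul_le_mul (hAc _) ((Finset.card_insert_le _ _).trans (Nat.succ_le_succ (hAc r)))
    have e2 : 2 ^ 2 ^ (r + 1) = 4 ^ 2 ^ r := by
      rw [pow_succ, mul_comm, pow_mul]; norm_num
    have e3 : 2 ^ 2 ^ r + 1 ≤ 4 ^ 2 ^ r := by
      exact Nat.pow_lt_pow_left (by norm_num) (by positivity)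
    calc (J r).card ≤ (4 ^ 2 ^ r * 4 ^ 2 ^ r) * 4 ^ 2 ^ r := by
          rw [Finset.card_product]
          refine Nat.mul_le_mul (e1.trans ?_) ((hAc _).trans e2.le)
          rw [e2]
          exact Nat.mul_le_mul_left _ e3
      _ = 64 ^ 2 ^ r := by rw [← mul_pow, ← mul_pow]; norm_num
  set N : (ι → ℝ) → ℝ := supNorm B hF with hN
  set S : (ι → ℝ) → (ι → ℝ) → ℝ := fun w u => chainSum B ρ J k M (N u) w u with hSdef
  have hN0 : ∀ u, 0 ≤ N u := supNorm_nonneg B hF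
  have hS0 : ∀ w u, 0 ≤ S w u := fun w u => zero_le_one.trans (one_le_chainSum ..)
  have hbil : ∀ (u w : ι → ℝ), ∀ y ∈ A M, |⟪B y u, B y w⟫_ℝ| ≤
      40 * Γ * (S w u ^ (p : ℝ)⁻¹ * N u + S u w ^ (p : ℝ)⁻¹ * N w) := by
    intro u w y hy
    obtain ⟨π, hπ, hπM, hsum⟩ := hchain y hy
    set h1 := S w u ^ (p : ℝ)⁻¹
    set h2 := S u w ^ (p : ℝ)⁻¹
    have hh1 : 0 ≤ h1 := Real.rpow_nonneg (hS0 _ _) _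
    have hh2 : 0 ≤ h2 := Real.rpow_nonneg (hS0 _ _) _
    have hmem : ∀ r, (π (r + 1) - π r, π (r + 1)) ∈ J r ∧ (π (r + 1) - π r, π r) ∈ J r ∧
        (π r, π r) ∈ J r := fun r => by
      have hsub := hAm (Nat.le_succ r) (hπ r)
      refine ⟨Finset.mem_product.2 ⟨Finset.mem_image.2 ⟨(π (r + 1), π r), ?_, rfl⟩, hπ _⟩,
        Finset.mem_product.2 ⟨Finset.mem_image.2 ⟨(π (r + 1), π r), ?_, rfl⟩, hsub⟩,
        Finset.mem_product.2 ⟨Finset.mem_image.2 ⟨(π r, 0), ?_, sub_zero _⟩, hsub⟩⟩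
      · exact Finset.mem_product.2 ⟨hπ _, Finset.mem_insert_of_mem (hπ r)⟩
      · exact Finset.mem_product.2 ⟨hπ _, Finset.mem_insert_of_mem (hπ r)⟩
      · exact Finset.mem_product.2 ⟨hsub, Finset.mem_insert_self _ _⟩
    have hk : k ∈ Finset.Ico k M := Finset.mem_Ico.2 ⟨le_rfl, hkM⟩
    have hfin := abs_inner_le_of_chain B hkM.le π u w
      (c₀ := h1 * (40 * √2 ^ k * ρ (π k) * N u))
      (fun r => h1 * (40 * √2 ^ r * ρ (π (r + 1) - π r) * N u) +
        h2 * (40 * √2 ^ r * ρ (π (r + 1) - π r) * N w))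
      (by
        rw [real_inner_comm]
        exact abs_inner_le_chainSum hB hρ hF hJ hp0 le_rfl u w hk (hmem k).2.2)
      (fun r hr => add_le_add
        (abs_inner_le_chainSum hB hρ hF hJ hp0 le_rfl u w hr (hmem r).1)
        (abs_inner_le_chainSum hB hρ hF hJ hp0 le_rfl w u hr (hmem r).2.1))
    rw [hπM] at hfin
    refine hfin.trans ?_
    have e : ∑ r ∈ Finset.Ico k M, (h1 * (40 * √2 ^ r * ρ (π (r + 1) - π r) * N u) +
        h2 * (40 * √2 ^ r * ρ (π (r + 1) - π r) * N w)) =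
        40 * (∑ r ∈ Finset.Ico k M, √2 ^ r * ρ (π (r + 1) - π r)) * (h1 * N u + h2 * N w) := by
      rw [Finset.mul_sum, Finset.sum_mul]
      exact Finset.sum_congr rfl fun r _ => by ring
    rw [e]
    have hu : 0 ≤ h1 * N u := mul_nonneg hh1 (hN0 u)
    have hw : 0 ≤ h2 * N w := mul_nonneg hh2 (hN0 w)
    have hk0 : 0 ≤ √2 ^ k * ρ (π k) := mul_nonneg (by positivity) (hρ _)
    nlinarith [mul_nonneg hk0 hw, mul_le_mul_of_nonneg_right hsum (add_nonneg hu hw)]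
  set Z : (ι → ℤˣ) → ℝ := fun σ => (A M).sup' hF fun y => |‖B y (signVec σ)‖ ^ 2 - 1| with hZ
  have hZ0 : ∀ σ, 0 ≤ Z σ := fun σ =>
    let ⟨y, hy⟩ := hF
    (abs_nonneg _).trans (Finset.le_sup' (fun y => |‖B y (signVec σ)‖ ^ 2 - 1|) hy)
  have hroot : ∀ w u, (S w u ^ (p : ℝ)⁻¹) ^ p = S w u := fun w u =>
    Real.rpow_inv_natCast_pow (hS0 w u) hp0
  have hZp : ∀ σ, Z σ ^ p ≤ 𝔼 τ : ι → ℤˣ, (160 * Γ) ^ p * (2 ^ (p - 1) *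
      (S (signPart (-τ) σ) (signPart τ σ) * N (signPart τ σ) ^ p +
        S (signPart τ σ) (signPart (-τ) σ) * N (signPart (-τ) σ) ^ p)) := by
    intro σ
    set f : (ι → ℤˣ) → ℝ := fun τ => 160 * Γ *
      (S (signPart (-τ) σ) (signPart τ σ) ^ (p : ℝ)⁻¹ * N (signPart τ σ) +
        S (signPart τ σ) (signPart (-τ) σ) ^ (p : ℝ)⁻¹ * N (signPart (-τ) σ)) with hf
    have hf0 : ∀ τ, 0 ≤ f τ := fun τ => mul_nonneg (by positivity) (add_nonneg
      (mul_nonneg (Real.rpow_nonneg (hS0 _ _) _) (hN0 _))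
      (mul_nonneg (Real.rpow_nonneg (hS0 _ _) _) (hN0 _)))
    have hle : Z σ ≤ 𝔼 τ, f τ := by
      refine Finset.sup'_le _ _ fun y hy => ?_
      rw [norm_map_signVec_sq_sub_one (hB1 y hy)]
      refine (Finset.abs_expect_le _ _).trans (Finset.expect_le_expect fun τ _ => ?_)
      rw [abs_mul, abs_of_nonneg (by norm_num : (0 : ℝ) ≤ 4)]
      have := hbil (signPart τ σ) (signPart (-τ) σ) y hy
      simp only [hf]
      linarith
    refine (pow_le_pow_left₀ (hZ0 σ) hle p).trans ((expect_pow_le hf0 p).trans ?_)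
    refine Finset.expect_le_expect fun τ _ => ?_
    simp only [hf]
    rw [mul_pow]
    refine mul_le_mul_of_nonneg_left ?_ (by positivity)
    refine (add_pow_le (mul_nonneg (Real.rpow_nonneg (hS0 _ _) _) (hN0 _))
      (mul_nonneg (Real.rpow_nonneg (hS0 _ _) _) (hN0 _)) p).trans (le_of_eq ?_)
    rw [mul_pow, mul_pow, hroot, hroot]
  -- The factor N depends on the first part only. After the second part has been randomised afresh,
  -- the average of the chain sum is at most 2 with the first part frozen. The mirror term is the
  -- case of -τ.
  have hτ : ∀ τ : ι → ℤˣ, 𝔼 σ, S (signPart (-τ) σ) (signPart τ σ) * N (signPart τ σ) ^ p ≤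
      2 * 𝔼 σ : ι → ℤˣ, N (signVec σ) ^ p := by
    intro τ
    rw [expect_signPart τ (fun u w => S w u * N u ^ p)]
    calc _ ≤ 𝔼 σ, 2 * N (signPart τ σ) ^ p := by
          refine Finset.expect_le_expect fun σ _ => ?_
          rw [← Finset.expect_mul]
          refine mul_le_mul_of_nonneg_right ?_ (pow_nonneg (hN0 _) p)
          exact expect_chainSum_le hB hF hJ hJc _ _ (abs_signPart_le _ σ)
      _ ≤ _ := by
          rw [← Finset.mul_expect]
          refine mul_le_mul_of_nonneg_left ?_ (by norm_num)
          exact expect_supNorm_signPart_pow_le B hF τ p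
  calc 𝔼 σ, Z σ ^ p ≤ _ := Finset.expect_le_expect fun σ _ => hZp σ
    _ = 𝔼 τ : ι → ℤˣ, (160 * Γ) ^ p * (2 ^ (p - 1) *
        (𝔼 σ, S (signPart (-τ) σ) (signPart τ σ) * N (signPart τ σ) ^ p +
          𝔼 σ, S (signPart τ σ) (signPart (-τ) σ) * N (signPart (-τ) σ) ^ p)) := by
        rw [Finset.expect_comm]
        refine Finset.expect_congr rfl fun τ _ => ?_
        rw [← Finset.mul_expect, ← Finset.mul_expect, Finset.expect_add_distrib]
    _ ≤ 𝔼 τ : ι → ℤˣ, (160 * Γ) ^ p * (2 ^ (p - 1) * (2 * 𝔼 σ : ι → ℤˣ, N (signVec σ) ^ p +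
          2 * 𝔼 σ : ι → ℤˣ, N (signVec σ) ^ p)) := by
        refine Finset.expect_le_expect fun τ _ => ?_
        have h2 := hτ (-τ)
        rw [neg_neg] at h2
        have h1 := hτ τ
        gcongr
    _ = _ := by
        rw [Fintype.expect_const]
        have : (2 : ℝ) ^ p = 2 ^ (p - 1) * 2 := by
          rw [← pow_succ, Nat.sub_add_cancel (Nat.pos_of_ne_zero hp0)]
        have e : (320 * Γ) ^ p = (160 * Γ) ^ p * 2 ^ p := by rw [← mul_pow]; ring
        rw [e, this]; ring

/-- Moment bound for the supremum of a Rademacher chaos of order two. -/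
theorem expect_chaos_pow_le
    (hB : ∀ x z, ∑ a, ⟪B x (Pi.single a 1), z⟫_ℝ ^ 2 ≤ ρ x ^ 2 * ‖z‖ ^ 2) (hρ : ∀ x, 0 ≤ ρ x)
    {A : ℕ → Finset V} (hAm : Monotone A) (hAc : ∀ r, (A r).card ≤ 2 ^ 2 ^ r) {k M : ℕ} (hkM : k < M)
    (hF : (A M).Nonempty) (hB1 : ∀ y ∈ A M, ∑ a, ‖B y (Pi.single a 1)‖ ^ 2 = 1) {Γ : ℝ} (hΓ : 0 ≤ Γ)
    (hΓ1 : 960 * Γ ≤ 1)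
    (hchain : ∀ y ∈ A M, ∃ π : ℕ → V, (∀ r, π r ∈ A r) ∧ π M = y ∧
      √2 ^ k * ρ (π k) + ∑ r ∈ Finset.Ico k M, √2 ^ r * ρ (π (r + 1) - π r) ≤ Γ) :
    𝔼 σ : ι → ℤˣ, ((A M).sup' hF fun y => |‖B y (signVec σ)‖ ^ 2 - 1|) ^ (2 * 2 ^ k) ≤
      (960 * Γ) ^ (2 * 2 ^ k) := by
  have hmain := expect_chaos_pow_le_mul hB hρ hAm hAc hkM hF hB1 hΓ hchain
  set p := 2 * 2 ^ k with hp
  have hp1 : 1 ≤ p := by have := Nat.one_le_two_pow (n := k); omega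
  set Z : (ι → ℤˣ) → ℝ := fun σ => (A M).sup' hF fun y => |‖B y (signVec σ)‖ ^ 2 - 1| with hZ
  have hZ0 : ∀ σ, 0 ≤ Z σ := fun σ =>
    let ⟨y, hy⟩ := hF
    (abs_nonneg _).trans (Finset.le_sup' (fun y => |‖B y (signVec σ)‖ ^ 2 - 1|) hy)
  set X := 𝔼 σ, Z σ ^ p with hX
  set Y := 𝔼 σ : ι → ℤˣ, supNorm B hF (signVec σ) ^ p with hY
  have hX0 : 0 ≤ X := Finset.expect_nonneg fun σ _ => pow_nonneg (hZ0 σ) p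
  have hY0 : 0 ≤ Y := Finset.expect_nonneg fun σ _ => pow_nonneg (supNorm_nonneg _ _ _) p
  have hNZ : ∀ σ : ι → ℤˣ, supNorm B hF (signVec σ) ^ 2 ≤ 1 + Z σ := fun σ => by
    obtain ⟨y, hy, hye⟩ := Finset.exists_mem_eq_sup' hF fun y => ‖B y (signVec σ)‖
    have h1 : supNorm B hF (signVec σ) = ‖B y (signVec σ)‖ := hye
    have h2 := Finset.le_sup' (fun y => |‖B y (signVec σ)‖ ^ 2 - 1|) hy
    have h3 := le_abs_self (‖B y (signVec σ)‖ ^ 2 - 1)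
    rw [h1]
    simp only [hZ]
    linarith
  -- The squared norms exceed one by at most Z, so the bound X ≤ 2αY feeds back into itself and
  -- becomes X² ≤ β(1 + X).
  have hY2 : Y ^ 2 ≤ 2 ^ (p - 1) * (1 + X) := by
    calc Y ^ 2 ≤ 𝔼 σ : ι → ℤˣ, (supNorm B hF (signVec σ) ^ p) ^ 2 :=
          expect_pow_le (fun σ => pow_nonneg (supNorm_nonneg _ _ _) p) 2
      _ ≤ 𝔼 σ, 2 ^ (p - 1) * (1 + Z σ ^ p) := by
          refine Finset.expect_le_expect fun σ _ => ?_
          rw [← pow_mul, mul_comm, pow_mul]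
          refine (pow_le_pow_left₀ (sq_nonneg _) (hNZ σ) p).trans ?_
          simpa using add_pow_le zero_le_one (hZ0 σ) p
      _ = _ := by
          rw [← Finset.mul_expect, Finset.expect_add_distrib, Fintype.expect_const]
  have h2p : (2 : ℝ) ^ p = 2 ^ (p - 1) * 2 := by rw [← pow_succ, Nat.sub_add_cancel hp1]
  set α := (320 * Γ) ^ p with hα
  have hα0 : 0 ≤ α := by positivity
  have hX2 : X ^ 2 ≤ 2 * (2 ^ p * α ^ 2) * (1 + X) := by
    calc X ^ 2 ≤ (2 * α * Y) ^ 2 := pow_le_pow_left₀ hX0 hmain 2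
      _ = 4 * α ^ 2 * Y ^ 2 := by ring
      _ ≤ 4 * α ^ 2 * (2 ^ (p - 1) * (1 + X)) := by gcongr
      _ = _ := by rw [h2p]; ring
  set β := 2 * (2 ^ p * α ^ 2) with hβ
  -- The numerical factor 4 is absorbed into 4^p, and 8 · 320² ≤ 960². Hence β ≤ 1/2, which excludes
  -- X > 1, and then X² ≤ 2β.
  have hβ2 : 2 * β ≤ ((960 * Γ) ^ p) ^ 2 := by
    have h4 : (4 : ℝ) ≤ 4 ^ p := by
      calc (4 : ℝ) = 4 ^ 1 := by norm_num
        _ ≤ _ := pow_le_pow_right₀ (by norm_num) hp1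
    calc 2 * β = 4 * (2 ^ p * α ^ 2) := by rw [hβ]; ring
      _ ≤ 4 ^ p * (2 ^ p * α ^ 2) := by gcongr
      _ = (8 * (320 * Γ) ^ 2) ^ p := by
          rw [hα, ← pow_mul, mul_comm p 2, pow_mul _ 2 p, ← mul_assoc, ← mul_pow, ← mul_pow]; norm_num
      _ ≤ ((960 * Γ) ^ 2) ^ p := by
          gcongr
          nlinarith [sq_nonneg Γ]
      _ = _ := by rw [← pow_mul, ← pow_mul, mul_comm 2 p]
  have hone : ((960 * Γ) ^ p) ^ 2 ≤ 1 :=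
    pow_le_one₀ (by positivity) (pow_le_one₀ (by positivity) hΓ1)
  have hX1 : X ≤ 1 := by
    by_contra hcon
    push Not at hcon
    nlinarith
  have hβ0 : 0 ≤ β := by positivity
  have : X ^ 2 ≤ ((960 * Γ) ^ p) ^ 2 := by nlinarith
  exact le_of_sq_le_sq this (by positivity)

end ChaosChaining

/-! ### Tail of the chaos supremum in terms of γ₂. -/

section ChaosTail

open scoped InnerProductSpace BigOperators

variable {ι : Type*} [Fintype ι] [DecidableEq ι]
  {W : Type*} [NormedAddCommGroup W] [InnerProductSpace ℝ W]
  {V : Type*} [AddCommGroup V] [Module ℝ V]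
  {B : V →ₗ[ℝ] (ι → ℝ) →ₗ[ℝ] W} {ρ : V → ℝ}

/-- Pairing the image with itself and applying Cauchy–Schwarz loses the number of signs. The loss is
harmless: the bound serves only to pass from a sufficiently fine finite net to all of `T`. -/
lemma norm_map_signVec_le
    (hB : ∀ x z, ∑ a, ⟪B x (Pi.single a 1), z⟫_ℝ ^ 2 ≤ ρ x ^ 2 * ‖z‖ ^ 2) (hρ : ∀ x, 0 ≤ ρ x)
    (x : V) (σ : ι → ℤˣ) : ‖B x (signVec σ)‖ ≤ √(Fintype.card ι) * ρ x := by
  set z := B x (signVec σ) with hz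
  have h1 : ‖z‖ ^ 2 = ∑ a, signVec σ a * ⟪B x (Pi.single a 1), z⟫_ℝ := by
    rw [← real_inner_self_eq_norm_sq]
    nth_rewrite 1 [hz]
    exact inner_map_eq_sum_single _ _ _
  have h2 : (‖z‖ ^ 2) ^ 2 ≤ Fintype.card ι * (ρ x ^ 2 * ‖z‖ ^ 2) := by
    rw [h1]
    refine (Finset.sum_mul_sq_le_sq_mul_sq _ _ _).trans ?_
    rw [← h1]
    refine mul_le_mul (le_of_eq ?_) (hB x z) (Finset.sum_nonneg fun _ _ => sq_nonneg _) (by positivity)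
    have : ∀ a, signVec σ a ^ 2 = 1 := fun a => by
      rcases signVec_eq σ a with h | h <;> rw [h] <;> norm_num
    simp [this]
  rcases (norm_nonneg z).eq_or_lt with h0 | hpos
  · rw [← h0]; exact mul_nonneg (Real.sqrt_nonneg _) (hρ x)
  · refine le_of_sq_le_sq ?_ (mul_nonneg (Real.sqrt_nonneg _) (hρ x))
    rw [mul_pow, Real.sq_sqrt (by positivity)]
    refine le_of_mul_le_mul_right ?_ (pow_pos hpos 2)
    calc _ = (‖z‖ ^ 2) ^ 2 := by ring
      _ ≤ _ := h2
      _ = _ := by ring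

/-- Strictness selects an almost optimal admissible sequence. Its levels are finite, so the
distances to them are attained, at the points `π r`. -/
lemma exists_admissible_finset {X : Type*} {S : Set X} {d : X → X → ℝ} {γ : ℝ}
    (hγ : gammaTwo S (fun x y => ENNReal.ofReal (d x y)) < ENNReal.ofReal γ) (hd : ∀ x y, 0 ≤ d x y) :
    ∃ A : ℕ → Finset X, Monotone A ∧ (∀ r, (A r).card ≤ 2 ^ 2 ^ r) ∧ (∀ r, ↑(A r) ⊆ S) ∧
      (∀ r, (A r).Nonempty) ∧ ∀ x ∈ S, ∃ π : ℕ → X, (∀ r, π r ∈ A r) ∧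
        ∀ M, ∑ r ∈ Finset.range M, √2 ^ r * d x (π r) ≤ γ := by
  rw [gammaTwo] at hγ
  simp only [iInf_lt_iff] at hγ
  obtain ⟨A, hA, hlt⟩ := hγ
  have hfin : ∀ r, (A r).Finite := fun r => Set.finite_of_encard_le_coe (hA.card_le r)
  have hcard0 : (A 0).Nonempty := by
    rw [← Set.encard_ne_zero, hA.card_zero]; exact one_ne_zero
  have hne : ∀ r, (hfin r).toFinset.Nonempty := fun r => by
    rw [Set.Finite.toFinset_nonempty]
    exact hcard0.mono (hA.mono (Nat.zero_le r))
  refine ⟨fun r => (hfin r).toFinset, ?_, ?_, ?_, hne, ?_⟩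
  · intro r t hrt
    exact Set.Finite.toFinset_subset_toFinset.2 (hA.mono hrt)
  · intro r
    have := hA.card_le r
    rw [(hfin r).encard_eq_coe_toFinset_card] at this
    exact_mod_cast this
  · intro r; simpa using hA.subset r
  · intro x hx
    choose π hπ hmin using fun r => Finset.exists_min_image _ (fun y => d x y) (hne r)
    refine ⟨π, hπ, fun M => ?_⟩
    have h1 : ∑' r : ℕ, (2 : ℝ≥0∞) ^ ((r : ℝ) / 2) * ⨅ y ∈ A r, ENNReal.ofReal (d x y) <
        ENNReal.ofReal γ :=
      lt_of_le_of_lt (le_iSup₂ (f := fun x (_ : x ∈ S) => ∑' r : ℕ, (2 : ℝ≥0∞) ^ ((r : ℝ) / 2) *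
        ⨅ y ∈ A r, ENNReal.ofReal (d x y)) x hx) hlt
    have h2 : ENNReal.ofReal (∑ r ∈ Finset.range M, √2 ^ r * d x (π r)) ≤ ENNReal.ofReal γ := by
      rw [ENNReal.ofReal_sum_of_nonneg fun r _ => mul_nonneg (by positivity) (hd _ _)]
      refine le_trans (Finset.sum_le_sum fun r _ => ?_) ((ENNReal.sum_le_tsum _).trans h1.le)
      rw [ennreal_two_rpow_half, ENNReal.ofReal_mul (by positivity)]
      refine mul_le_mul_right (le_iInf₂ fun y hy => ENNReal.ofReal_le_ofReal ?_) _
      exact hmin r y ((hfin r).mem_toFinset.2 hy)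
    rw [ENNReal.ofReal_le_ofReal_iff'] at h2
    rcases h2 with h2 | h2
    · exact h2
    · have : 0 < γ := by
        by_contra hcon
        rw [ENNReal.ofReal_of_nonpos (not_lt.1 hcon)] at h1
        exact absurd h1 not_lt_zero
      exact h2.trans this.le

/-- Tail bound for the supremum of a Rademacher chaos of order two in terms of `γ₂`. -/
theorem expect_chaos_tail_le
    (hB : ∀ x z, ∑ a, ⟪B x (Pi.single a 1), z⟫_ℝ ^ 2 ≤ ρ x ^ 2 * ‖z‖ ^ 2) (hρ : ∀ x, 0 ≤ ρ x)
    (hρ0 : ρ 0 = 0) (hρs : ∀ x y, ρ (x - y) ≤ ρ x + ρ y)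
    {T : Set V} (hB1 : ∀ y ∈ T, ∑ a, ‖B y (Pi.single a 1)‖ ^ 2 = 1) {Δ γ ε : ℝ} {k : ℕ}
    (hΔ : ∀ y ∈ T, ρ y ≤ Δ) (hΔ0 : 0 ≤ Δ) (hγ0 : 0 ≤ γ)
    (hγ : gammaTwo T (fun x y => ENNReal.ofReal (ρ (x - y))) < ENNReal.ofReal γ) (hε : 0 < ε)
    (hε1 : ε ≤ 1) (hΓ : 960 * (√2 ^ k * Δ + 2 * γ) ≤ ε / 6) :
    𝔼 σ : ι → ℤˣ, Set.indicator {σ | ∃ x ∈ T, ε ≤ |‖B x (signVec σ)‖ ^ 2 - 1|} (fun _ => (1 : ℝ)) σ ≤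
      Real.exp (-(2 * 2 ^ k)) := by
  classical
  obtain ⟨A, hAm, hAc, hAT, hAne, hAπ⟩ := exists_admissible_finset hγ fun x y => hρ _
  set Γ := √2 ^ k * Δ + 2 * γ with hΓdef
  have hΓ0 : 0 ≤ Γ := by positivity
  have hs1 : (1 : ℝ) ≤ √2 := Real.one_le_sqrt.2 (by norm_num)
  set L := (Fintype.card ι : ℝ) with hL
  have hL0 : 0 ≤ L := Nat.cast_nonneg _
  -- At level `M` the crude norm bound makes the passage from the net to an arbitrary point cost at
  -- most ε/2.
  obtain ⟨M, hkM, hM⟩ : ∃ M, k < M ∧ 2 * L * Δ * γ ≤ ε / 2 * √2 ^ M := by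
    have h1 : Filter.Tendsto (fun M : ℕ => ε / 2 * √2 ^ M) Filter.atTop Filter.atTop :=
      (tendsto_pow_atTop_atTop_of_one_lt (Real.lt_sqrt_of_sq_lt (by norm_num))).const_mul_atTop
        (by positivity)
    obtain ⟨M, hM1, hM2⟩ := ((h1.eventually_ge_atTop (2 * L * Δ * γ)).and
      (Filter.eventually_gt_atTop k)).exists
    exact ⟨M, hM2, hM1⟩
  have hchain : ∀ y ∈ A M, ∃ π : ℕ → V, (∀ r, π r ∈ A r) ∧ π M = y ∧
      √2 ^ k * ρ (π k) + ∑ r ∈ Finset.Ico k M, √2 ^ r * ρ (π (r + 1) - π r) ≤ Γ := by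
    intro y hy
    obtain ⟨π, hπ, hsum⟩ := hAπ y (hAT M hy)
    -- A chain must end at `y` exactly, so from level `M` on the nearest point is replaced by `y`;
    -- this only decreases the distances.
    let π' : ℕ → V := fun r => if r < M then π r else y
    have hπ' : ∀ r, π' r ∈ A r := fun r => by
      by_cases h : r < M
      · simpa [π', h] using hπ r
      · simpa [π', h] using hAm (not_lt.1 h) hy
    have he : ∀ r, ρ (y - π' r) ≤ ρ (y - π r) := fun r => by
      by_cases h : r < M
      · simp [π', h]
      · simpa [π', h, hρ0] using hρ _
    refine ⟨π', hπ', by simp [π'], add_le_add ?_ ?_⟩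
    · exact mul_le_mul_of_nonneg_left (hΔ _ (hAT k (hπ' k))) (by positivity)
    · have hstep : ∀ r, √2 ^ r * ρ (π' (r + 1) - π' r) ≤
          √2 ^ (r + 1) * ρ (y - π (r + 1)) + √2 ^ r * ρ (y - π r) := fun r => by
        have h1 : ρ (π' (r + 1) - π' r) ≤ ρ (y - π' r) + ρ (y - π' (r + 1)) := by
          have := hρs (y - π' r) (y - π' (r + 1))
          rwa [sub_sub_sub_cancel_left] at this
        have h2 : √2 ^ r * ρ (y - π (r + 1)) ≤ √2 ^ (r + 1) * ρ (y - π (r + 1)) :=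
          mul_le_mul_of_nonneg_right (pow_le_pow_right₀ hs1 (Nat.le_succ r)) (hρ _)
        calc _ ≤ √2 ^ r * (ρ (y - π r) + ρ (y - π (r + 1))) := by
              have := he r
              have := he (r + 1)
              gcongr
              linarith
          _ ≤ _ := by linarith
      have hnn : ∀ r, 0 ≤ √2 ^ r * ρ (y - π r) := fun r => mul_nonneg (by positivity) (hρ _)
      calc _ ≤ ∑ r ∈ Finset.range M, (√2 ^ (r + 1) * ρ (y - π (r + 1)) + √2 ^ r * ρ (y - π r)) :=
            (Finset.sum_le_sum fun r _ => hstep r).trans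
              (Finset.sum_le_sum_of_subset_of_nonneg
                (fun r hr => Finset.mem_range.2 (Finset.mem_Ico.1 hr).2)
                fun r _ _ => add_nonneg (hnn _) (hnn _))
        _ ≤ γ + γ := by
            rw [Finset.sum_add_distrib]
            refine add_le_add ?_ (hsum M)
            refine le_trans ?_ (hsum (M + 1))
            rw [Finset.sum_range_succ']
            exact le_add_of_nonneg_right (hnn 0)
        _ = 2 * γ := by ring
  have hmom := expect_chaos_pow_le hB hρ hAm hAc hkM (hAne M) (fun y hy => hB1 y (hAT M hy)) hΓ0
    (by linarith) hchain
  set p := 2 * 2 ^ k with hp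
  set Z : (ι → ℤˣ) → ℝ := fun σ => (A M).sup' (hAne M) fun y => |‖B y (signVec σ)‖ ^ 2 - 1| with hZ
  have hZ0 : ∀ σ, 0 ≤ Z σ := fun σ =>
    let ⟨y, hy⟩ := hAne M
    (abs_nonneg _).trans (Finset.le_sup' (fun y => |‖B y (signVec σ)‖ ^ 2 - 1|) hy)
  have hbad : ∀ σ, (∃ x ∈ T, ε ≤ |‖B x (signVec σ)‖ ^ 2 - 1|) → ε / 2 ≤ Z σ := by
    rintro σ ⟨x, hx, hxe⟩
    obtain ⟨π, hπ, hsum⟩ := hAπ x hx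
    have h1 : √2 ^ M * ρ (x - π M) ≤ γ :=
      (Finset.single_le_sum (f := fun r => √2 ^ r * ρ (x - π r))
        (fun r _ => mul_nonneg (by positivity) (hρ _)) (Finset.self_mem_range_succ M)).trans
        (hsum (M + 1))
    have h2 := Finset.le_sup' (fun y => |‖B y (signVec σ)‖ ^ 2 - 1|) (hπ M)
    have hb1 := norm_map_signVec_le hB hρ x σ
    have hb2 := norm_map_signVec_le hB hρ (π M) σ
    have hb3 := norm_map_signVec_le hB hρ (x - π M) σ
    rw [map_sub, LinearMap.sub_apply] at hb3
    have hx1 := hΔ x hx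
    have hx2 := hΔ _ (hAT M (hπ M))
    set b1 := ‖B x (signVec σ)‖
    set b2 := ‖B (π M) (signVec σ)‖
    have h3 : |b1 - b2| ≤ √L * ρ (x - π M) := (abs_norm_sub_norm_le _ _).trans hb3
    have hLs : √L * √L = L := Real.mul_self_sqrt hL0
    have h4 : |b1 ^ 2 - b2 ^ 2| ≤ 2 * L * Δ * ρ (x - π M) := by
      have hb1' : b1 ≤ √L * Δ := hb1.trans (mul_le_mul_of_nonneg_left hx1 (Real.sqrt_nonneg _))
      have hb2' : b2 ≤ √L * Δ := hb2.trans (mul_le_mul_of_nonneg_left hx2 (Real.sqrt_nonneg _))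
      have e : b1 ^ 2 - b2 ^ 2 = (b1 + b2) * (b1 - b2) := by ring
      rw [e, abs_mul, abs_of_nonneg (add_nonneg (norm_nonneg _) (norm_nonneg _))]
      calc (b1 + b2) * |b1 - b2| ≤ (2 * (√L * Δ)) * (√L * ρ (x - π M)) := by
            refine mul_le_mul (by linarith) h3 (abs_nonneg _) (by positivity)
        _ = 2 * (√L * √L) * Δ * ρ (x - π M) := by ring
        _ = _ := by rw [hLs]
    have h5 : 2 * L * Δ * ρ (x - π M) ≤ ε / 2 := by
      have hsM : 0 < √2 ^ M := by positivity
      refine le_of_mul_le_mul_right ?_ hsM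
      calc 2 * L * Δ * ρ (x - π M) * √2 ^ M = 2 * L * Δ * (√2 ^ M * ρ (x - π M)) := by ring
        _ ≤ 2 * L * Δ * γ := by gcongr
        _ ≤ _ := hM
    have h6 : |b1 ^ 2 - 1| ≤ |b1 ^ 2 - b2 ^ 2| + |b2 ^ 2 - 1| := by
      have := abs_add_le (b1 ^ 2 - b2 ^ 2) (b2 ^ 2 - 1)
      rwa [sub_add_sub_cancel] at this
    simp only [hZ]
    linarith
  have hp0 : p ≠ 0 := by positivity
  have hind : ∀ σ : ι → ℤˣ, Set.indicator {σ | ∃ x ∈ T, ε ≤ |‖B x (signVec σ)‖ ^ 2 - 1|}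
      (fun _ => (1 : ℝ)) σ ≤ (2 / ε) ^ p * Z σ ^ p := by
    intro σ
    by_cases h : ∃ x ∈ T, ε ≤ |‖B x (signVec σ)‖ ^ 2 - 1|
    · rw [Set.indicator_of_mem (by exact h), ← mul_pow]
      refine one_le_pow₀ ?_
      have := hbad σ h
      rw [div_mul_eq_mul_div, le_div_iff₀ hε]
      linarith
    · rw [Set.indicator_of_notMem (by exact h)]
      have := hZ0 σ
      positivity
  calc _ ≤ 𝔼 σ, (2 / ε) ^ p * Z σ ^ p := Finset.expect_le_expect fun σ _ => hind σ
    _ ≤ (2 / ε) ^ p * (960 * Γ) ^ p := by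
        rw [← Finset.mul_expect]; gcongr
    -- By `hΓ`, (2/ε) · 960Γ ≤ 1/3 < e^{-1}; hence the requirement ε/6.
    _ ≤ Real.exp (-1) ^ p := by
        rw [← mul_pow]
        refine pow_le_pow_left₀ (by positivity) ?_ p
        have he : 1 / 3 ≤ Real.exp (-1) := by
          rw [Real.exp_neg, one_div]
          exact inv_anti₀ (Real.exp_pos _) (by linarith [Real.exp_one_lt_d9])
        refine le_trans ?_ he
        rw [div_mul_eq_mul_div, div_le_iff₀ hε]
        linarith
    _ = _ := by
        rw [← Real.exp_nat_mul, hp]; push_cast; congr 1; ring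

end ChaosTail

/-! ### The deterministic geometry of a sparse pattern. -/

section SparsePattern

open scoped InnerProductSpace

variable {m n : ℕ}

/-- The projections of the coordinate vectors onto a subspace. -/
noncomputable def leverageVec (E : Submodule ℝ (EuclideanSpace ℝ (Fin n))) (j : Fin n) : E :=
  E.orthogonalProjectionOnto (EuclideanSpace.single j (1 : ℝ))

variable (E : Submodule ℝ (EuclideanSpace ℝ (Fin n)))

lemma inner_leverageVec (j : Fin n) (x : E) : ⟪leverageVec E j, x⟫_ℝ = x.1 j := by
  rw [leverageVec, Submodule.inner_orthogonalProjectionOnto_eq_of_mem_right]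
  simp [EuclideanSpace.inner_single_left]

/-- Projecting an orthonormal basis gives a Parseval frame; this is the tightness used in the trace
moments of the energies. -/
lemma sum_inner_leverageVec_smul (x : E) :
    ∑ j, ⟪leverageVec E j, x⟫_ℝ • leverageVec E j = (1 : ℝ) • x := by
  simp only [inner_leverageVec]
  have h : x = E.orthogonalProjectionOnto x.1 :=
    (Submodule.orthogonalProjectionOnto_mem_subspace_eq_self x).symm
  have hx : x.1 = ∑ j, x.1 j • EuclideanSpace.single j (1 : ℝ) := by
    ext i
    simp [Finset.sum_apply, Pi.single_apply]
  conv_rhs => rw [one_smul, h, hx]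
  simp only [map_sum, map_smul, leverageVec]

lemma norm_leverageVec_le (j : Fin n) : ‖leverageVec E j‖ ≤ incoherence E :=
  le_ciSup (f := fun j : Fin n => ‖E.starProjection (EuclideanSpace.single j (1 : ℝ))‖)
    (Set.finite_range _).bddAbove j

lemma sum_norm_leverageVec_sq : ∑ j, ‖leverageVec E j‖ ^ 2 = Module.finrank ℝ E := by
  have h := sum_inner_of_tight (sum_inner_leverageVec_smul E) 1
  simpa [real_inner_self_eq_norm_sq] using h

/-- The mass of the leverage vectors selected by a row. -/
noncomputable def rowMass (D : Fin n → ℝ) : ℝ := ∑ j, D j * ‖leverageVec E j‖ ^ 2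

variable {D : Fin m → Fin n → ℝ}

lemma deltaNorm_nonneg (s : ℕ) (x : EuclideanSpace ℝ (Fin n)) : 0 ≤ deltaNorm s D x :=
  mul_nonneg (by positivity) (Real.iSup_nonneg fun _ => Real.sqrt_nonneg _)

lemma deltaNorm_le {s : ℕ} (hs : 1 ≤ s) {x : EuclideanSpace ℝ (Fin n)} {u : ℝ} (hu : 0 ≤ u)
    (h : ∀ i, (1 / s : ℝ) * ∑ j, D i j * x j ^ 2 ≤ u ^ 2) : deltaNorm s D x ≤ u := by
  have hs0 : (0 : ℝ) < s := by exact_mod_cast hs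
  have hss : 0 < √(s : ℝ) := Real.sqrt_pos.2 hs0
  rw [deltaNorm, one_div, inv_mul_le_iff₀ hss]
  refine Real.iSup_le (fun i => ?_) (by positivity)
  rw [Real.sqrt_le_left (by positivity), mul_pow, Real.sq_sqrt hs0.le]
  have := h i
  rwa [one_div, inv_mul_le_iff₀ hs0] at this

lemma le_deltaNorm_sq {s : ℕ} (hD : ∀ i j, 0 ≤ D i j) (x : EuclideanSpace ℝ (Fin n)) (i : Fin m) :
    (1 / s : ℝ) * ∑ j, D i j * x j ^ 2 ≤ deltaNorm s D x ^ 2 := by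
  have h0 : 0 ≤ ∑ j, D i j * x j ^ 2 :=
    Finset.sum_nonneg fun j _ => mul_nonneg (hD i j) (sq_nonneg _)
  have h1 : √(∑ j, D i j * x j ^ 2) ≤ ⨆ i : Fin m, √(∑ j, D i j * x j ^ 2) :=
    le_ciSup (f := fun i : Fin m => √(∑ j, D i j * x j ^ 2)) (Set.finite_range _).bddAbove i
  rw [deltaNorm, mul_pow, div_pow, Real.sq_sqrt (Nat.cast_nonneg s), one_pow]
  refine mul_le_mul_of_nonneg_left ?_ (by positivity)
  calc ∑ j, D i j * x j ^ 2 = √(∑ j, D i j * x j ^ 2) ^ 2 := (Real.sq_sqrt h0).symm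
    _ ≤ _ := by gcongr

lemma deltaNorm_zero (s : ℕ) : deltaNorm s D 0 = 0 := by simp [deltaNorm]

lemma deltaNorm_sub_le {s : ℕ} (hs : 1 ≤ s) (hD : ∀ i j, D i j = 0 ∨ D i j = 1)
    (x y : EuclideanSpace ℝ (Fin n)) : deltaNorm s D (x - y) ≤ deltaNorm s D x + deltaNorm s D y := by
  have hD0 : ∀ i j, 0 ≤ D i j := fun i j => by rcases hD i j with h | h <;> simp [h]
  have hs0 : (0 : ℝ) < s := by exact_mod_cast hs
  have hrow : ∀ i (z : EuclideanSpace ℝ (Fin n)), (1 / s : ℝ) * ∑ j, D i j * z j ^ 2 =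
      ‖(WithLp.toLp 2 fun j => 1 / √(s : ℝ) * (D i j * z j) : EuclideanSpace ℝ (Fin n))‖ ^ 2 := by
    intro i z
    rw [EuclideanSpace.norm_sq_eq, Finset.mul_sum]
    refine Finset.sum_congr rfl fun j _ => ?_
    rw [Real.norm_eq_abs, sq_abs, mul_pow, div_pow, Real.sq_sqrt hs0.le]
    rcases hD i j with h | h <;> simp [h]
  have hle : ∀ i (z : EuclideanSpace ℝ (Fin n)),
      ‖(WithLp.toLp 2 fun j => 1 / √(s : ℝ) * (D i j * z j) : EuclideanSpace ℝ (Fin n))‖ ≤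
        deltaNorm s D z := fun i z => by
    refine le_of_sq_le_sq ?_ (deltaNorm_nonneg s z)
    rw [← hrow]
    exact le_deltaNorm_sq hD0 z i
  refine deltaNorm_le hs (add_nonneg (deltaNorm_nonneg s x) (deltaNorm_nonneg s y)) fun i => ?_
  rw [hrow]
  refine pow_le_pow_left₀ (norm_nonneg _) ?_ 2
  have e : (WithLp.toLp 2 fun j => 1 / √(s : ℝ) * (D i j * (x - y) j) : EuclideanSpace ℝ (Fin n)) =
      (WithLp.toLp 2 fun j => 1 / √(s : ℝ) * (D i j * x j)) -
        (WithLp.toLp 2 fun j => 1 / √(s : ℝ) * (D i j * y j)) := by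
    ext j; simp; ring
  rw [e]
  exact (norm_sub_le _ _).trans (add_le_add (hle i x) (hle i y))

/-- The sparse transform as a bilinear map in the vector and the signs. -/
noncomputable def sjltBilin (s : ℕ) (D : Fin m → Fin n → ℝ) :
    EuclideanSpace ℝ (Fin n) →ₗ[ℝ] (Fin m × Fin n → ℝ) →ₗ[ℝ] EuclideanSpace ℝ (Fin m) :=
  LinearMap.mk₂ ℝ (fun x u => WithLp.toLp 2 fun i => ∑ j, 1 / √(s : ℝ) * u (i, j) * D i j * x j)
    (fun x y u => by
      ext i; simp only [PiLp.add_apply, ← Finset.sum_add_distrib]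
      exact Finset.sum_congr rfl fun j _ => by ring)
    (fun c x u => by
      ext i; simp only [PiLp.smul_apply, smul_eq_mul, Finset.mul_sum]
      exact Finset.sum_congr rfl fun j _ => by ring)
    (fun x u w => by
      ext i; simp only [PiLp.add_apply, Pi.add_apply, ← Finset.sum_add_distrib]
      exact Finset.sum_congr rfl fun j _ => by ring)
    (fun c x u => by
      ext i; simp only [PiLp.smul_apply, Pi.smul_apply, smul_eq_mul, Finset.mul_sum]
      exact Finset.sum_congr rfl fun j _ => by ring)

lemma sjltBilin_apply (s : ℕ) (D : Fin m → Fin n → ℝ) (x : EuclideanSpace ℝ (Fin n))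
    (u : Fin m × Fin n → ℝ) (i : Fin m) :
    sjltBilin s D x u i = ∑ j, 1 / √(s : ℝ) * u (i, j) * D i j * x j := rfl

lemma toLp_sjltMatrix_mulVec (s : ℕ) (D S : Fin m → Fin n → ℝ) (x : EuclideanSpace ℝ (Fin n)) :
    WithLp.toLp 2 ((sjltMatrix s D S).mulVec x.ofLp) = sjltBilin s D x fun q => S q.1 q.2 := rfl

lemma sjltBilin_single (s : ℕ) (D : Fin m → Fin n → ℝ) (x : EuclideanSpace ℝ (Fin n))
    (a : Fin m × Fin n) :
    sjltBilin s D x (Pi.single a 1) =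
      EuclideanSpace.single a.1 (1 / √(s : ℝ) * D a.1 a.2 * x a.2) := by
  ext i
  rw [sjltBilin_apply, PiLp.single_apply]
  obtain ⟨a1, a2⟩ := a
  by_cases h : i = a1
  · subst h
    rw [Finset.sum_eq_single a2]
    · simp
    · intro j _ hj
      simp [hj]
    · simp
  · simp [h]

/-- This is where ‖·‖_δ enters: the sign at (i, j) acts in direction e_i, so row i contributes z_i²
times its own quadratic form, and the maximum over rows bounds the variance. -/
lemma sum_inner_sjltBilin_single_sq_le {s : ℕ} (hD : ∀ i j, D i j = 0 ∨ D i j = 1)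
    (x : EuclideanSpace ℝ (Fin n)) (z : EuclideanSpace ℝ (Fin m)) :
    ∑ a, ⟪sjltBilin s D x (Pi.single a 1), z⟫_ℝ ^ 2 ≤ deltaNorm s D x ^ 2 * ‖z‖ ^ 2 := by
  have hD0 : ∀ i j, 0 ≤ D i j := fun i j => by rcases hD i j with h | h <;> simp [h]
  rw [Fintype.sum_prod_type, EuclideanSpace.norm_sq_eq, Finset.mul_sum]
  refine Finset.sum_le_sum fun i _ => ?_
  have h : ∀ j, ⟪sjltBilin s D x (Pi.single (i, j) 1), z⟫_ℝ ^ 2 =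
      (1 / s : ℝ) * (D i j * x j ^ 2) * ‖z i‖ ^ 2 := fun j => by
    rw [sjltBilin_single, EuclideanSpace.inner_single_left, Real.norm_eq_abs, sq_abs,
      RCLike.conj_to_real, mul_pow, mul_pow, mul_pow, div_pow, Real.sq_sqrt (Nat.cast_nonneg s)]
    rcases hD i j with h | h <;> simp [h]
  simp only [h]
  rw [← Finset.sum_mul, ← Finset.mul_sum]
  exact mul_le_mul_of_nonneg_right (le_deltaNorm_sq hD0 x i) (sq_nonneg _)

/-- The exact column sums make ‖Φx‖² have mean ‖x‖² over the signs for each fixed pattern, so there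
is no diagonal error term. -/
lemma sum_norm_sjltBilin_single_sq {s : ℕ} (hs : 1 ≤ s) (hD : ∀ i j, D i j = 0 ∨ D i j = 1)
    (hcol : ∀ j, ∑ i, D i j = s) (x : EuclideanSpace ℝ (Fin n)) :
    ∑ a, ‖sjltBilin s D x (Pi.single a 1)‖ ^ 2 = ‖x‖ ^ 2 := by
  have hs0 : (s : ℝ) ≠ 0 := by positivity
  rw [Fintype.sum_prod_type, Finset.sum_comm, EuclideanSpace.norm_sq_eq]
  refine Finset.sum_congr rfl fun j _ => ?_
  have h : ∀ i, ‖sjltBilin s D x (Pi.single (i, j) 1)‖ ^ 2 =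
      D i j * ((1 / s : ℝ) * x j ^ 2) := fun i => by
    rw [sjltBilin_single, PiLp.norm_single, Real.norm_eq_abs, sq_abs,
      mul_pow, mul_pow, div_pow, Real.sq_sqrt (Nat.cast_nonneg s)]
    rcases hD i j with h | h <;> simp [h]
  simp only [h]
  rw [← Finset.sum_mul, hcol, Real.norm_eq_abs, sq_abs]
  field_simp

/-- The quadratic form `x ↦ s⁻¹ ∑ⱼ Dⱼ xⱼ²` on a subspace, as an operator. -/
noncomputable def rowOperator (s : ℕ) (D : Fin n → ℝ) : E →ₗ[ℝ] E :=
  (1 / s : ℝ) • weightedFrame (leverageVec E) D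

lemma inner_rowOperator (s : ℕ) (D : Fin n → ℝ) (x : E) :
    ⟪x, rowOperator E s D x⟫_ℝ = (1 / s : ℝ) * ∑ j, D j * x.1 j ^ 2 := by
  simp only [rowOperator, weightedFrame, LinearMap.smul_apply, LinearMap.sum_apply, inner_smul_right,
    inner_sum, rankOneSq_apply, real_inner_comm x]
  congr 1
  exact Finset.sum_congr rfl fun j _ => by rw [← real_inner_comm, inner_leverageVec]; ring

lemma trace_rowOperator (s : ℕ) (D : Fin n → ℝ) :
    LinearMap.trace ℝ E (rowOperator E s D) = (1 / s : ℝ) * rowMass E D := by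
  have h := trace_weightedFrame_pow_succ (leverageVec E) D 0
  simp only [zero_add, pow_one, pow_zero, Module.End.one_apply, real_inner_self_eq_norm_sq] at h
  rw [rowOperator, map_smul, h, smul_eq_mul, rowMass]

lemma rowOperator_isPositive (s : ℕ) {D : Fin n → ℝ} (hD : ∀ j, 0 ≤ D j) :
    (rowOperator E s D).IsPositive :=
  (weightedFrame_isPositive _ hD).smul_of_nonneg (by positivity)

lemma sum_mul_sq_le_rowMass {D : Fin n → ℝ} (hD : ∀ j, 0 ≤ D j) (x : E) :
    ∑ j, D j * x.1 j ^ 2 ≤ rowMass E D * ‖x‖ ^ 2 := by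
  rw [rowMass, Finset.sum_mul]
  refine Finset.sum_le_sum fun j _ => ?_
  rw [mul_assoc]
  refine mul_le_mul_of_nonneg_left ?_ (hD j)
  rw [← inner_leverageVec, ← mul_pow, ← sq_abs]
  exact pow_le_pow_left₀ (abs_nonneg _) (abs_real_inner_le_norm _ _) 2

lemma sum_mul_sq_le_norm_sq {D : Fin n → ℝ} (hD : ∀ j, D j = 0 ∨ D j = 1)
    (x : EuclideanSpace ℝ (Fin n)) : ∑ j, D j * x j ^ 2 ≤ ‖x‖ ^ 2 := by
  rw [EuclideanSpace.norm_sq_eq]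
  refine Finset.sum_le_sum fun j _ => ?_
  rw [Real.norm_eq_abs, sq_abs]
  rcases hD j with h | h <;> simp [h, sq_nonneg]

lemma unitSphereOf_eq_image : unitSphereOf E = (Subtype.val : E → _) '' Metric.sphere (0 : E) 1 := by
  ext x
  simp only [unitSphereOf, Set.mem_ofPred_eq, Set.mem_image, mem_sphere_zero_iff_norm]
  constructor
  · rintro ⟨hx, h⟩; exact ⟨⟨x, hx⟩, h, rfl⟩
  · rintro ⟨y, hy, rfl⟩; exact ⟨y.2, hy⟩

/-- Pointwise bound for `γ₂` of the unit sphere in terms of row statistics of the pattern. -/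
theorem gammaTwo_unitSphereOf_le {s : ℕ} (hs : 1 ≤ s) (hm : 1 ≤ m)
    (hD : ∀ i j, D i j = 0 ∨ D i j = 1) {α β : ℝ} (hα : ∀ i, rowMass E (D i) ≤ α)
    (hβ : ∀ i, ∀ x : E, ‖x‖ = 1 → ∑ j, D i j * x.1 j ^ 2 ≤ β) (hβ0 : 0 ≤ β) {G ε : ℝ} (hG : 0 < G)
    (hG2 : (5 * α + 4 * β * Real.log m) / s ≤ G ^ 2) (hε : 0 < ε)
    (hd : 2 ≤ Module.finrank ℝ E / ε) :
    gammaTwo (unitSphereOf E) (deltaDist s D) ≤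
      ENNReal.ofReal (25 * (ε + Real.log (Module.finrank ℝ E / ε) * G)) := by
  have hD0 : ∀ i j, 0 ≤ D i j := fun i j => by rcases hD i j with h | h <;> simp [h]
  have hs1 : (1 : ℝ) ≤ s := by exact_mod_cast hs
  have hs0 : (0 : ℝ) < s := by linarith
  have hm1 : (1 : ℝ) ≤ m := by exact_mod_cast hm
  have : Nonempty (Fin m) := ⟨⟨0, hm⟩⟩
  have hα0 : 0 ≤ α := by
    refine le_trans ?_ (hα ⟨0, hm⟩)
    exact Finset.sum_nonneg fun j _ => mul_nonneg (hD0 _ _) (sq_nonneg _)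
  have hlog : 0 ≤ Real.log m := Real.log_nonneg hm1
  rw [unitSphereOf_eq_image]
  refine (gammaTwo_image_le _ _ _).trans ?_
  have hscale : ∀ i (x : E), ∑ j, D i j * x.1 j ^ 2 ≤ β * ‖x‖ ^ 2 := by
    intro i x
    rcases eq_or_ne x 0 with rfl | hx
    · simp
    have hx0 : 0 < ‖x‖ := norm_pos_iff.2 hx
    have h1 := hβ i (‖x‖⁻¹ • x) (by rw [norm_smul, norm_inv, norm_norm, inv_mul_cancel₀ hx0.ne'])
    have h2 : ∑ j, D i j * (‖x‖⁻¹ • x).1 j ^ 2 = (‖x‖ ^ 2)⁻¹ * ∑ j, D i j * x.1 j ^ 2 := by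
      rw [Finset.mul_sum]
      refine Finset.sum_congr rfl fun j _ => ?_
      simp only [Submodule.coe_smul, PiLp.smul_apply, smul_eq_mul, mul_pow, inv_pow]
      ring
    rw [h2, inv_mul_le_iff₀ (by positivity)] at h1
    linarith
  -- The sphere estimate needs b ≤ a and b ≤ 1. Mass and ambient norm also bound the energy, so
  -- truncating β at α and at s is legitimate.
  refine gammaTwo_sphere_le (T := fun i : Fin m => rowOperator E s (D i))
    (fun i => rowOperator_isPositive E s (hD0 i)) (a := α / s) (b := min β (min α s) / s)
    (fun i => ?_) (fun i x => ?_) (by positivity) ?_ ?_ (fun x y u hu h => ?_) hG ?_ hε hd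
  · rw [trace_rowOperator, one_div, inv_mul_eq_div]
    have := hα i
    gcongr
  · rw [inner_rowOperator, one_div, inv_mul_le_iff₀ hs0, ← mul_assoc, mul_div_cancel₀ _ hs0.ne',
      min_mul_of_nonneg _ _ (sq_nonneg _), min_mul_of_nonneg _ _ (sq_nonneg _)]
    refine le_min (hscale i x) (le_min ?_ ?_)
    · exact (sum_mul_sq_le_rowMass E (hD0 i) x).trans
        (mul_le_mul_of_nonneg_right (hα i) (sq_nonneg _))
    · refine (sum_mul_sq_le_norm_sq (hD i) x.1).trans ?_
      exact le_mul_of_one_le_left (sq_nonneg _) hs1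
  · gcongr
    exact (min_le_right _ _).trans (min_le_left _ _)
  · rw [div_le_one hs0]
    exact (min_le_right _ _).trans (min_le_right _ _)
  · refine ENNReal.ofReal_le_ofReal (deltaNorm_le hs hu fun i => ?_)
    have := h i
    rwa [inner_rowOperator] at this
  · rw [Fintype.card_fin]
    calc 5 * (α / s) + 4 * (min β (min α s) / s) * Real.log m =
          (5 * α + 4 * min β (min α s) * Real.log m) / s := by ring
      _ ≤ (5 * α + 4 * β * Real.log m) / s := by
          gcongr
          exact min_le_left _ _
      _ ≤ G ^ 2 := hG2

lemma deltaNorm_le_sqrt_rowMass {s : ℕ} (hs : 1 ≤ s) (hD : ∀ i j, D i j = 0 ∨ D i j = 1) {α : ℝ}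
    (hα : ∀ i, rowMass E (D i) ≤ α) (hα0 : 0 ≤ α) {x : EuclideanSpace ℝ (Fin n)}
    (hx : x ∈ unitSphereOf E) : deltaNorm s D x ≤ √(α / s) := by
  have hD0 : ∀ i j, 0 ≤ D i j := fun i j => by rcases hD i j with h | h <;> simp [h]
  refine deltaNorm_le hs (Real.sqrt_nonneg _) fun i => ?_
  rw [Real.sq_sqrt (by positivity), one_div, inv_mul_eq_div]
  gcongr
  have h1 := sum_mul_sq_le_rowMass E (hD0 i) ⟨x, hx.1⟩
  have h2 : ‖(⟨x, hx.1⟩ : E)‖ = 1 := hx.2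
  rw [h2] at h1
  linarith [hα i]

lemma deltaDist_le_sqrt_rowMass {s : ℕ} (hs : 1 ≤ s) (hD : ∀ i j, D i j = 0 ∨ D i j = 1) {α : ℝ}
    (hα : ∀ i, rowMass E (D i) ≤ α) (hα0 : 0 ≤ α) {x y : EuclideanSpace ℝ (Fin n)}
    (hx : x ∈ unitSphereOf E) (hy : y ∈ unitSphereOf E) :
    deltaDist s D x y ≤ ENNReal.ofReal (2 * √(α / s)) := by
  refine ENNReal.ofReal_le_ofReal ((deltaNorm_sub_le hs hD x y).trans ?_)
  have h1 := deltaNorm_le_sqrt_rowMass E hs hD hα hα0 hx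
  have h2 := deltaNorm_le_sqrt_rowMass E hs hD hα hα0 hy
  linarith

lemma diamTwo_unitSphereOf_le {s : ℕ} (hs : 1 ≤ s) (hD : ∀ i j, D i j = 0 ∨ D i j = 1) {α : ℝ}
    (hα : ∀ i, rowMass E (D i) ≤ α) (hα0 : 0 ≤ α) :
    diamTwo (unitSphereOf E) (deltaDist s D) ≤ ENNReal.ofReal (2 * √(α / s)) :=
  iSup₂_le fun _ hx => iSup₂_le fun _ hy => deltaDist_le_sqrt_rowMass E hs hD hα hα0 hx hy

/-- On a line, `γ₂` of the unit sphere is at most the diameter. -/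
lemma gammaTwo_unitSphereOf_line_le (hE : Module.finrank ℝ E = 1) {s : ℕ} (hs : 1 ≤ s)
    (hD : ∀ i j, D i j = 0 ∨ D i j = 1) {α : ℝ} (hα : ∀ i, rowMass E (D i) ≤ α) (hα0 : 0 ≤ α) :
    gammaTwo (unitSphereOf E) (deltaDist s D) ≤ ENNReal.ofReal (2 * √(α / s)) := by
  classical
  have : Nontrivial E := Module.nontrivial_of_finrank_pos (R := ℝ) (by rw [hE]; norm_num)
  obtain ⟨u, hu⟩ : (Metric.sphere (0 : E) 1).Nonempty := NormedSpace.sphere_nonempty.2 zero_le_one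
  have hu1 : ‖u‖ = 1 := by simpa using hu
  have hu0 : u ≠ 0 := fun h => by rw [h, norm_zero] at hu1; norm_num at hu1
  have hT : ∀ x ∈ unitSphereOf E, x = u.1 ∨ x = -u.1 := by
    rintro x ⟨hx, hx1⟩
    obtain ⟨c, hc⟩ := (finrank_eq_one_iff_of_nonzero' u hu0).1 hE ⟨x, hx⟩
    have hcx : c • u.1 = x := congrArg Subtype.val hc
    have hu1' : ‖u.1‖ = 1 := hu1
    have habs : |c| = 1 := by
      rw [← hcx, norm_smul, hu1', mul_one] at hx1
      exact hx1
    rcases (abs_eq zero_le_one).1 habs with h | h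
    · left; rw [← hcx, h, one_smul]
    · right; rw [← hcx, h, neg_one_smul]
  have hmem : u.1 ∈ unitSphereOf E ∧ -u.1 ∈ unitSphereOf E :=
    ⟨⟨u.2, hu1⟩, ⟨E.neg_mem u.2, by rw [norm_neg]; exact hu1⟩⟩
  have h := gammaTwo_le_of_nets (ρ := deltaDist s D) hmem.1
    (fun x hx => deltaDist_le_sqrt_rowMass E hs hD hα hα0 hx hmem.1) (e := fun _ => 0) fun r => by
      refine ⟨{u.1, -u.1}, ?_, ?_, fun x hx => ⟨x, ?_, ?_⟩⟩
      · simp only [Finset.coe_insert, Finset.coe_singleton]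
        exact Set.insert_subset hmem.1 (Set.singleton_subset_iff.2 hmem.2)
      · refine Finset.card_le_two.trans ?_
        calc 2 = 2 ^ 1 := by norm_num
          _ ≤ 2 ^ 2 ^ r := Nat.pow_le_pow_right (by norm_num) Nat.one_le_two_pow
      · rcases hT x hx with h | h <;> simp [h]
      · simp [deltaDist, deltaNorm_zero]
  simpa using h

end SparsePattern

/-! ### Moments of the row statistics. -/

section PatternMoments

open scoped InnerProductSpace

variable {m n : ℕ} (E : Submodule ℝ (EuclideanSpace ℝ (Fin n)))

/-- The `k`-th power sum of the row masses of a pattern. -/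
noncomputable def massMoment (k : ℕ) (D : Fin m → Fin n → ℝ) : ℝ := ∑ i, rowMass E (D i) ^ k

/-- The sum over the rows of a pattern of the `k`-th trace moments of the row frames. -/
noncomputable def frameMoment (k : ℕ) (D : Fin m → Fin n → ℝ) : ℝ :=
  ∑ i, LinearMap.trace ℝ E (weightedFrame (leverageVec E) (D i) ^ k)

variable {E}

lemma rowMass_nonneg {D : Fin n → ℝ} (hD : ∀ j, 0 ≤ D j) : 0 ≤ rowMass E D :=
  Finset.sum_nonneg fun j _ => mul_nonneg (hD j) (sq_nonneg _)

lemma rowMass_le_finrank {D : Fin n → ℝ} (hD : ∀ j, D j = 0 ∨ D j = 1) :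
    rowMass E D ≤ Module.finrank ℝ E := by
  rw [← sum_norm_leverageVec_sq, rowMass]
  refine Finset.sum_le_sum fun j _ => ?_
  rcases hD j with h | h <;> simp [h]

/-- The mass is a frame operator on ℝ built from the numbers ‖v_j‖, a tight frame there with
constant d. The trace moment theorem thus covers mass and energy alike. -/
lemma rowMass_pow_eq_trace (D : Fin n → ℝ) (k : ℕ) :
    rowMass E D ^ k =
      LinearMap.trace ℝ ℝ (weightedFrame (fun j => ‖leverageVec E j‖) D ^ k) := by
  have h : weightedFrame (fun j => ‖leverageVec E j‖) D = rowMass E D • (1 : ℝ →ₗ[ℝ] ℝ) := by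
    ext
    simp only [weightedFrame, LinearMap.sum_apply, LinearMap.smul_apply, rankOneSq_apply, rowMass,
      Module.End.one_apply, smul_eq_mul, mul_one]
    refine Finset.sum_congr rfl fun j _ => ?_
    simp [sq]
  rw [h, smul_pow, one_pow, map_smul, LinearMap.trace_one]
  simp

lemma rowMass_pow_le_massMoment {D : Fin m → Fin n → ℝ} (hD : ∀ i j, 0 ≤ D i j) (k : ℕ)
    (i : Fin m) : rowMass E (D i) ^ k ≤ massMoment E k D :=
  Finset.single_le_sum (f := fun i => rowMass E (D i) ^ k)
    (fun i _ => pow_nonneg (rowMass_nonneg (hD i)) k) (Finset.mem_univ i)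

lemma massMoment_nonneg {D : Fin m → Fin n → ℝ} (hD : ∀ i j, 0 ≤ D i j) (k : ℕ) :
    0 ≤ massMoment E k D :=
  Finset.sum_nonneg fun i _ => pow_nonneg (rowMass_nonneg (hD i)) k

lemma frameMoment_nonneg {D : Fin m → Fin n → ℝ} (hD : ∀ i j, 0 ≤ D i j) (k : ℕ) :
    0 ≤ frameMoment E k D :=
  Finset.sum_nonneg fun i _ => trace_weightedFrame_pow_nonneg _ (hD i) k

lemma sum_mul_sq_pow_le_frameMoment {D : Fin m → Fin n → ℝ} (hD : ∀ i j, 0 ≤ D i j) (k : ℕ)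
    (i : Fin m) {x : E} (hx : ‖x‖ = 1) :
    (∑ j, D i j * x.1 j ^ 2) ^ k ≤ frameMoment E k D := by
  have h := inner_rowOperator E 1 (D i) x
  simp only [rowOperator, Nat.cast_one, div_one, one_smul, one_mul] at h
  rw [← h]
  exact ((weightedFrame_isPositive _ (hD i)).inner_pow_le_trace_pow k hx).trans
    (Finset.single_le_sum (f := fun i => LinearMap.trace ℝ E
      (weightedFrame (leverageVec E) (D i) ^ k))
      (fun i _ => trace_weightedFrame_pow_nonneg _ (hD i) k) (Finset.mem_univ i))

variable {Ω : Type*} [MeasurableSpace Ω] {P : Measure Ω} {s : ℕ}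
  {δ σ : Fin m → Fin n → Ω → ℝ}

lemma IsSJLTData.pattern_nonneg (h : IsSJLTData P s δ σ) (i : Fin m) (j : Fin n) (ω : Ω) :
    0 ≤ δ i j ω := by
  rcases h.pattern_zero_one i j ω with h | h <;> simp [h]

lemma IsSJLTData.iIndepFun_row (h : IsSJLTData P s δ σ) (i : Fin m) : iIndepFun (δ i) P :=
  h.pattern_indep_cols.comp (fun _ (x : Fin m → ℝ) => x i) fun _ => measurable_pi_apply i

variable [IsProbabilityMeasure P]

lemma IsSJLTData.integrable_trace (h : IsSJLTData P s δ σ) {H : Type*} [NormedAddCommGroup H]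
    [InnerProductSpace ℝ H] [FiniteDimensional ℝ H] (v : Fin n → H) (k : ℕ) (i : Fin m) :
    Integrable (fun ω => LinearMap.trace ℝ H (weightedFrame v (fun j => δ i j ω) ^ k)) P :=
  integrable_continuous_comp_zero_one (h.measurable_pattern i) (h.pattern_zero_one i)
    (continuous_trace_weightedFrame_pow v k)

lemma IsSJLTData.integrable_massMoment (h : IsSJLTData P s δ σ) (k : ℕ) :
    Integrable (fun ω => massMoment E k fun i j => δ i j ω) P := by
  simp only [massMoment, rowMass_pow_eq_trace]
  exact integrable_finsetSum _ fun i _ => h.integrable_trace _ k i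

lemma IsSJLTData.integrable_frameMoment (h : IsSJLTData P s δ σ) (k : ℕ) :
    Integrable (fun ω => frameMoment E k fun i j => δ i j ω) P :=
  integrable_finsetSum _ fun i _ => h.integrable_trace _ k i

theorem IsSJLTData.integral_massMoment_le (h : IsSJLTData P s δ σ) (k : ℕ) :
    ∫ ω, massMoment E k (fun i j => δ i j ω) ∂P ≤
      m * ((s : ℝ) / m * Module.finrank ℝ E + k * incoherence E ^ 2) ^ k := by
  simp only [massMoment, rowMass_pow_eq_trace]
  rw [integral_finsetSum _ fun i _ => h.integrable_trace _ k i]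
  refine (Finset.sum_le_card_nsmul _ _ _ fun i _ =>
    integral_trace_weightedFrame_pow_le (h.measurable_pattern i) (h.pattern_zero_one i)
      (h.iIndepFun_row i) (by positivity) (h.pattern_mean i) (Λ := Module.finrank ℝ E)
      (c := incoherence E ^ 2) (fun x => ?_) (Nat.cast_nonneg _) (fun j => ?_)
      (sq_nonneg _) k).trans_eq ?_
  · rw [← sum_norm_leverageVec_sq, smul_eq_mul, Finset.sum_mul]
    exact Finset.sum_congr rfl fun j _ => by simp; ring
  · rw [norm_norm]
    exact pow_le_pow_left₀ (norm_nonneg _) (norm_leverageVec_le E j) 2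
  · simp

/-- Unlike for the mass, the dimension is here only a prefactor outside the power. This is why the
energy, which carries the extra log m in γ₂, scales like s/m and not like sd/m. -/
theorem IsSJLTData.integral_frameMoment_le (h : IsSJLTData P s δ σ) (k : ℕ) :
    ∫ ω, frameMoment E k (fun i j => δ i j ω) ∂P ≤
      m * (Module.finrank ℝ E * ((s : ℝ) / m + k * incoherence E ^ 2) ^ k) := by
  simp only [frameMoment]
  rw [integral_finsetSum _ fun i _ => h.integrable_trace _ k i]
  refine (Finset.sum_le_card_nsmul _ _ _ fun i _ =>
    integral_trace_weightedFrame_pow_le (h.measurable_pattern i) (h.pattern_zero_one i)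
      (h.iIndepFun_row i) (by positivity) (h.pattern_mean i) (Λ := 1)
      (c := incoherence E ^ 2) (sum_inner_leverageVec_smul E) zero_le_one (fun j => ?_)
      (sq_nonneg _) k).trans_eq ?_
  · exact pow_le_pow_left₀ (norm_nonneg _) (norm_leverageVec_le E j) 2
  · simp

end PatternMoments

/-! ### Passing from integer moments to real exponents. -/

section Lyapunov

variable {Ω : Type*} [MeasurableSpace Ω] {P : Measure Ω}

lemma eLpNorm'_le_of_integral_pow_le {a : Ω → ℝ} {A : ℝ} {k : ℕ} (hk : 1 ≤ k) (ha0 : ∀ ω, 0 ≤ a ω)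
    (hA0 : 0 ≤ A) (hint : Integrable (fun ω => a ω ^ k) P) (hA : ∫ ω, a ω ^ k ∂P ≤ A ^ k) :
    eLpNorm' a k P ≤ ENNReal.ofReal A := by
  have hk0 : (0 : ℝ) < k := by exact_mod_cast hk
  rw [eLpNorm', one_div, ENNReal.rpow_inv_le_iff hk0, ENNReal.rpow_natCast,
    ← ENNReal.ofReal_pow hA0]
  calc ∫⁻ ω, ‖a ω‖ₑ ^ (k : ℝ) ∂P = ∫⁻ ω, ENNReal.ofReal (a ω ^ k) ∂P := by
        refine lintegral_congr fun ω => ?_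
        rw [ENNReal.rpow_natCast, Real.enorm_of_nonneg (ha0 ω), ENNReal.ofReal_pow (ha0 ω)]
    _ = ENNReal.ofReal (∫ ω, a ω ^ k ∂P) :=
        (ofReal_integral_eq_lintegral_ofReal hint
          (Filter.Eventually.of_forall fun ω => pow_nonneg (ha0 ω) k)).symm
    _ ≤ _ := ENNReal.ofReal_le_ofReal hA

variable [IsProbabilityMeasure P]

/-- Moment bounds for a quantity dominated by an affine combination of two variables. -/
theorem lintegral_rpow_le_of_sq_le {g : Ω → ℝ≥0∞} {a b : Ω → ℝ} {x y z A B p : ℝ} {k : ℕ}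
    (hx : 0 ≤ x) (hy : 0 ≤ y) (hz : 0 ≤ z) (hA0 : 0 ≤ A) (hB0 : 0 ≤ B) (hp : 0 < p) (hk : 1 ≤ k)
    (hpk : p ≤ k) (ha0 : ∀ ω, 0 ≤ a ω) (hb0 : ∀ ω, 0 ≤ b ω)
    (ham : AEStronglyMeasurable a P) (hbm : AEStronglyMeasurable b P)
    (hai : Integrable (fun ω => a ω ^ k) P) (hbi : Integrable (fun ω => b ω ^ k) P)
    (hA : ∫ ω, a ω ^ k ∂P ≤ A ^ k) (hB : ∫ ω, b ω ^ k ∂P ≤ B ^ k)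
    (hg : ∀ ω, g ω ^ 2 ≤ ENNReal.ofReal (x + y * a ω + z * b ω)) :
    (∫⁻ ω, g ω ^ (2 * p) ∂P) ^ (1 / p) ≤ ENNReal.ofReal (x + y * A + z * B) := by
  have hk0 : (0 : ℝ) < k := by exact_mod_cast hk
  have hk1 : (1 : ℝ) ≤ k := by exact_mod_cast hk
  have hxm : AEStronglyMeasurable (fun _ : Ω => x) P := aestronglyMeasurable_const
  have hym : AEStronglyMeasurable (y • a) P := ham.const_smul y
  have hzm : AEStronglyMeasurable (z • b) P := hbm.const_smul z
  have h1 : (∫⁻ ω, g ω ^ (2 * p) ∂P) ^ (1 / p) ≤ eLpNorm' ((fun _ => x) + y • a + z • b) p P := by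
    rw [eLpNorm']
    refine ENNReal.rpow_le_rpow (lintegral_mono fun ω => ?_) (by positivity)
    have hω : 0 ≤ x + y * a ω + z * b ω := by
      have := mul_nonneg hy (ha0 ω); have := mul_nonneg hz (hb0 ω); linarith
    rw [ENNReal.rpow_mul]
    refine ENNReal.rpow_le_rpow ?_ hp.le
    simp only [Pi.add_apply, Pi.smul_apply, smul_eq_mul]
    rw [Real.enorm_of_nonneg hω]
    exact_mod_cast hg ω
  -- Minkowski's inequality needs an exponent at least 1, so it is applied after raising `p` to the
  -- integer `k`.
  refine h1.trans ((eLpNorm'_le_eLpNorm'_of_exponent_le hp hpk P ((hxm.add hym).add hzm)).trans ?_)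
  refine (eLpNorm'_add_le (hxm.add hym) hzm hk1).trans ?_
  rw [ENNReal.ofReal_add (by positivity) (by positivity), ENNReal.ofReal_add hx (by positivity),
    ENNReal.ofReal_mul hy, ENNReal.ofReal_mul hz]
  refine add_le_add ((eLpNorm'_add_le hxm hym hk1).trans (add_le_add ?_ ?_)) ?_
  · rw [eLpNorm'_const_of_isProbabilityMeasure x hk0, Real.enorm_of_nonneg hx]
  · rw [eLpNorm'_const_smul y hk0, Real.enorm_of_nonneg hy]
    exact mul_le_mul_right (eLpNorm'_le_of_integral_pow_le hk ha0 hA0 hai hA) _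
  · rw [eLpNorm'_const_smul z hk0, Real.enorm_of_nonneg hz]
    exact mul_le_mul_right (eLpNorm'_le_of_integral_pow_le hk hb0 hB0 hbi hB) _

end Lyapunov

/-! ### Moment bounds for the diameter and γ₂. -/

section MomentBounds

variable {m n : ℕ} {E : Submodule ℝ (EuclideanSpace ℝ (Fin n))}
  {Ω : Type*} [MeasurableSpace Ω] {P : Measure Ω} {s : ℕ}
  {δ σ : Fin m → Fin n → Ω → ℝ}

/-- The role of p ≥ log m: replacing a maximum over the m rows by a power sum costs a factor e after
the k-th root. -/
lemma natCast_le_exp_pow {k : ℕ} (hm : 1 ≤ m) (hk : Real.log m ≤ k) :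
    (m : ℝ) ≤ Real.exp 1 ^ k := by
  rw [← Real.exp_nat_mul, mul_one]
  exact (Real.log_le_iff_le_exp (by exact_mod_cast hm)).1 hk

lemma exists_pow_eq_of_integrable {F : Ω → ℝ} (hF0 : ∀ ω, 0 ≤ F ω) (hF : Integrable F P) {k : ℕ}
    (hk : k ≠ 0) :
    ∃ a : Ω → ℝ, (∀ ω, 0 ≤ a ω) ∧ AEStronglyMeasurable a P ∧ ∀ ω, a ω ^ k = F ω :=
  ⟨fun ω => F ω ^ (k : ℝ)⁻¹, fun ω => Real.rpow_nonneg (hF0 ω) _,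
    (hF.aestronglyMeasurable.aemeasurable.pow_const _).aestronglyMeasurable,
    fun ω => Real.rpow_inv_natCast_pow (hF0 ω) hk⟩

variable [IsProbabilityMeasure P]

lemma IsSJLTData.integral_massMoment_le_pow (h : IsSJLTData P s δ σ) {k : ℕ} (hm : 1 ≤ m)
    (hk : Real.log m ≤ k) :
    ∫ ω, massMoment E k (fun i j => δ i j ω) ∂P ≤
      (Real.exp 1 * ((s : ℝ) / m * Module.finrank ℝ E + k * incoherence E ^ 2)) ^ k := by
  rw [mul_pow]
  exact (h.integral_massMoment_le k).trans
    (mul_le_mul_of_nonneg_right (natCast_le_exp_pow hm hk) (by positivity))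

lemma IsSJLTData.integral_frameMoment_le_pow (h : IsSJLTData P s δ σ) {k : ℕ} (hm : 1 ≤ m)
    (hk : Real.log m ≤ k) (hd : Module.finrank ℝ E ≤ m ^ 2) :
    ∫ ω, frameMoment E k (fun i j => δ i j ω) ∂P ≤
      (Real.exp 1 ^ 3 * ((s : ℝ) / m + k * incoherence E ^ 2)) ^ k := by
  have hd' : (Module.finrank ℝ E : ℝ) ≤ m ^ 2 := by exact_mod_cast hd
  have h1 := natCast_le_exp_pow hm hk
  refine (h.integral_frameMoment_le k).trans ?_
  rw [← mul_assoc, mul_pow, ← pow_mul, mul_comm 3 k, pow_mul]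
  refine mul_le_mul_of_nonneg_right ?_ (by positivity)
  calc (m : ℝ) * Module.finrank ℝ E ≤ m * m ^ 2 := by gcongr
    _ = m ^ 3 := by ring
    _ ≤ _ := by gcongr

/-- A variable dominating all row masses, with controlled moments. -/
lemma IsSJLTData.exists_rowMass_le (h : IsSJLTData P s δ σ) {k : ℕ} (hk : k ≠ 0) (hm : 1 ≤ m)
    (hmk : Real.log m ≤ k) :
    ∃ a : Ω → ℝ, (∀ ω, 0 ≤ a ω) ∧ AEStronglyMeasurable a P ∧ Integrable (fun ω => a ω ^ k) P ∧
      ∫ ω, a ω ^ k ∂P ≤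
        (Real.exp 1 * ((s : ℝ) / m * Module.finrank ℝ E + k * incoherence E ^ 2)) ^ k ∧
      ∀ ω i, rowMass E (fun j => δ i j ω) ≤ a ω := by
  obtain ⟨a, ha0, ham, ha⟩ := exists_pow_eq_of_integrable (P := P)
    (fun ω => massMoment_nonneg (E := E) (fun i j => h.pattern_nonneg i j ω) k)
    (h.integrable_massMoment k) hk
  refine ⟨a, ha0, ham, ?_, ?_, fun ω i => ?_⟩
  · simpa only [ha] using h.integrable_massMoment k
  · simpa only [ha] using h.integral_massMoment_le_pow hm hmk
  · refine le_of_pow_le_pow_left₀ hk (ha0 ω) ?_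
    rw [ha]
    exact rowMass_pow_le_massMoment (D := fun i j => δ i j ω) (fun i j => h.pattern_nonneg i j ω) k i

/-- A variable dominating all row energies on the unit sphere, with controlled moments. -/
lemma IsSJLTData.exists_rowEnergy_le (h : IsSJLTData P s δ σ) {k : ℕ} (hk : k ≠ 0) (hm : 1 ≤ m)
    (hmk : Real.log m ≤ k) (hd : Module.finrank ℝ E ≤ m ^ 2) :
    ∃ b : Ω → ℝ, (∀ ω, 0 ≤ b ω) ∧ AEStronglyMeasurable b P ∧ Integrable (fun ω => b ω ^ k) P ∧
      ∫ ω, b ω ^ k ∂P ≤ (Real.exp 1 ^ 3 * ((s : ℝ) / m + k * incoherence E ^ 2)) ^ k ∧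
      ∀ ω i, ∀ x : E, ‖x‖ = 1 → ∑ j, δ i j ω * x.1 j ^ 2 ≤ b ω := by
  obtain ⟨b, hb0, hbm, hb⟩ := exists_pow_eq_of_integrable (P := P)
    (fun ω => frameMoment_nonneg (E := E) (fun i j => h.pattern_nonneg i j ω) k)
    (h.integrable_frameMoment k) hk
  refine ⟨b, hb0, hbm, ?_, ?_, fun ω i x hx => ?_⟩
  · simpa only [hb] using h.integrable_frameMoment k
  · simpa only [hb] using h.integral_frameMoment_le_pow hm hmk hd
  · refine le_of_pow_le_pow_left₀ hk (hb0 ω) ?_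
    rw [hb]
    exact sum_mul_sq_pow_le_frameMoment (D := fun i j => δ i j ω)
      (fun i j => h.pattern_nonneg i j ω) k i hx

lemma IsSJLTData.lintegral_diamTwo_le (h : IsSJLTData P s δ σ) (hs : 1 ≤ s) {a : Ω → ℝ} {A p : ℝ}
    {k : ℕ} (hp : 0 < p) (hk : 1 ≤ k) (hpk : p ≤ k) (ha0 : ∀ ω, 0 ≤ a ω)
    (ham : AEStronglyMeasurable a P) (hai : Integrable (fun ω => a ω ^ k) P)
    (hA0 : 0 ≤ A) (hA : ∫ ω, a ω ^ k ∂P ≤ A ^ k)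
    (ha : ∀ ω i, rowMass E (fun j => δ i j ω) ≤ a ω) :
    (∫⁻ ω, diamTwo (unitSphereOf E) (deltaDist s fun i j => δ i j ω) ^ (2 * p) ∂P) ^ (1 / p) ≤
      ENNReal.ofReal (4 / s * A) := by
  have key := lintegral_rpow_le_of_sq_le (P := P)
    (g := fun ω => diamTwo (unitSphereOf E) (deltaDist s fun i j => δ i j ω)) (a := a) (b := a)
    (x := 0) (y := 4 / s) (z := 0) (p := p) le_rfl (by positivity) le_rfl hA0 hA0 hp hk hpk ha0 ha0
    ham ham hai hai hA hA fun ω => ?_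
  · simpa using key
  · have h1 := diamTwo_unitSphereOf_le E hs (D := fun i j => δ i j ω)
      (fun i j => h.pattern_zero_one i j ω) (ha ω) (ha0 ω)
    refine (pow_le_pow_left₀ zero_le h1 2).trans ?_
    rw [← ENNReal.ofReal_pow (by positivity), mul_pow,
      Real.sq_sqrt (div_nonneg (ha0 ω) (Nat.cast_nonneg s))]
    refine ENNReal.ofReal_le_ofReal (le_of_eq ?_)
    ring

lemma IsSJLTData.lintegral_gammaTwo_le (h : IsSJLTData P s δ σ) (hs : 1 ≤ s) (hm : 1 ≤ m)
    {a b : Ω → ℝ} {A B p ε : ℝ} {k : ℕ} (hp : 0 < p) (hk : 1 ≤ k) (hpk : p ≤ k)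
    (ha0 : ∀ ω, 0 ≤ a ω) (ham : AEStronglyMeasurable a P) (hai : Integrable (fun ω => a ω ^ k) P)
    (hA0 : 0 ≤ A) (hA : ∫ ω, a ω ^ k ∂P ≤ A ^ k)
    (ha : ∀ ω i, rowMass E (fun j => δ i j ω) ≤ a ω)
    (hb0 : ∀ ω, 0 ≤ b ω) (hbm : AEStronglyMeasurable b P) (hbi : Integrable (fun ω => b ω ^ k) P)
    (hB0 : 0 ≤ B) (hB : ∫ ω, b ω ^ k ∂P ≤ B ^ k)
    (hb : ∀ ω i, ∀ x : E, ‖x‖ = 1 → ∑ j, δ i j ω * x.1 j ^ 2 ≤ b ω)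
    (hε : 0 < ε) (hd : 2 ≤ Module.finrank ℝ E / ε) :
    (∫⁻ ω, gammaTwo (unitSphereOf E) (deltaDist s fun i j => δ i j ω) ^ (2 * p) ∂P) ^ (1 / p) ≤
      ENNReal.ofReal (2500 * ε ^ 2 + 6250 * Real.log (Module.finrank ℝ E / ε) ^ 2 / s * A +
        5000 * Real.log (Module.finrank ℝ E / ε) ^ 2 * Real.log m / s * B) := by
  set ℓ := Real.log (Module.finrank ℝ E / ε) with hℓ
  have hℓ0 : 0 < ℓ := Real.log_pos (by linarith)
  have hlog : 0 ≤ Real.log m := Real.log_nonneg (by exact_mod_cast hm)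
  have hs0 : (0 : ℝ) < s := by exact_mod_cast hs
  refine lintegral_rpow_le_of_sq_le (by positivity) (by positivity) (by positivity) hA0 hB0 hp hk
    hpk ha0 hb0 ham hbm hai hbi hA hB fun ω => ?_
  have haω := ha0 ω
  have hbω := hb0 ω
  set Q := (5 * a ω + 4 * b ω * Real.log m) / s with hQ
  have hQ0 : 0 ≤ Q := by positivity
  -- The scale `G` must be positive even when the row statistics vanish. The added ε²/ℓ² contributes
  -- only a multiple of ε² after multiplication by ℓ².
  have hG : 0 < Q + ε ^ 2 / ℓ ^ 2 := by positivity
  have h1 := gammaTwo_unitSphereOf_le E hs hm (D := fun i j => δ i j ω)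
    (fun i j => h.pattern_zero_one i j ω) (ha ω) (hb ω) hbω (G := √(Q + ε ^ 2 / ℓ ^ 2))
    (Real.sqrt_pos.2 hG) (by
      rw [Real.sq_sqrt hG.le]
      have : 0 ≤ ε ^ 2 / ℓ ^ 2 := by positivity
      linarith) hε hd
  refine (pow_le_pow_left₀ zero_le h1 2).trans ?_
  rw [← ENNReal.ofReal_pow (by positivity)]
  refine ENNReal.ofReal_le_ofReal ?_
  calc (25 * (ε + ℓ * √(Q + ε ^ 2 / ℓ ^ 2))) ^ 2
      ≤ 1250 * (ε ^ 2 + (ℓ * √(Q + ε ^ 2 / ℓ ^ 2)) ^ 2) := by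
        nlinarith [sq_nonneg (ε - ℓ * √(Q + ε ^ 2 / ℓ ^ 2))]
    _ = 1250 * (ε ^ 2 + ℓ ^ 2 * (Q + ε ^ 2 / ℓ ^ 2)) := by rw [mul_pow, Real.sq_sqrt hG.le]
    _ = 2500 * ε ^ 2 + 6250 * ℓ ^ 2 / s * a ω + 5000 * ℓ ^ 2 * Real.log m / s * b ω := by
        rw [hQ]; field_simp; ring

/-- Two rows force p ≥ log 2 > 1/2. With one row `p` may be arbitrarily small while its ceiling is
1; that case is handled by the deterministic bound of the mass by d. -/
lemma natCeil_le_two_mul {p : ℝ} (hm : 2 ≤ m) (hp : Real.log m ≤ p) : (⌈p⌉₊ : ℝ) ≤ 2 * p := by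
  have h2 : Real.log 2 ≤ Real.log m := Real.log_le_log (by norm_num) (by exact_mod_cast hm)
  have hl := Real.log_two_gt_d9
  rcases le_or_gt p 1 with h1 | h1
  · have : (⌈p⌉₊ : ℝ) ≤ 1 := by exact_mod_cast Nat.ceil_le.2 (by simpa using h1)
    linarith
  · have := Nat.ceil_lt_add_one (by linarith : 0 ≤ p)
    linarith

/-- Moments of the diameter of the unit sphere. -/
theorem IsSJLTData.lintegral_diamTwo_rpow_le (h : IsSJLTData P s δ σ) (hs : 1 ≤ s) (hm : 1 ≤ m)
    {p : ℝ} (hp : 0 < p) (hmp : Real.log m ≤ p) :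
    (∫⁻ ω, diamTwo (unitSphereOf E) (deltaDist s fun i j => δ i j ω) ^ (2 * p) ∂P) ^ (1 / p) ≤
      ENNReal.ofReal (24 * ((Module.finrank ℝ E : ℝ) / m + p / s * incoherence E ^ 2)) := by
  have hs1 : (1 : ℝ) ≤ s := by exact_mod_cast hs
  have hs0 : (0 : ℝ) < s := by linarith
  have hd0 : (0 : ℝ) ≤ Module.finrank ℝ E := Nat.cast_nonneg _
  have hk : 1 ≤ ⌈p⌉₊ := Nat.one_le_ceil_iff.2 hp
  have hμ : 0 ≤ incoherence E ^ 2 := sq_nonneg _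
  rcases hm.eq_or_lt with rfl | hm2
  · refine (h.lintegral_diamTwo_le (E := E) hs hp hk (Nat.le_ceil p) (a := fun _ => Module.finrank ℝ E)
      (fun _ => hd0) aestronglyMeasurable_const (integrable_const _) hd0 (by simp)
      fun ω i => rowMass_le_finrank fun j => h.pattern_zero_one i j ω).trans
      (ENNReal.ofReal_le_ofReal ?_)
    have h1 : (4 : ℝ) / s * Module.finrank ℝ E ≤ 4 * Module.finrank ℝ E :=
      mul_le_mul_of_nonneg_right (div_le_self (by norm_num) hs1) hd0
    have h2 : 0 ≤ p / s * incoherence E ^ 2 := by positivity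
    simp only [Nat.cast_one, div_one]
    linarith
  · have hm0 : (0 : ℝ) < m := by positivity
    obtain ⟨a, ha0, ham, hai, hA, ha⟩ := h.exists_rowMass_le (E := E) (k := ⌈p⌉₊) (by omega) hm
      (hmp.trans (Nat.le_ceil p))
    refine (h.lintegral_diamTwo_le hs hp hk (Nat.le_ceil p) ha0 ham hai (by positivity) hA ha).trans
      (ENNReal.ofReal_le_ofReal ?_)
    have hkp := natCeil_le_two_mul hm2 hmp
    calc 4 / s * (Real.exp 1 * ((s : ℝ) / m * Module.finrank ℝ E + ⌈p⌉₊ * incoherence E ^ 2))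
        ≤ 4 / s * (3 * ((s : ℝ) / m * Module.finrank ℝ E + 2 * p * incoherence E ^ 2)) := by
          gcongr
          exact Real.exp_one_lt_three.le
      _ = 12 * (Module.finrank ℝ E / m) + 24 * (p / s * incoherence E ^ 2) := by field_simp; ring
      _ ≤ _ := by
          have : 0 ≤ (Module.finrank ℝ E : ℝ) / m := by positivity
          linarith

/-- Moments of `γ₂` of the unit sphere. -/
theorem IsSJLTData.lintegral_gammaTwo_rpow_le (h : IsSJLTData P s δ σ) (hs : 1 ≤ s) (hm : 1 ≤ m)
    (hdim : 1 ≤ Module.finrank ℝ E) {p ε : ℝ} (hp : 0 < p) (hmp : Real.log m ≤ p) (hε : 0 < ε)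
    (hε1 : ε < 1) :
    (∫⁻ ω, gammaTwo (unitSphereOf E) (deltaDist s fun i j => δ i j ω) ^ (2 * p) ∂P) ^ (1 / p) ≤
      ENNReal.ofReal (1000000 * (ε ^ 2 + (Module.finrank ℝ E + Real.log m) *
        Real.log (Module.finrank ℝ E / ε) ^ 2 / m +
        p * Real.log (Module.finrank ℝ E / ε) ^ 2 * Real.log m / s * incoherence E ^ 2)) := by
  have hs1 : (1 : ℝ) ≤ s := by exact_mod_cast hs
  have hs0 : (0 : ℝ) < s := by linarith
  have hm1 : (1 : ℝ) ≤ m := by exact_mod_cast hm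
  have hm0 : (0 : ℝ) < m := by linarith
  have hd1 : (1 : ℝ) ≤ Module.finrank ℝ E := by exact_mod_cast hdim
  have hd0 : (0 : ℝ) ≤ Module.finrank ℝ E := by linarith
  have hk : 1 ≤ ⌈p⌉₊ := Nat.one_le_ceil_iff.2 hp
  have hμ : 0 ≤ incoherence E ^ 2 := sq_nonneg _
  have hlog : 0 ≤ Real.log m := Real.log_nonneg hm1
  have henergy : ∀ ω i, ∀ x : E, ‖x‖ = 1 → ∑ j, δ i j ω * x.1 j ^ 2 ≤ 1 := fun ω i x hx => by
    have h1 := sum_mul_sq_le_norm_sq (fun j => h.pattern_zero_one i j ω) x.1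
    have h2 : ‖x.1‖ = 1 := hx
    rwa [h2, one_pow] at h1
  -- If d/ε < 2, then ε < 1 forces d = 1 and ε > 1/2, so the constant bound on a line is absorbed by
  -- ε².
  rcases lt_or_ge (Module.finrank ℝ E / ε : ℝ) 2 with hdε | hdε
  · rw [div_lt_iff₀ hε] at hdε
    have hE : Module.finrank ℝ E = 1 := by
      have : (Module.finrank ℝ E : ℝ) < 2 := by linarith
      have : Module.finrank ℝ E < 2 := by exact_mod_cast this
      omega
    have key := lintegral_rpow_le_of_sq_le (P := P)
      (g := fun ω => gammaTwo (unitSphereOf E) (deltaDist s fun i j => δ i j ω))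
      (a := fun _ => 0) (b := fun _ => 0) (A := 0) (B := 0)
      (x := 4) (y := 0) (z := 0) (p := p) (by norm_num) le_rfl le_rfl le_rfl le_rfl hp hk
      (Nat.le_ceil p) (fun _ => le_rfl) (fun _ => le_rfl) aestronglyMeasurable_const
      aestronglyMeasurable_const (integrable_const _) (integrable_const _) (by simp) (by simp)
      fun ω => ?_
    · refine key.trans (ENNReal.ofReal_le_ofReal ?_)
      have h1 : 0 ≤ (Module.finrank ℝ E + Real.log m) *
        Real.log (Module.finrank ℝ E / ε) ^ 2 / m := by positivity
      have h2 : 0 ≤ p * Real.log (Module.finrank ℝ E / ε) ^ 2 * Real.log m / s *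
        incoherence E ^ 2 := by positivity
      nlinarith
    · have h1 := gammaTwo_unitSphereOf_line_le E hE hs (D := fun i j => δ i j ω)
        (fun i j => h.pattern_zero_one i j ω) (α := 1)
        (fun i => (rowMass_le_finrank fun j => h.pattern_zero_one i j ω).trans (by simp [hE]))
        zero_le_one
      refine (pow_le_pow_left₀ zero_le h1 2).trans ?_
      rw [← ENNReal.ofReal_pow (by positivity), mul_pow, Real.sq_sqrt (by positivity)]
      refine ENNReal.ofReal_le_ofReal ?_
      have : 1 / (s : ℝ) ≤ 1 := div_le_one_of_le₀ hs1 hs0.le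
      linarith
  set ℓ := Real.log (Module.finrank ℝ E / ε) with hℓ
  rcases hm.eq_or_lt with rfl | hm2
  · refine (h.lintegral_gammaTwo_le (E := E) hs le_rfl hp hk (Nat.le_ceil p)
      (a := fun _ => Module.finrank ℝ E) (b := fun _ => 1) (B := 1)
      (fun _ => hd0) aestronglyMeasurable_const (integrable_const _) hd0 (by simp)
      (fun ω i => rowMass_le_finrank fun j => h.pattern_zero_one i j ω)
      (fun _ => zero_le_one) aestronglyMeasurable_const (integrable_const _) zero_le_one (by simp)
      henergy hε hdε).trans (ENNReal.ofReal_le_ofReal ?_)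
    rw [← hℓ]
    have h1 : 6250 * ℓ ^ 2 / s * Module.finrank ℝ E ≤ 6250 * ℓ ^ 2 * Module.finrank ℝ E :=
      mul_le_mul_of_nonneg_right (div_le_self (by positivity) hs1) hd0
    have h2 : 0 ≤ ℓ ^ 2 * Module.finrank ℝ E := by positivity
    simp only [Nat.cast_one, div_one, Real.log_one, mul_zero, zero_div, zero_mul, add_zero]
    nlinarith [sq_nonneg ε]
  have hkp := natCeil_le_two_mul hm2 hmp
  have hlog2 : 1 / 2 ≤ Real.log m := by
    have := Real.log_le_log (by norm_num) (show (2 : ℝ) ≤ m by exact_mod_cast hm2)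
    linarith [Real.log_two_gt_d9]
  obtain ⟨a, ha0, ham, hai, hA, ha⟩ := h.exists_rowMass_le (E := E) (k := ⌈p⌉₊) (by omega) hm
    (hmp.trans (Nat.le_ceil p))
  have hX : 0 ≤ ℓ ^ 2 * Module.finrank ℝ E / m := by positivity
  have hY : 0 ≤ ℓ ^ 2 * Real.log m / m := by positivity
  have hZ : 0 ≤ p * ℓ ^ 2 * Real.log m / s * incoherence E ^ 2 := by positivity
  have hAle : 6250 * ℓ ^ 2 / s *
      (Real.exp 1 * ((s : ℝ) / m * Module.finrank ℝ E + ⌈p⌉₊ * incoherence E ^ 2)) ≤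
      18750 * (ℓ ^ 2 * Module.finrank ℝ E / m) +
        75000 * (p * ℓ ^ 2 * Real.log m / s * incoherence E ^ 2) := by
    calc _ ≤ 6250 * ℓ ^ 2 / s *
          (3 * ((s : ℝ) / m * Module.finrank ℝ E + 2 * p * incoherence E ^ 2)) := by
          gcongr
          exact Real.exp_one_lt_three.le
      _ = 18750 * (ℓ ^ 2 * Module.finrank ℝ E / m) +
          75000 * (p * ℓ ^ 2 * (1 / 2) / s * incoherence E ^ 2) := by field_simp; ring
      _ ≤ _ := by gcongr
  -- For d ≤ m² the prefactor md of the trace moment is at most e^{3k}. For larger d the trivial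
  -- energy bound 1 suffices, because m log m ≤ m² ≤ d lets the term with d/m absorb it.
  rcases le_or_gt (Module.finrank ℝ E) (m ^ 2) with hdm | hdm
  · obtain ⟨b, hb0, hbm, hbi, hB, hb⟩ := h.exists_rowEnergy_le (E := E) (k := ⌈p⌉₊) (by omega) hm
      (hmp.trans (Nat.le_ceil p)) hdm
    refine (h.lintegral_gammaTwo_le hs hm hp hk (Nat.le_ceil p) ha0 ham hai (by positivity) hA ha
      hb0 hbm hbi (by positivity) hB hb hε hdε).trans (ENNReal.ofReal_le_ofReal ?_)
    rw [← hℓ]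
    have hBle : 5000 * ℓ ^ 2 * Real.log m / s *
        (Real.exp 1 ^ 3 * ((s : ℝ) / m + ⌈p⌉₊ * incoherence E ^ 2)) ≤
        135000 * (ℓ ^ 2 * Real.log m / m) +
          270000 * (p * ℓ ^ 2 * Real.log m / s * incoherence E ^ 2) := by
      calc _ ≤ 5000 * ℓ ^ 2 * Real.log m / s *
            (3 ^ 3 * ((s : ℝ) / m + 2 * p * incoherence E ^ 2)) := by
            gcongr
            exact Real.exp_one_lt_three.le
        _ = _ := by field_simp; ring
    have e : (Module.finrank ℝ E + Real.log m) * ℓ ^ 2 / m =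
        ℓ ^ 2 * Module.finrank ℝ E / m + ℓ ^ 2 * Real.log m / m := by ring
    rw [e]
    nlinarith [sq_nonneg ε]
  · refine (h.lintegral_gammaTwo_le hs hm hp hk (Nat.le_ceil p) ha0 ham hai (by positivity) hA ha
      (b := fun _ => 1) (B := 1) (fun _ => zero_le_one) aestronglyMeasurable_const
      (integrable_const _) zero_le_one (by simp) henergy hε hdε).trans
      (ENNReal.ofReal_le_ofReal ?_)
    rw [← hℓ]
    have hdm' : (m : ℝ) ^ 2 ≤ Module.finrank ℝ E := by exact_mod_cast hdm.le
    have hBle : 5000 * ℓ ^ 2 * Real.log m / s * 1 ≤ 5000 * (ℓ ^ 2 * Module.finrank ℝ E / m) := by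
      rw [mul_one, ← mul_div_assoc, div_le_div_iff₀ hs0 hm0]
      have h1 : Real.log m * m ≤ Module.finrank ℝ E := by
        have := Real.log_le_self hm0.le
        nlinarith
      calc 5000 * ℓ ^ 2 * Real.log m * m = 5000 * ℓ ^ 2 * (Real.log m * m) := by ring
        _ ≤ 5000 * ℓ ^ 2 * (Module.finrank ℝ E * s) := by
            exact mul_le_mul_of_nonneg_left (h1.trans (le_mul_of_one_le_right hd0 hs1))
              (by positivity)
        _ = _ := by ring
    have e : (Module.finrank ℝ E + Real.log m) * ℓ ^ 2 / m =
        ℓ ^ 2 * Module.finrank ℝ E / m + ℓ ^ 2 * Real.log m / m := by ring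
    rw [e]
    nlinarith [sq_nonneg ε]

end MomentBounds

/-! ### Conditioning on the pattern and averaging over the signs. -/

section Conditioning

variable {Ω : Type*} [MeasurableSpace Ω] {P : Measure Ω}

/-- Union bound over the values of a discrete variable independent of the second one. -/
lemma measure_mem_fiber_le [IsProbabilityMeasure P] {α β : Type*} [MeasurableSpace α]
    [MeasurableSpace β] [MeasurableSingletonClass α] {X : Ω → α} {Y : Ω → β}
    (hXY : IndepFun X Y P) (hX : Measurable X) (F : Finset α) {B : α → Set β}
    (hB : ∀ D ∈ F, MeasurableSet (B D)) {p : ℝ≥0∞} (hp : ∀ D ∈ F, P (Y ⁻¹' B D) ≤ p) :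
    P {ω | X ω ∈ F ∧ Y ω ∈ B (X ω)} ≤ p := by
  have hsub : {ω | X ω ∈ F ∧ Y ω ∈ B (X ω)} ⊆ ⋃ D ∈ F, X ⁻¹' {D} ∩ Y ⁻¹' B D := by
    rintro ω ⟨h1, h2⟩
    exact Set.mem_biUnion h1 ⟨rfl, h2⟩
  have hdisj : (F : Set α).PairwiseDisjoint fun D => X ⁻¹' {D} := fun a _ b _ hab =>
    Disjoint.preimage X (Set.disjoint_singleton.2 hab)
  calc P {ω | X ω ∈ F ∧ Y ω ∈ B (X ω)} ≤ ∑ D ∈ F, P (X ⁻¹' {D} ∩ Y ⁻¹' B D) :=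
        (measure_mono hsub).trans (measure_biUnion_finset_le _ _)
    _ ≤ ∑ D ∈ F, P (X ⁻¹' {D}) * p := Finset.sum_le_sum fun D hD => by
        rw [hXY.measure_inter_preimage_eq_mul _ _ (measurableSet_singleton D) (hB D hD)]
        exact mul_le_mul_right (hp D hD) _
    _ = P (⋃ D ∈ F, X ⁻¹' {D}) * p := by
        rw [← Finset.sum_mul, measure_biUnion_finset hdisj fun D _ => hX (measurableSet_singleton D)]
    _ ≤ 1 * p := mul_le_mul_left prob_le_one _
    _ = p := one_mul p

open scoped BigOperators in
/-- Probabilities for independent Rademacher variables are averages over sign patterns. -/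
lemma measure_signVec_mem_le {ι : Type*} [Fintype ι] [DecidableEq ι] {Y : ι → Ω → ℝ}
    (hY : iIndepFun Y P) (h1 : ∀ q, P {ω | Y q ω = 1} = 1 / 2)
    (h2 : ∀ q, P {ω | Y q ω = -1} = 1 / 2) (A : Set (ι → ℤˣ)) :
    P {ω | (fun q => Y q ω) ∈ signVec '' A} ≤
      ENNReal.ofReal (𝔼 θ : ι → ℤˣ, Set.indicator A (fun _ => (1 : ℝ)) θ) := by
  classical
  have hpt : ∀ θ : ι → ℤˣ, P (⋂ q ∈ Finset.univ, Y q ⁻¹' {signVec θ q}) =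
      (1 / 2) ^ Fintype.card ι := fun θ => by
    rw [hY.measure_inter_preimage_eq_mul _ fun q _ => measurableSet_singleton _]
    rw [← Finset.card_univ, ← Finset.prod_const]
    refine Finset.prod_congr rfl fun q _ => ?_
    rcases Int.units_eq_one_or (θ q) with h | h
    · have : signVec θ q = 1 := by simp [signVec, h]
      rw [this]; exact h1 q
    · have : signVec θ q = -1 := by simp [signVec, h]
      rw [this]; exact h2 q
  have hsub : {ω | (fun q => Y q ω) ∈ signVec '' A} ⊆
      ⋃ θ ∈ Finset.univ.filter (· ∈ A), ⋂ q ∈ Finset.univ, Y q ⁻¹' {signVec θ q} := by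
    rintro ω ⟨θ, hθ, hω⟩
    refine Set.mem_biUnion (Finset.mem_coe.2 (Finset.mem_filter.2 ⟨Finset.mem_univ θ, hθ⟩)) ?_
    exact Set.mem_iInter₂.2 fun q _ => (congrFun hω q).symm
  refine (measure_mono hsub).trans ((measure_biUnion_finset_le _ _).trans ?_)
  rw [Finset.sum_congr rfl fun θ _ => hpt θ, Finset.sum_const, Finset.expect_eq_sum_div_card,
    Finset.card_univ, Fintype.card_fun, Fintype.card_units_int, Finset.sum_indicator_eq_sum_filter]
  simp only [Finset.sum_const, nsmul_eq_mul, mul_one, Nat.cast_pow, Nat.cast_ofNat]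
  rw [ENNReal.ofReal_div_of_pos (by positivity), ENNReal.ofReal_natCast,
    ENNReal.ofReal_pow (by norm_num), ENNReal.ofReal_ofNat, one_div, ← ENNReal.inv_pow, div_eq_mul_inv]

/-- Markov's inequality at level e³A gains e^{-3k}, of which the prefactor `c` consumes at most e^k.
-/
lemma measure_pow_le_of_integral_le [IsProbabilityMeasure P] {F : Ω → ℝ} (hF0 : ∀ ω, 0 ≤ F ω)
    (hF : Integrable F P) {c A : ℝ} {k : ℕ} (hA : 0 < A) (hle : ∫ ω, F ω ∂P ≤ c * A ^ k)
    (hc : c ≤ Real.exp k) :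
    P {ω | (Real.exp 1 ^ 3 * A) ^ k ≤ F ω} ≤ ENNReal.ofReal (Real.exp (-(2 * k))) := by
  have h1 := mul_meas_ge_le_integral_of_nonneg (Filter.Eventually.of_forall hF0) hF
    ((Real.exp 1 ^ 3 * A) ^ k)
  rw [← ofReal_measureReal]
  refine ENNReal.ofReal_le_ofReal ?_
  have e : (Real.exp 1 ^ 3 * A) ^ k = Real.exp (3 * k) * A ^ k := by
    rw [mul_pow, ← Real.exp_nat_mul, ← Real.exp_nat_mul]
    congr 2
    push_cast; ring
  set r := P.real {ω | (Real.exp 1 ^ 3 * A) ^ k ≤ F ω}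
  have h2 : A ^ k * (Real.exp (3 * k) * r) ≤ A ^ k * Real.exp k := by
    calc A ^ k * (Real.exp (3 * k) * r) = (Real.exp 1 ^ 3 * A) ^ k * r := by rw [e]; ring
      _ ≤ c * A ^ k := h1.trans hle
      _ ≤ _ := by
        rw [mul_comm]
        exact mul_le_mul_of_nonneg_left hc (by positivity)
  have h3 := le_of_mul_le_mul_left h2 (by positivity)
  have h4 : Real.exp (k : ℝ) = Real.exp (3 * k) * Real.exp (-(2 * k)) := by
    rw [← Real.exp_add]; congr 1; ring
  rw [h4] at h3
  exact le_of_mul_le_mul_left h3 (Real.exp_pos _)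

end Conditioning

/-! ### The sign tail for a fixed good pattern. -/

section SignTail

open scoped BigOperators

variable {m n : ℕ} {E : Submodule ℝ (EuclideanSpace ℝ (Fin n))} {D : Fin m → Fin n → ℝ} {s : ℕ}

/-- The sign tail for a pattern whose row statistics are controlled. -/
theorem expect_sjltBilin_tail_le (hs : 1 ≤ s) (hm : 1 ≤ m) (hdim : 1 ≤ Module.finrank ℝ E)
    (hD : ∀ i j, D i j = 0 ∨ D i j = 1) (hcol : ∀ j, ∑ i, D i j = s) {α β h ε : ℝ} {κ : ℕ}
    (hα0 : 0 < α) (hα : ∀ i, rowMass E (D i) ≤ α) (hβ0 : 0 ≤ β)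
    (hβ : ∀ i, ∀ x : E, ‖x‖ = 1 → ∑ j, D i j * x.1 j ^ 2 ≤ β) (hε : 0 < ε) (hε1 : ε < 1)
    (hκ : 2 ^ κ ≤ 2 * h) (hαh : h * (α / s) ≤ 135 * (ε ^ 2 / 10 ^ 20))
    (hαβ : Real.log (Module.finrank ℝ E / ε) ^ 2 * ((5 * α + 4 * β * Real.log m) / s) ≤
      1755 * (ε ^ 2 / 10 ^ 20)) :
    𝔼 θ : Fin m × Fin n → ℤˣ, Set.indicator {θ | ∃ x ∈ unitSphereOf E,
      ε / 2 ≤ |‖sjltBilin s D x (signVec θ)‖ ^ 2 - 1|} (fun _ => (1 : ℝ)) θ ≤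
        Real.exp (-(2 * 2 ^ κ)) := by
  have hs0 : (0 : ℝ) < s := by exact_mod_cast hs
  have hlog : 0 ≤ Real.log m := Real.log_nonneg (by exact_mod_cast hm)
  have hd1 : (1 : ℝ) ≤ Module.finrank ℝ E := by exact_mod_cast hdim
  have hαs : 0 ≤ α / s := by positivity
  have hΔ : √2 ^ κ * √(α / s) ≤ ε / 10 ^ 8 := by
    refine le_of_sq_le_sq ?_ (by positivity)
    rw [mul_pow, ← pow_mul, mul_comm κ 2, pow_mul, Real.sq_sqrt (by norm_num), Real.sq_sqrt hαs]
    calc (2 : ℝ) ^ κ * (α / s) ≤ 2 * h * (α / s) := by gcongr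
      _ ≤ 270 * (ε ^ 2 / 10 ^ 20) := by linarith
      _ ≤ (ε / 10 ^ 8) ^ 2 := by rw [div_pow]; linarith [sq_nonneg ε]
  have hΔ' : √(α / s) ≤ ε / 10 ^ 8 :=
    (le_mul_of_one_le_left (Real.sqrt_nonneg _)
      (one_le_pow₀ (Real.one_le_sqrt.2 (by norm_num)))).trans hΔ
  obtain ⟨γ, hγ0, hγε, hγ⟩ : ∃ γ : ℝ, 0 ≤ γ ∧ γ ≤ ε / 10 ^ 5 ∧
      gammaTwo (unitSphereOf E) (deltaDist s D) < ENNReal.ofReal γ := by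
    rcases lt_or_ge (Module.finrank ℝ E / ε : ℝ) 2 with hdε | hdε
    · rw [div_lt_iff₀ hε] at hdε
      have hE : Module.finrank ℝ E = 1 := by
        have : (Module.finrank ℝ E : ℝ) < 2 := by linarith
        have : Module.finrank ℝ E < 2 := by exact_mod_cast this
        omega
      refine ⟨ε / 10 ^ 5, by positivity, le_rfl,
        (gammaTwo_unitSphereOf_line_le E hE hs hD hα hα0.le).trans_lt
          ((ENNReal.ofReal_lt_ofReal_iff (by positivity)).2 ?_)⟩
      linarith
    · set ℓ := Real.log (Module.finrank ℝ E / ε) with hℓ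
      have hℓ2 : Real.log 2 ≤ ℓ := Real.log_le_log (by norm_num) hdε
      have hlog2 : 0 < Real.log 2 := Real.log_pos (by norm_num)
      -- γ₂ has to be a small multiple of ε, so the net resolution is lowered to ε/2^22. As ℓ ≥ log
      -- 2, this inflates the logarithm at most 23 times.
      have hℓ' : Real.log (Module.finrank ℝ E / (ε / 2 ^ 22)) = ℓ + 22 * Real.log 2 := by
        rw [← div_mul, Real.log_mul (by positivity) (by positivity), Real.log_pow, hℓ]
        norm_num
      have hQ : 0 < (5 * α + 4 * β * Real.log m) / s := by positivity
      have hG : Real.log (Module.finrank ℝ E / (ε / 2 ^ 22)) *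
          √((5 * α + 4 * β * Real.log m) / s) ≤ ε / 10 ^ 7 := by
        refine le_of_sq_le_sq ?_ (by positivity)
        rw [mul_pow, Real.sq_sqrt hQ.le, hℓ']
        calc (ℓ + 22 * Real.log 2) ^ 2 * ((5 * α + 4 * β * Real.log m) / s)
            ≤ (23 * ℓ) ^ 2 * ((5 * α + 4 * β * Real.log m) / s) := by
              gcongr <;> linarith
          _ = 529 * (ℓ ^ 2 * ((5 * α + 4 * β * Real.log m) / s)) := by ring
          _ ≤ 529 * (1755 * (ε ^ 2 / 10 ^ 20)) := by gcongr
          _ ≤ (ε / 10 ^ 7) ^ 2 := by rw [div_pow]; linarith [sq_nonneg ε]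
      refine ⟨ε / 10 ^ 5, by positivity, le_rfl,
        (gammaTwo_unitSphereOf_le E hs hm hD hα hβ hβ0 (Real.sqrt_pos.2 hQ)
          (Real.sq_sqrt hQ.le).ge (ε := ε / 2 ^ 22) (by positivity) ?_).trans_lt
          ((ENNReal.ofReal_lt_ofReal_iff (by positivity)).2 ?_)⟩
      · refine hdε.trans (div_le_div_of_nonneg_left (by linarith) (by positivity) ?_)
        exact div_le_self hε.le (by norm_num)
      · linarith
  refine expect_chaos_tail_le (ρ := deltaNorm s D) (fun x z => sum_inner_sjltBilin_single_sq_le hD x z)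
    (fun x => deltaNorm_nonneg s x) (deltaNorm_zero s) (fun x y => deltaNorm_sub_le hs hD x y)
    (fun y hy => ?_) (Δ := √(α / s)) (γ := γ)
    (fun y hy => deltaNorm_le_sqrt_rowMass E hs hD hα hα0.le hy) (Real.sqrt_nonneg _) hγ0 hγ
    (by linarith) (by linarith) ?_
  · rw [sum_norm_sjltBilin_single_sq hs hD hcol, hy.2, one_pow]
  · linarith

end SignTail

/-! ### The subspace embedding with high probability. -/

section SubspaceEmbedding

variable {m n : ℕ} {E : Submodule ℝ (EuclideanSpace ℝ (Fin n))}

/-- Row statistics in the regime of the subspace embedding theorem. -/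
lemma row_statistics_le {d m s μ ℓ lm h e k lam : ℝ} (hd : 0 ≤ d) (hm : 0 < m) (hs : 0 < s)
    (hh : 0 ≤ h) (hlm : 1 / 2 ≤ lm) (hk : k ≤ 4 * h) (hlam : lam ≤ 27)
    (hk0 : 0 ≤ k) (he : 0 ≤ e)
    (hM : (d + lm) * ℓ ^ 2 + d * h ≤ e * m) (hS : (lm * h * ℓ ^ 2 + h ^ 2) * μ ^ 2 ≤ e * s) :
    h * (lam * (s / m * d + k * μ ^ 2) / s) ≤ 135 * e ∧
      ℓ ^ 2 * ((5 * (lam * (s / m * d + k * μ ^ 2)) +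
        4 * (lam * (s / m + k * μ ^ 2)) * lm) / s) ≤ 1755 * e := by
  have hu : 0 ≤ d / m := by positivity
  have hw : 0 ≤ μ ^ 2 / s := by positivity
  have ht : 0 ≤ lm / m := by positivity
  have hM' : ℓ ^ 2 * (d / m) + ℓ ^ 2 * (lm / m) + h * (d / m) ≤ e := by
    calc _ = ((d + lm) * ℓ ^ 2 + d * h) / m := by ring
      _ ≤ e := (div_le_iff₀ hm).2 hM
  have hS' : lm * h * ℓ ^ 2 * (μ ^ 2 / s) + h ^ 2 * (μ ^ 2 / s) ≤ e := by
    calc _ = (lm * h * ℓ ^ 2 + h ^ 2) * μ ^ 2 / s := by ring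
      _ ≤ e := (div_le_iff₀ hs).2 hS
  have p1 : 0 ≤ ℓ ^ 2 * (d / m) := by positivity
  have p2 : 0 ≤ ℓ ^ 2 * (lm / m) := by positivity
  have p3 : 0 ≤ h * (d / m) := by positivity
  have p4 : 0 ≤ lm * h * ℓ ^ 2 * (μ ^ 2 / s) := by positivity
  have p5 : 0 ≤ h ^ 2 * (μ ^ 2 / s) := by positivity
  have q1 : h * (k * (μ ^ 2 / s)) ≤ 4 * (h ^ 2 * (μ ^ 2 / s)) := by
    calc h * (k * (μ ^ 2 / s)) ≤ h * (4 * h * (μ ^ 2 / s)) := by gcongr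
      _ = _ := by ring
  have q2 : ℓ ^ 2 * (lm * (k * (μ ^ 2 / s))) ≤ 4 * (lm * h * ℓ ^ 2 * (μ ^ 2 / s)) := by
    calc ℓ ^ 2 * (lm * (k * (μ ^ 2 / s))) ≤ ℓ ^ 2 * (lm * (4 * h * (μ ^ 2 / s))) := by gcongr
      _ = _ := by ring
  have q3 : ℓ ^ 2 * (k * (μ ^ 2 / s)) ≤ 8 * (lm * h * ℓ ^ 2 * (μ ^ 2 / s)) := by
    have : ℓ ^ 2 * (1 / 2 * (k * (μ ^ 2 / s))) ≤ ℓ ^ 2 * (lm * (k * (μ ^ 2 / s))) := by gcongr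
    linarith
  constructor
  · calc h * (lam * (s / m * d + k * μ ^ 2) / s) =
          lam * (h * (d / m) + h * (k * (μ ^ 2 / s))) := by field_simp
      _ ≤ 27 * (h * (d / m) + h * (k * (μ ^ 2 / s))) := by gcongr
      _ ≤ 135 * e := by linarith
  · calc ℓ ^ 2 * ((5 * (lam * (s / m * d + k * μ ^ 2)) +
          4 * (lam * (s / m + k * μ ^ 2)) * lm) / s) =
          lam * (5 * (ℓ ^ 2 * (d / m)) + 5 * (ℓ ^ 2 * (k * (μ ^ 2 / s))) +
            4 * (ℓ ^ 2 * (lm / m)) + 4 * (ℓ ^ 2 * (lm * (k * (μ ^ 2 / s))))) := by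
            field_simp; ring
      _ ≤ 27 * (5 * (ℓ ^ 2 * (d / m)) + 5 * (ℓ ^ 2 * (k * (μ ^ 2 / s))) +
            4 * (ℓ ^ 2 * (lm / m)) + 4 * (ℓ ^ 2 * (lm * (k * (μ ^ 2 / s))))) := by gcongr
      _ ≤ 1755 * e := by linarith

variable {Ω : Type*} [MeasurableSpace Ω] {P : Measure Ω} [IsProbabilityMeasure P] {s : ℕ}
  {δ σ : Fin m → Fin n → Ω → ℝ}

/-- Without rows the column sums would be 0 instead of s, and a nonzero E guarantees that a column
exists. -/
lemma IsSJLTData.one_le_rows (h : IsSJLTData P s δ σ) (hs : 1 ≤ s)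
    (hdim : 1 ≤ Module.finrank ℝ E) : 1 ≤ m := by
  have hn : 1 ≤ n := by
    have := Submodule.finrank_le E
    rw [finrank_euclideanSpace_fin] at this
    omega
  obtain ⟨ω, hω⟩ := (h.pattern_col_sum ⟨0, hn⟩).exists
  by_contra hm
  obtain rfl : m = 0 := by omega
  simp only [Finset.univ_eq_empty, Finset.sum_empty] at hω
  have : s = 0 := by exact_mod_cast hω.symm
  omega

lemma IsSJLTData.ae_sign (h : IsSJLTData P s δ σ) (i : Fin m) (j : Fin n) :
    ∀ᵐ ω ∂P, σ i j ω = 1 ∨ σ i j ω = -1 := by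
  have hm1 : MeasurableSet {ω | σ i j ω = 1} := h.measurable_sign i j (measurableSet_singleton 1)
  have hm2 : MeasurableSet {ω | σ i j ω = -1} :=
    h.measurable_sign i j (measurableSet_singleton (-1))
  have hd : Disjoint {ω | σ i j ω = 1} {ω | σ i j ω = -1} := by
    rw [Set.disjoint_left]
    intro ω (h1 : σ i j ω = 1) (h2 : σ i j ω = -1)
    rw [h1] at h2
    norm_num at h2
  have hu : P ({ω | σ i j ω = 1} ∪ {ω | σ i j ω = -1}) = 1 := by
    rw [measure_union hd hm2, h.sign_one, h.sign_neg_one, ENNReal.add_halves]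
  have := (prob_compl_eq_zero_iff (hm1.union hm2)).2 hu
  exact this

/-- The failure probability of the restricted isometry estimate, given the moment parameters. -/
theorem IsSJLTData.measure_not_restrictedIsometry_le (H : IsSJLTData P s δ σ) (hs : 1 ≤ s)
    (hm : 1 ≤ m) (hdim : 1 ≤ Module.finrank ℝ E) (hdm : Module.finrank ℝ E ≤ m) {h ε : ℝ}
    {k κ : ℕ} (hk : k ≠ 0) (hmk : (m : ℝ) ^ 2 ≤ Real.exp k) (hε : 0 < ε) (hε1 : ε < 1)
    (hκ : 2 ^ κ ≤ 2 * h)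
    (hαh : h * (Real.exp 1 ^ 3 * ((s : ℝ) / m * Module.finrank ℝ E + k * incoherence E ^ 2) / s) ≤
      135 * (ε ^ 2 / 10 ^ 20))
    (hαβ : Real.log (Module.finrank ℝ E / ε) ^ 2 *
      ((5 * (Real.exp 1 ^ 3 * ((s : ℝ) / m * Module.finrank ℝ E + k * incoherence E ^ 2)) +
        4 * (Real.exp 1 ^ 3 * ((s : ℝ) / m + k * incoherence E ^ 2)) * Real.log m) / s) ≤
      1755 * (ε ^ 2 / 10 ^ 20)) :
    P {ω | restrictedIsometryConst (sjltMatrix s (fun i j => δ i j ω) (fun i j => σ i j ω))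
        (unitSphereOf E) < ENNReal.ofReal ε}ᶜ ≤
      ENNReal.ofReal (Real.exp (-(2 * k))) + ENNReal.ofReal (Real.exp (-(2 * k))) +
        ENNReal.ofReal (Real.exp (-(2 * 2 ^ κ))) := by
  classical
  have hs0 : (0 : ℝ) < s := by exact_mod_cast hs
  have hm0 : (0 : ℝ) < m := by exact_mod_cast hm
  have hm1 : (1 : ℝ) ≤ m := by exact_mod_cast hm
  have hd0 : (0 : ℝ) < Module.finrank ℝ E := by exact_mod_cast hdim
  have hdm' : (Module.finrank ℝ E : ℝ) ≤ m := by exact_mod_cast hdm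
  set α₀ := (s : ℝ) / m * Module.finrank ℝ E + k * incoherence E ^ 2 with hα₀
  set β₀ := (s : ℝ) / m + k * incoherence E ^ 2 with hβ₀
  have hα₀0 : 0 < α₀ := by positivity
  have hβ₀0 : 0 < β₀ := by positivity
  have hB1 := measure_pow_le_of_integral_le (P := P)
    (fun ω => massMoment_nonneg (E := E) (fun i j => H.pattern_nonneg i j ω) k)
    (H.integrable_massMoment k) (c := m) hα₀0 (H.integral_massMoment_le k)
    ((le_self_pow₀ hm1 two_ne_zero).trans hmk)
  have hB2 := measure_pow_le_of_integral_le (P := P)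
    (fun ω => frameMoment_nonneg (E := E) (fun i j => H.pattern_nonneg i j ω) k)
    (H.integrable_frameMoment k) (c := m * Module.finrank ℝ E) hβ₀0
    ((H.integral_frameMoment_le k).trans_eq (by ring))
    (le_trans (by rw [sq]; gcongr) hmk)
  -- Good patterns form a finite set, so conditioning on δ is a finite sum over its values.
  set good : Set (Fin m × Fin n → ℝ) := {D | (∀ q, D q ∈ ({0, 1} : Set ℝ)) ∧
    (∀ j, ∑ i, D (i, j) = s) ∧ massMoment E k (fun i j => D (i, j)) < (Real.exp 1 ^ 3 * α₀) ^ k ∧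
    frameMoment E k (fun i j => D (i, j)) < (Real.exp 1 ^ 3 * β₀) ^ k} with hgood
  have hfin : good.Finite :=
    (Set.Finite.pi' fun _ => Set.toFinite ({0, 1} : Set ℝ)).subset fun D hD => hD.1
  set bad : (Fin m × Fin n → ℝ) → Set (Fin m × Fin n → ℤˣ) := fun D => {θ | ∃ x ∈ unitSphereOf E,
    ε / 2 ≤ |‖sjltBilin s (fun i j => D (i, j)) x (signVec θ)‖ ^ 2 - 1|} with hbad
  have hB3 : P {ω | (fun q : Fin m × Fin n => δ q.1 q.2 ω) ∈ hfin.toFinset ∧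
      (fun q : Fin m × Fin n => σ q.1 q.2 ω) ∈
        signVec '' bad (fun q : Fin m × Fin n => δ q.1 q.2 ω)} ≤
      ENNReal.ofReal (Real.exp (-(2 * 2 ^ κ))) := by
    refine measure_mem_fiber_le H.pattern_indep_sign
      (measurable_pi_lambda _ fun q => H.measurable_pattern q.1 q.2) hfin.toFinset
      (B := fun D => signVec '' bad D)
      (fun D _ => ((Set.toFinite (bad D)).image signVec).measurableSet) fun D hD => ?_
    obtain ⟨h01, hcol, hmass, hframe⟩ := hfin.mem_toFinset.1 hD
    have h01' : ∀ i j, D (i, j) = 0 ∨ D (i, j) = 1 := fun i j => by simpa using h01 (i, j)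
    have hD0 : ∀ i j, 0 ≤ D (i, j) := fun i j => by
      rcases h01' i j with h | h <;> simp [h]
    refine (measure_signVec_mem_le H.sign_indep (fun q => H.sign_one q.1 q.2)
      (fun q => H.sign_neg_one q.1 q.2) (bad D)).trans (ENNReal.ofReal_le_ofReal ?_)
    refine expect_sjltBilin_tail_le hs hm hdim h01' hcol (α := Real.exp 1 ^ 3 * α₀)
      (β := Real.exp 1 ^ 3 * β₀) (by positivity) (fun i => ?_) (by positivity) (fun i x hx => ?_)
      hε hε1 hκ hαh hαβ
    · exact le_of_pow_le_pow_left₀ hk (by positivity)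
        ((rowMass_pow_le_massMoment hD0 k i).trans hmass.le)
    · exact le_of_pow_le_pow_left₀ hk (by positivity)
        ((sum_mul_sq_pow_le_frameMoment hD0 k i hx).trans hframe.le)
  have hN1 : P {ω | ∀ j, ∑ i, δ i j ω = s}ᶜ = 0 := ae_all_iff.2 H.pattern_col_sum
  have hN2 : P {ω | ∀ i j, σ i j ω = 1 ∨ σ i j ω = -1}ᶜ = 0 :=
    ae_all_iff.2 fun i => ae_all_iff.2 fun j => H.ae_sign i j
  have hsub : {ω | restrictedIsometryConst (sjltMatrix s (fun i j => δ i j ω) (fun i j => σ i j ω))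
        (unitSphereOf E) < ENNReal.ofReal ε}ᶜ ⊆
      ({ω | ∀ j, ∑ i, δ i j ω = s}ᶜ ∪ {ω | ∀ i j, σ i j ω = 1 ∨ σ i j ω = -1}ᶜ) ∪
      (({ω | (Real.exp 1 ^ 3 * α₀) ^ k ≤ massMoment E k (fun i j => δ i j ω)} ∪
        {ω | (Real.exp 1 ^ 3 * β₀) ^ k ≤ frameMoment E k (fun i j => δ i j ω)}) ∪
      {ω | (fun q : Fin m × Fin n => δ q.1 q.2 ω) ∈ hfin.toFinset ∧
        (fun q : Fin m × Fin n => σ q.1 q.2 ω) ∈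
          signVec '' bad (fun q : Fin m × Fin n => δ q.1 q.2 ω)}) := by
    intro ω hω
    by_contra hcon
    simp only [Set.mem_union, not_or, Set.notMem_compl_iff] at hcon
    obtain ⟨⟨hcol, hsign⟩, ⟨hmass, hframe⟩, hrest⟩ := hcon
    have hmem : (fun q : Fin m × Fin n => δ q.1 q.2 ω) ∈ good :=
      ⟨fun q => by simpa using H.pattern_zero_one q.1 q.2 ω, hcol, not_le.1 hmass, not_le.1 hframe⟩
    have hθ : ∃ θ : Fin m × Fin n → ℤˣ, signVec θ = fun q => σ q.1 q.2 ω := by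
      refine ⟨fun q => if σ q.1 q.2 ω = 1 then 1 else -1, funext fun q => ?_⟩
      rcases hsign q.1 q.2 with h | h
      · simp [signVec, h]
      · have : ¬ (-1 : ℝ) = 1 := by norm_num
        simp [signVec, h, this]
    obtain ⟨θ, hθ⟩ := hθ
    -- The bad sign patterns are defined with ε/2, so that a supremum of non-strict bounds is still
    -- strictly below ε.
    refine hω (lt_of_le_of_lt (iSup₂_le fun x hx => ?_)
      ((ENNReal.ofReal_lt_ofReal_iff hε).2 (half_lt_self hε)))
    rw [toLp_sjltMatrix_mulVec, ← hθ]
    refine ENNReal.ofReal_le_ofReal (le_of_not_ge fun hge => hrest ⟨hfin.mem_toFinset.2 hmem, ?_⟩)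
    exact ⟨θ, ⟨x, hx, hge⟩, hθ⟩
  refine (measure_mono hsub).trans ((measure_union_le _ _).trans ?_)
  rw [measure_union_null hN1 hN2, zero_add]
  exact (measure_union_le _ _).trans (add_le_add ((measure_union_le _ _).trans (add_le_add hB1 hB2))
    hB3)

/-- Restricted isometry with high probability. -/
theorem IsSJLTData.restrictedIsometry (H : IsSJLTData P s δ σ) (hs : 1 ≤ s)
    (hdim : 1 ≤ Module.finrank ℝ E) {ε η : ℝ} (hε : 0 < ε) (hε1 : ε < 1) (hη : 0 < η)
    (hηm : η ≤ 1 / m) (hη2 : η ≤ 1 / 2)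
    (hM : 10 ^ 20 * (((Module.finrank ℝ E + Real.log m) *
      min (Real.log (Module.finrank ℝ E / ε) ^ 2) (Real.log m ^ 2) +
        Module.finrank ℝ E * Real.log η⁻¹) / ε ^ 2) ≤ m)
    (hS : 10 ^ 20 * ((Real.log m * Real.log η⁻¹ *
      min (Real.log (Module.finrank ℝ E / ε) ^ 2) (Real.log m ^ 2) + Real.log η⁻¹ ^ 2) *
        incoherence E ^ 2 / ε ^ 2) ≤ s) :
    ENNReal.ofReal (1 - η) ≤
      P {ω | restrictedIsometryConst (sjltMatrix s (fun i j => δ i j ω) (fun i j => σ i j ω))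
        (unitSphereOf E) < ENNReal.ofReal ε} := by
  have hm : 1 ≤ m := H.one_le_rows hs hdim
  have hs0 : (0 : ℝ) < s := by exact_mod_cast hs
  have hm0 : (0 : ℝ) < m := by exact_mod_cast hm
  have hd1 : (1 : ℝ) ≤ Module.finrank ℝ E := by exact_mod_cast hdim
  have hε2 : 0 < ε ^ 2 := by positivity
  set d : ℝ := (Module.finrank ℝ E : ℝ) with hd
  set h := Real.log η⁻¹ with hh
  have hlm0 : 0 ≤ Real.log m := Real.log_nonneg (by exact_mod_cast hm)
  have hh2 : Real.log 2 ≤ h := Real.log_le_log (by norm_num) (by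
    rw [le_inv_comm₀ (by norm_num) hη]; simpa using hη2)
  have hh1 : 1 / 2 ≤ h := by linarith [Real.log_two_gt_d9]
  have hlmh : Real.log m ≤ h := Real.log_le_log hm0 (by
    rw [le_inv_comm₀ hm0 hη]; simpa using hηm)
  rw [← mul_div_assoc, div_le_iff₀ hε2] at hM hS
  have hmin0 : 0 ≤ min (Real.log (d / ε) ^ 2) (Real.log m ^ 2) :=
    le_min (sq_nonneg _) (sq_nonneg _)
  -- The term d·log(1/η)/ε² of the hypothesis on m, together with log(1/η) ≥ 1/2, already forces d/ε
  -- ≤ m; hence the minimum is log²(d/ε).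
  have hdεm : d / ε ≤ m := by
    rw [div_le_iff₀ hε]
    have h1 : 0 ≤ (d + Real.log m) * min (Real.log (d / ε) ^ 2) (Real.log m ^ 2) := by positivity
    have h2 : d * (1 / 2) ≤ d * h := by gcongr
    have h3 : (m : ℝ) * ε ^ 2 ≤ m * ε := by
      gcongr
      nlinarith
    linarith
  have hdm : d ≤ m := (le_div_self (by linarith) hε hε1.le).trans hdεm
  have hdm' : Module.finrank ℝ E ≤ m := Nat.cast_le.1 hdm
  have hm2 : (2 : ℝ) ≤ m := by
    have h1 : 0 ≤ (d + Real.log m) * min (Real.log (d / ε) ^ 2) (Real.log m ^ 2) := by positivity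
    have h2 : 1 * (1 / 2) ≤ d * h := by gcongr
    have h3 : (m : ℝ) * ε ^ 2 ≤ m * 1 := by
      gcongr
      nlinarith
    linarith
  have hlm : 1 / 2 ≤ Real.log m := by
    have := Real.log_le_log (by norm_num) hm2
    linarith [Real.log_two_gt_d9]
  have hdε1 : 1 ≤ d / ε := hd1.trans (le_div_self (by linarith) hε hε1.le)
  have hmin : min (Real.log (d / ε) ^ 2) (Real.log m ^ 2) = Real.log (d / ε) ^ 2 :=
    min_eq_left (pow_le_pow_left₀ (Real.log_nonneg hdε1)
      (Real.log_le_log (by positivity) hdεm) 2)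
  rw [hmin] at hM hS
  -- The moment order ⌈2h⌉ with h = log(1/η) ≥ log m gives m² ≤ e^k for the prefactors and a failure
  -- probability of at most η⁴ for each row statistic.
  have hk4 : (⌈2 * h⌉₊ : ℝ) ≤ 4 * h := by
    have := Nat.ceil_lt_add_one (by linarith : 0 ≤ 2 * h)
    linarith
  have hkh : 2 * h ≤ ⌈2 * h⌉₊ := Nat.le_ceil _
  -- The chaos is chained from the dyadic level with 2^κ ≤ 2h < 2^{κ+1}: the lower bound makes its
  -- tail at most η², the upper one keeps the diameter term within the hypotheses. In total 2η⁴ + η²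
  -- ≤ η.
  obtain ⟨κ, hκ1, hκ2⟩ := exists_nat_pow_near (show (1 : ℝ) ≤ 2 * h by linarith)
    (by norm_num : (1 : ℝ) < 2)
  have he3 : Real.exp 1 ^ 3 ≤ 27 := by
    calc Real.exp 1 ^ 3 ≤ 3 ^ 3 := by
          gcongr
          exact Real.exp_one_lt_three.le
      _ = 27 := by norm_num
  have hstat := row_statistics_le (d := d) (m := m) (s := s) (μ := incoherence E)
    (ℓ := Real.log (d / ε)) (lm := Real.log m) (h := h) (e := ε ^ 2 / 10 ^ 20)
    (k := ⌈2 * h⌉₊) (lam := Real.exp 1 ^ 3) (by linarith) hm0 hs0 (by linarith) hlm hk4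
    he3 (by positivity) (by positivity) (by linarith) (by linarith)
  have key := H.measure_not_restrictedIsometry_le hs hm hdim hdm' (k := ⌈2 * h⌉₊)
    (Nat.ceil_pos.2 (by linarith)).ne' (by
      have h1 : (m : ℝ) = Real.exp (Real.log m) := (Real.exp_log hm0).symm
      rw [h1, ← Real.exp_nat_mul]
      exact Real.exp_le_exp.2 (by push_cast; linarith)) hε hε1 hκ1 hstat.1 hstat.2
  have hηexp : Real.exp (-h) = η := by rw [hh, Real.log_inv, neg_neg, Real.exp_log hη]
  have hprob : Real.exp (-(2 * (⌈2 * h⌉₊ : ℝ))) + Real.exp (-(2 * (⌈2 * h⌉₊ : ℝ))) +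
      Real.exp (-(2 * 2 ^ κ)) ≤ η := by
    have h1 : Real.exp (-(2 * (⌈2 * h⌉₊ : ℝ))) ≤ η ^ 4 := by
      rw [← hηexp, ← Real.exp_nat_mul]
      exact Real.exp_le_exp.2 (by push_cast; linarith)
    have h2 : Real.exp (-(2 * 2 ^ κ)) ≤ η ^ 2 := by
      rw [← hηexp, ← Real.exp_nat_mul]
      refine Real.exp_le_exp.2 ?_
      rw [pow_succ] at hκ2
      push_cast
      linarith
    have h3 : η ^ 2 ≤ η * (1 / 2) := by rw [sq]; gcongr
    have h4 : η ^ 4 ≤ η * (1 / 4) := by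
      calc η ^ 4 = η ^ 2 * η ^ 2 := by ring
        _ ≤ η * (1 / 2) * (η * (1 / 2)) := by gcongr
        _ = η * (1 / 4) * η := by ring
        _ ≤ η * (1 / 4) * 1 := by gcongr; linarith
        _ = _ := mul_one _
    linarith
  rw [← ENNReal.ofReal_add (by positivity) (by positivity),
    ← ENNReal.ofReal_add (by positivity) (by positivity)] at key
  have key' := key.trans (ENNReal.ofReal_le_ofReal hprob)
  rw [ENNReal.ofReal_sub _ hη.le, ENNReal.ofReal_one, tsub_le_iff_right]
  calc (1 : ℝ≥0∞) = P Set.univ := measure_univ.symm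
    _ ≤ _ := by
      rw [← Set.union_compl_self {ω | restrictedIsometryConst
        (sjltMatrix s (fun i j => δ i j ω) (fun i j => σ i j ω)) (unitSphereOf E) <
          ENNReal.ofReal ε}]
      exact (measure_union_le _ _).trans (add_le_add_right key' _)

end SubspaceEmbedding
-- Assembly of the four statements.
theorem mainTheorem2 :
    ∃ C : ℝ, 0 < C ∧
      ∀ (n m s d : ℕ) (_ : 1 ≤ s) (_ : 1 ≤ d)
        (E : Submodule ℝ (EuclideanSpace ℝ (Fin n))) (_ : Module.finrank ℝ E = d)
        (Ω : Type*) [MeasurableSpace Ω] (P : Measure Ω) [IsProbabilityMeasure P]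
        (δ σ : Fin m → Fin n → Ω → ℝ) (_ : IsSJLTData P s δ σ),
        -- moment bounds for `γ₂(T, ‖·‖_δ)` and the diameter
        (∀ p ε : ℝ, 0 < p → Real.log m ≤ p → 0 < ε → ε < 1 →
          (∫⁻ ω, gammaTwo (unitSphereOf E) (deltaDist s fun i j => δ i j ω) ^ (2 * p) ∂P) ^ (1 / p)
            ≤ ENNReal.ofReal (C * (ε ^ 2 + (d + Real.log m) * Real.log (d / ε) ^ 2 / m
                + p * Real.log (d / ε) ^ 2 * Real.log m / s * incoherence E ^ 2))) ∧
        (∀ p : ℝ, 0 < p → Real.log m ≤ p →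
          (∫⁻ ω, diamTwo (unitSphereOf E) (deltaDist s fun i j => δ i j ω) ^ (2 * p) ∂P) ^ (1 / p)
            ≤ ENNReal.ofReal (C * ((d : ℝ) / m + p / s * incoherence E ^ 2))) ∧
        -- the subspace embedding
        (∀ ε η : ℝ, 0 < ε → ε < 1 → 0 < η → η ≤ 1 / m → η ≤ 1 / 2 →
          C * (((d + Real.log m) * min (Real.log (d / ε) ^ 2) (Real.log m ^ 2)
            + d * Real.log η⁻¹) / ε ^ 2) ≤ m →
          C * ((Real.log m * Real.log η⁻¹ * min (Real.log (d / ε) ^ 2) (Real.log m ^ 2)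
            + Real.log η⁻¹ ^ 2) * incoherence E ^ 2 / ε ^ 2) ≤ s →
          ENNReal.ofReal (1 - η) ≤
            P {ω | restrictedIsometryConst
              (sjltMatrix s (fun i j => δ i j ω) (fun i j => σ i j ω)) (unitSphereOf E)
                < ENNReal.ofReal ε}) ∧
        -- column sparsity one for sufficiently incoherent subspaces
        (s = 1 → ∀ ε η : ℝ, 0 < ε → ε < 1 → 0 < η → η ≤ 1 / m → η ≤ 1 / 2 →
          C * (((d + Real.log m) * min (Real.log (d / ε) ^ 2) (Real.log m ^ 2)
            + d * Real.log η⁻¹) / ε ^ 2) ≤ m →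
          C * (Real.log m * Real.log η⁻¹ * min (Real.log (d / ε) ^ 2) (Real.log m ^ 2)
            + Real.log η⁻¹ ^ 2) * incoherence E ^ 2 ≤ ε ^ 2 →
          ENNReal.ofReal (1 - η) ≤
            P {ω | restrictedIsometryConst
              (sjltMatrix 1 (fun i j => δ i j ω) (fun i j => σ i j ω)) (unitSphereOf E)
                < ENNReal.ofReal ε}) := by
  -- The size of the constant is dictated by the embedding; the moment bounds need only 10^6 and 24.
  refine ⟨10 ^ 20, by positivity, ?_⟩
  rintro n m s _ hs hdim E rfl Ω _ P _ δ σ H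
  have hm : 1 ≤ m := H.one_le_rows hs hdim
  have hlog : 0 ≤ Real.log m := Real.log_nonneg (by exact_mod_cast hm)
  refine ⟨fun p ε hp hmp hε hε1 => ?_, fun p hp hmp => ?_, fun ε η hε hε1 hη hηm hη2 hM hS => ?_,
    ?_⟩
  · refine (H.lintegral_gammaTwo_rpow_le hs hm hdim hp hmp hε hε1).trans
      (ENNReal.ofReal_le_ofReal (mul_le_mul_of_nonneg_right (by norm_num) ?_))
    positivity
  · refine (H.lintegral_diamTwo_rpow_le hs hm hp hmp).trans
      (ENNReal.ofReal_le_ofReal (mul_le_mul_of_nonneg_right (by norm_num) ?_))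
    positivity
  · exact H.restrictedIsometry hs hdim hε hε1 hη hηm hη2 hM hS
  · rintro rfl ε η hε hε1 hη hηm hη2 hM hS
    refine H.restrictedIsometry le_rfl hdim hε hε1 hη hηm hη2 hM ?_
    rw [Nat.cast_one, ← mul_div_assoc, div_le_one (by positivity), ← mul_assoc]
    exact hS
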